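/- Let $K$ be a field of characteristic $0$ and let $\mathcal A=\{H_1,\dots,H_n\}$ be an essential central arrangement of $n$ distinct hyperplanes in $\mathbb C^l$, i.e. the $H_i$ are linear hyperplanes with $\bigcap_i H_i=\{0\}$; choose linear forms $\alpha_i$ with $\ker\alpha_i=H_i$. Let $E=K\langle e_1,\dots,e_n\rangle$ be the exterior algebra, let $J\subset E$ be the Orlik–Solomon ideal, i.e. the two-sided ideal generated by the elements $$\partial e_F=\sum_{j=1}^t(-1)^{j-1}e_{i_1}\wedge\dots\wedge\widehat{e_{i_j}}\wedge\dots\wedge e_{i_t}$$ for all $F=\{i_1<\dots<i_t\}\subseteq\{1,\dots,n\}$ such that $\alpha_{i_1},\dots,\alpha_{i_t}$ are linearly dependent, and let $A=E/J$ be the Orlik–Solomon algebra with its induced grading. For $u\in A_1$ let $H^p(A,u)$ be the cohomology in degree $p$ of the complex $0\to A_0\xrightarrow{\cdot u}A_1\xrightarrow{\cdot u}A_2\to\cdots$, and put $$R^p(A)=\{u\in A_1: H^p(A,u)\neq 0\},\qquad V_E(A)=\{u\in A_1:\{a\in A: ua=0\}\neq uA\}.$$ Suppose that $J\neq 0$ and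 that $J$ has a $d$-linear resolution over $E$, i.e. the graded Betti numbers $\beta_{i,i+j}^E(J)=\dim_K\operatorname{Tor}_i^E(K,J)_{i+j}$ vanish for all $i\ge 0$ and all $j\neq d$. Then 1. $R^p(A)=\{0\}$ for $0\le p\le d-2$; 2. $R^{d-1}(A)=V_E(A)$; 3. $V_E(A)$ is a linear subspace of $A_1$, and $R^{d-1}(A)=V_E(A)$ is irreducible in the Zariski topology of the $K$-vector space $A_1$. -/

import Mathlib

/-- A central arrangement of `n` hyperplanes in `ℂ^l`: pairwise distinct linear hyperplanes
(linear subspaces of codimension one) `H 0, …, H (n - 1)`. -/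
structure CentralArrangement (n l : ℕ) where
  H : Fin n → Submodule ℂ (Fin l → ℂ)
  isHyperplane : ∀ i, IsCoatom (H i)
  distinct : Function.Injective H

namespace CentralArrangement

variable {n l : ℕ}

/-- The arrangement is essential: its hyperplanes meet only in the origin. -/
def IsEssential (𝒜 : CentralArrangement n l) : Prop :=
  ⨅ i, 𝒜.H i = ⊥

/-- `{H i : i ∈ F}` is dependent: linear forms `α i` with kernels `H i` (which are unique up to
nonzero scalars) are linearly dependent for `i ∈ F`. -/
def Dependent (𝒜 : CentralArrangement n l) (F : Finset (Fin n)) : Prop :=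
  ∃ α : Fin n → Module.Dual ℂ (Fin l → ℂ),
    (∀ i, LinearMap.ker (α i) = 𝒜.H i) ∧
      ¬ LinearIndependent ℂ (fun i : F => α i)

end CentralArrangement

noncomputable section

/-- The exterior algebra `E = K⟨e_1, …, e_n⟩`. -/
abbrev ExtAlg (K : Type*) [Field K] (n : ℕ) : Type _ :=
  ExteriorAlgebra K (Fin n → K)

/-- The homogeneous component `E_p` of the exterior algebra. -/
abbrev extDeg (K : Type*) [Field K] (n p : ℕ) : Submodule K (ExtAlg K n) :=
  ⋀[K]^p (Fin n → K)

/-- The variable `e_i` of the exterior algebra. -/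
def extVar (K : Type*) [Field K] {n : ℕ} (i : Fin n) : ExtAlg K n :=
  ExteriorAlgebra.ι K (Pi.single i 1)

/-- The element `∂ e_F = ∑ j, (-1)^j e_{i_0} ∧ ⋯ ∧ (omit e_{i_j}) ∧ ⋯ ∧ e_{i_{t-1}}`, where
`i_0 < ⋯ < i_{t-1}` are the elements of `F`. -/
def boundaryMonomial (K : Type*) [Field K] {n : ℕ} (F : Finset (Fin n)) : ExtAlg K n :=
  ∑ j ∈ Finset.range F.card,
    (-1) ^ j * (((F.sort (· ≤ ·)).eraseIdx j).map (extVar K)).prod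

/-- The Orlik–Solomon ideal: the two-sided ideal of `E` generated by all `∂ e_F` with `F`
dependent. -/
def orlikSolomonIdeal (K : Type*) [Field K] {n l : ℕ} (𝒜 : CentralArrangement n l) :
    Ideal (ExtAlg K n) :=
  (TwoSidedIdeal.span {x | ∃ F, 𝒜.Dependent F ∧ x = boundaryMonomial K F}).asIdeal

instance orlikSolomonIdeal_isTwoSided (K : Type*) [Field K] {n l : ℕ}
    (𝒜 : CentralArrangement n l) : (orlikSolomonIdeal K 𝒜).IsTwoSided := by
  unfold orlikSolomonIdeal
  infer_instance

section Quotient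

variable {K : Type*} [Field K] {n : ℕ} (J : Ideal (ExtAlg K n)) [J.IsTwoSided]

/-- The homogeneous component `A_p` of `A = E/J`. -/
def quotDeg (p : ℕ) : Submodule K (ExtAlg K n ⧸ J) :=
  (extDeg K n p).map (Ideal.Quotient.mkₐ K J).toLinearMap

/-- The cocycles in `A_p` of the complex `(A, u)` with `A = E/J`. Left and right multiplication
by `u ∈ A_1` agree up to sign on each homogeneous component, so they have the same kernels and
the same images there. -/
def cocyclesOf (u : ExtAlg K n ⧸ J) (p : ℕ) : Submodule K (ExtAlg K n ⧸ J) :=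
  quotDeg J p ⊓ LinearMap.ker (LinearMap.mulLeft K u)

/-- The coboundaries in `A_p` of the complex `(A, u)`: zero for `p = 0`, and `u A_{p-1}` for
`p ≥ 1`. -/
def coboundariesOf (u : ExtAlg K n ⧸ J) : ℕ → Submodule K (ExtAlg K n ⧸ J)
  | 0 => ⊥
  | p + 1 => (quotDeg J p).map (LinearMap.mulLeft K u)

/-- The cohomology `H^p(A, u)`. -/
abbrev cohomologyOf (u : ExtAlg K n ⧸ J) (p : ℕ) : Type _ :=
  cocyclesOf J u p ⧸ (coboundariesOf J u p).submoduleOf (cocyclesOf J u p)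

/-- The `p`-th resonance variety `R^p(A) = {u ∈ A_1 : H^p(A, u) ≠ 0}`. -/
def resonanceVariety (p : ℕ) : Set (quotDeg J 1) :=
  {u | Nontrivial (cohomologyOf J (u : ExtAlg K n ⧸ J) p)}

/-- The rank variety `V_E(A)`: all `u ∈ A_1` such that the set of elements of `A` annihilated by
`u` is not `uA`. -/
def rankVariety : Set (quotDeg J 1) :=
  {u | {a : ExtAlg K n ⧸ J | (u : ExtAlg K n ⧸ J) * a = 0} ≠
    Set.range (fun a : ExtAlg K n ⧸ J => (u : ExtAlg K n ⧸ J) * a)}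

end Quotient

/-- The polynomial functions on a finite-dimensional vector space `W`: the algebra of functions
generated by the linear forms. -/
def polyFunctions (K W : Type*) [Field K] [AddCommGroup W] [Module K W] :
    Subalgebra K (W → K) :=
  Algebra.adjoin K {f | ∃ φ : Module.Dual K W, f = φ}

/-- The Zariski topology on a finite-dimensional vector space `W`: the sets `{w : f w ≠ 0}`, for
`f` a polynomial function, form a basis. -/
@[reducible]
def zariskiTopology (K W : Type*) [Field K] [AddCommGroup W] [Module K W] :
    TopologicalSpace W :=
  TopologicalSpace.generateFrom {U | ∃ f ∈ polyFunctions K W, U = {w | f w ≠ 0}}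

section Resolution

variable {K : Type*} [Field K] {n : ℕ}

/-- The component of degree `k` of the graded free module `⨁_b E(-deg b)`. -/
def freeDeg (K : Type*) [Field K] (n : ℕ) {r : ℕ} (deg : Fin r → ℕ) (k : ℕ) :
    Submodule K (Fin r → ExtAlg K n) :=
  Submodule.pi Set.univ fun b => if deg b ≤ k then extDeg K n (k - deg b) else ⊥

/-- A graded free resolution `⋯ → F_1 → F_0 → J → 0` of a graded (left) ideal `J` of `E` by
finitely generated graded free modules `F_i = ⨁_b E(-deg i b)` and maps of degree zero. It need
not be minimal. -/
structure GradedFreeResolution (J : Ideal (ExtAlg K n)) where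
  rank : ℕ → ℕ
  deg : ∀ i, Fin (rank i) → ℕ
  d : ∀ i, (Fin (rank (i + 1)) → ExtAlg K n) →ₗ[ExtAlg K n] (Fin (rank i) → ExtAlg K n)
  aug : (Fin (rank 0) → ExtAlg K n) →ₗ[ExtAlg K n] ExtAlg K n
  d_homogeneous : ∀ i b, d i (Pi.single b 1) ∈ freeDeg K n (deg i) (deg (i + 1) b)
  aug_homogeneous : ∀ b, aug (Pi.single b 1) ∈ extDeg K n (deg 0 b)
  range_aug : LinearMap.range aug = J
  exact_aug : Function.Exact (d 0) aug
  exact_d : ∀ i, Function.Exact (d (i + 1)) (d i)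

namespace GradedFreeResolution

variable {J : Ideal (ExtAlg K n)} (F : GradedFreeResolution J)

/-- The differential `K ⊗_E F_{i+1} → K ⊗_E F_i`, where `K = E/(e_1, …, e_n)` and `K ⊗_E E^r` is
identified with `K^r` by applying the augmentation `E → K` to the coordinates. -/
def dBar (i : ℕ) : (Fin (F.rank (i + 1)) → K) →ₗ[K] (Fin (F.rank i) → K) :=
  ((ExteriorAlgebra.algebraMapInv : ExtAlg K n →ₐ[K] K).toLinearMap.compLeft (Fin (F.rank i))) ∘ₗ
    ((F.d i).restrictScalars K) ∘ₗ
      ((Algebra.linearMap K (ExtAlg K n)).compLeft (Fin (F.rank (i + 1))))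

/-- The component of degree `j` of `K ⊗_E F_i`. -/
def barDeg (i j : ℕ) : Submodule K (Fin (F.rank i) → K) :=
  Submodule.pi Set.univ fun b => if F.deg i b = j then ⊤ else ⊥

/-- The cycles of homological degree `i` and internal degree `j` of `K ⊗_E F`. -/
def torCycles : (i j : ℕ) → Submodule K (Fin (F.rank i) → K)
  | 0, j => F.barDeg 0 j
  | i + 1, j => F.barDeg (i + 1) j ⊓ LinearMap.ker (F.dBar i)

/-- The boundaries of homological degree `i` and internal degree `j` of `K ⊗_E F`. -/
def torBoundaries (i j : ℕ) : Submodule K (Fin (F.rank i) → K) :=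
  (F.barDeg (i + 1) j).map (F.dBar i)

/-- The graded vector space `Tor_i^E(K, J)_j`, as the homology of `K ⊗_E F`. -/
abbrev tor (i j : ℕ) : Type _ :=
  F.torCycles i j ⧸ (F.torBoundaries i j).submoduleOf (F.torCycles i j)

/-- The graded Betti number `β_{i,j}(J) = dim_K Tor_i^E(K, J)_j`. -/
def betti (i j : ℕ) : ℕ :=
  Module.finrank K (F.tor i j)

end GradedFreeResolution

/-- `J` has a `d`-linear resolution: `β_{i,m}(J) = 0` for all `i` and all `m ≠ i + d`. The Betti
numbers are computed from some graded free resolution; they do not depend on it. -/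
def HasLinearResolution (d : ℕ) (J : Ideal (ExtAlg K n)) : Prop :=
  ∃ F : GradedFreeResolution J, ∀ i m : ℕ, m ≠ i + d → F.betti i m = 0

end Resolution

end

/-! The graded spaces Tor^E(K, J) are computed by the Cartan complex of J, whose chains of
homological degree i are functions from exponents of degree i to J. A d-linear resolution makes this
complex exact wherever the values lie in J_m with m ≠ d
(`GradedFreeResolution.exists_cartan_ideal`). Together with elementary facts this is recorded in
`LinearIdeal`: d ≥ 2, J vanishes below degree d, J_d is spanned by the ∂e_C with C dependent of size
d + 1 (circuits, for short), and any d of the forms are independent.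

The core is that all these circuits span one and the same subspace U of rank d
(`LinearIdeal.vspan_eq`). Two arguments lead there. A dimension count in the Cartan complex,
asymptotic in the homological degree, shows that a subspace of rank d + 1 containing U holds at most
one form outside U (`LinearIdeal.eq_of_notMem`). Consequently the circuits spanning U and those
spanning other subspaces contribute parts P and Q of J_d with E_1 P ∩ E_1 Q = 0. Linearity of the
syzygies propagates this disjointness to all higher degrees (`LinearIdeal.disjoint_extDeg_mul`). In
the one-dimensional top degree both parts would be nonzero, a contradiction unless Q = 0.

Let X be the set of indices of forms in U. Then J is generated by boundaries of subsets of X, and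
the common variety is the space D of vectors supported on X with coordinate sum zero. If v ∉ D, some
linear form φ vanishes on D with φ(v) = 1. Contraction with φ preserves J and is a contracting
homotopy for multiplication by v on E/J (`LinearIdeal.exists_ctr_of_notMem`). If v ∈ D, a product of
d - 1 differences e_k - e_o with k, o ∈ X is a cocycle which is not a multiple of v modulo J
(`LinearIdeal.exists_of_mem_zeroSum`). In degrees p ≤ d - 2 both A_p and A_{p+1} agree with the
exterior algebra, so only v = 0 is resonant. A linear subspace over an infinite field is
irreducible. -/

noncomputable section

open Module

/-! ### Contractions and Euler-type identities in the exterior algebra. -/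

section Contraction

variable {K : Type*} [Field K] {n : ℕ}

/-- Contraction of the exterior algebra with a linear form. -/
def ctr (φ : Dual K (Fin n → K)) : ExtAlg K n →ₗ[K] ExtAlg K n :=
  CliffordAlgebra.contractLeft φ

/-- The inclusion of vectors into the exterior algebra. -/
abbrev vec : (Fin n → K) →ₗ[K] ExtAlg K n := ExteriorAlgebra.ι K

theorem ctr_vec_mul (φ : Dual K (Fin n → K)) (v : Fin n → K) (x : ExtAlg K n) :
    ctr φ (vec v * x) = φ v • x - vec v * ctr φ x :=
  CliffordAlgebra.contractLeft_ι_mul φ v x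

theorem ctr_algebraMap (φ : Dual K (Fin n → K)) (c : K) :
    ctr φ (algebraMap K (ExtAlg K n) c) = 0 :=
  CliffordAlgebra.contractLeft_algebraMap _ φ c

theorem ctr_one (φ : Dual K (Fin n → K)) : ctr φ (1 : ExtAlg K n) = 0 :=
  CliffordAlgebra.contractLeft_one _ φ

theorem ctr_ctr (φ : Dual K (Fin n → K)) (x : ExtAlg K n) : ctr φ (ctr φ x) = 0 :=
  CliffordAlgebra.contractLeft_contractLeft φ x

theorem vec_mul_self (v : Fin n → K) : vec v * vec v = 0 :=
  ExteriorAlgebra.ι_sq_zero v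

theorem vec_mul_vec (v w : Fin n → K) : vec v * vec w = -(vec w * vec v) :=
  eq_neg_of_add_eq_zero_left (ExteriorAlgebra.ι_add_mul_swap v w)

theorem vec_mem (v : Fin n → K) : vec v ∈ extDeg K n 1 := by
  simp [extDeg, ExteriorAlgebra.exteriorPower]

theorem extDeg_zero : extDeg K n 0 = 1 := pow_zero _

theorem mul_mem_extDeg {i j : ℕ} {x y : ExtAlg K n} (hx : x ∈ extDeg K n i)
    (hy : y ∈ extDeg K n j) : x * y ∈ extDeg K n (i + j) :=
  SetLike.GradedMul.mul_mem hx hy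

theorem vec_mul_mem {j : ℕ} (v : Fin n → K) {x : ExtAlg K n} (hx : x ∈ extDeg K n j) :
    vec v * x ∈ extDeg K n (j + 1) := by
  rw [add_comm]; exact mul_mem_extDeg (vec_mem v) hx

theorem mem_extDeg_zero {x : ExtAlg K n} (hx : x ∈ extDeg K n 0) :
    ∃ c, x = algebraMap K (ExtAlg K n) c := by
  rw [extDeg_zero, Submodule.mem_one] at hx
  obtain ⟨c, rfl⟩ := hx
  exact ⟨c, rfl⟩

theorem extDeg_succ_induction {k : ℕ} {C : ExtAlg K n → Prop}
    (hvec : ∀ v, ∀ x ∈ extDeg K n k, C (vec v * x)) (hadd : ∀ x y, C x → C y → C (x + y))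
    {x : ExtAlg K n} (hx : x ∈ extDeg K n (k + 1)) : C x := by
  rw [show extDeg K n (k + 1) = _ from pow_succ' _ k] at hx
  refine Submodule.mul_induction_on hx ?_ hadd
  rintro _ ⟨v, rfl⟩ x hx
  exact hvec v x hx

theorem ctr_eq_zero (φ : Dual K (Fin n → K)) {x : ExtAlg K n} (hx : x ∈ extDeg K n 0) :
    ctr φ x = 0 := by
  obtain ⟨c, rfl⟩ := mem_extDeg_zero hx
  exact ctr_algebraMap φ c

theorem ctr_mem (φ : Dual K (Fin n → K)) {k : ℕ} {x : ExtAlg K n}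
    (hx : x ∈ extDeg K n (k + 1)) : ctr φ x ∈ extDeg K n k := by
  induction k generalizing x with
  | zero =>
    refine extDeg_succ_induction (C := fun x => ctr φ x ∈ extDeg K n 0)
      (fun v x hx => ?_) (fun x y hx hy => ?_) hx
    · rw [ctr_vec_mul, ctr_eq_zero φ hx, mul_zero, sub_zero]
      exact Submodule.smul_mem _ _ hx
    · rw [map_add]; exact add_mem hx hy
  | succ k ih =>
    refine extDeg_succ_induction (C := fun x => ctr φ x ∈ extDeg K n (k + 1))
      (fun v x hx => ?_) (fun x y hx hy => ?_) hx
    · rw [ctr_vec_mul]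
      exact sub_mem (Submodule.smul_mem _ _ hx) (vec_mul_mem v (ih hx))
    · rw [map_add]; exact add_mem hx hy

/-- Euler's identity: contracting with the dual basis and multiplying back counts the degree. In
characteristic zero it gives an explicit way to write elements of positive degree as combinations of
the basis vectors. -/
theorem sum_vec_mul_ctr (b : Basis (Fin n) K (Fin n → K)) {j : ℕ} {x : ExtAlg K n}
    (hx : x ∈ extDeg K n j) : ∑ k, vec (b k) * ctr (b.coord k) x = (j : K) • x := by
  induction j generalizing x with
  | zero => simp [ctr_eq_zero _ hx]
  | succ j ih =>
    refine extDeg_succ_induction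
      (C := fun x => ∑ k, vec (b k) * ctr (b.coord k) x = ((j + 1 : ℕ) : K) • x)
      (fun v x hx => ?_) (fun x y hx hy => ?_) hx
    · have h1 : ∀ k, vec (b k) * ctr (b.coord k) (vec v * x) =
          vec (b.coord k v • b k) * x + vec v * (vec (b k) * ctr (b.coord k) x) := by
        intro k
        rw [ctr_vec_mul, mul_sub, ← mul_assoc, vec_mul_vec (b k) v, map_smul]
        simp [mul_assoc]
      simp_rw [h1]
      rw [Finset.sum_add_distrib, ← Finset.sum_mul, ← map_sum, ← Finset.mul_sum, ih hx]
      have : ∑ k, b.coord k v • b k = v := b.sum_repr v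
      rw [this]
      push_cast
      rw [add_smul, one_smul, mul_smul_comm, add_comm]
    · simp only [map_add, mul_add, Finset.sum_add_distrib, hx, hy, smul_add]

theorem sum_ctr_vec_mul (b : Basis (Fin n) K (Fin n → K)) {j : ℕ} {x : ExtAlg K n}
    (hx : x ∈ extDeg K n j) :
    ∑ k, ctr (b.coord k) (vec (b k) * x) = ((n : K) - j) • x := by
  simp_rw [ctr_vec_mul]
  rw [Finset.sum_sub_distrib, sum_vec_mul_ctr b hx, sub_smul]
  simp [Basis.coord_apply, ← Nat.cast_smul_eq_nsmul K]

/-- The socle of the exterior algebra is its top degree: an element killed by all basis vectors is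
killed by the scalar n - j of the dual Euler identity. -/
theorem exists_vec_mul_ne_zero [CharZero K] (b : Basis (Fin n) K (Fin n → K)) {j : ℕ}
    {x : ExtAlg K n} (hx : x ∈ extDeg K n j) (h0 : x ≠ 0) (hj : j ≠ n) :
    ∃ k, vec (b k) * x ≠ 0 := by
  by_contra! h
  have := sum_ctr_vec_mul b hx
  simp only [h, map_zero, Finset.sum_const_zero] at this
  rcases smul_eq_zero.1 this.symm with h1 | h1
  · exact hj (by exact_mod_cast (sub_eq_zero.1 h1).symm)
  · exact h0 h1

end Contraction

/-! ### The Cartan complex and its exactness for E. -/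

section Cartan

variable {K : Type*} [Field K] {n : ℕ}
variable {M N : Type*} [AddCommGroup M] [Module (ExtAlg K n) M]
  [AddCommGroup N] [Module (ExtAlg K n) N]

/-- The differential of the Cartan complex of `M` with respect to the vectors `b k`: the
coordinates of an element of `M ⊗ Γ` with respect to the divided power monomials are listed as a
function of the exponents. -/
def cartan (b : Fin n → Fin n → K) (f : (Fin n →₀ ℕ) → M) (α : Fin n →₀ ℕ) : M :=
  ∑ k, vec (b k) • f (α + Finsupp.single k 1)

theorem cartan_sub (b : Fin n → Fin n → K) (f g : (Fin n →₀ ℕ) → M) :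
    cartan b (f - g) = cartan b f - cartan b g := by
  ext α; simp [cartan, smul_sub]

theorem map_cartan (b : Fin n → Fin n → K) (T : M →ₗ[ExtAlg K n] N) (f : (Fin n →₀ ℕ) → M)
    (α : Fin n →₀ ℕ) : T (cartan b f α) = cartan b (fun β => T (f β)) α := by
  simp [cartan]

/-- A symmetric family paired with anticommuting vectors equals its own negative, and 2 is
invertible. -/
theorem sum_sum_vec_smul_eq_zero [CharZero K] (b : Fin n → Fin n → K) (f : Fin n → Fin n → M)
    (hf : ∀ k l, f k l = f l k) : ∑ k, ∑ l, vec (b k) • vec (b l) • f k l = 0 := by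
  set s := ∑ k, ∑ l, vec (b k) • vec (b l) • f k l with hs
  have h : s = -s := by
    conv_lhs => rw [hs, Finset.sum_comm]
    rw [hs, ← Finset.sum_neg_distrib]
    refine Finset.sum_congr rfl fun k _ => ?_
    rw [← Finset.sum_neg_distrib]
    refine Finset.sum_congr rfl fun l _ => ?_
    rw [← mul_smul, ← mul_smul, vec_mul_vec, neg_smul, hf]
  have h2 : (2 : ExtAlg K n) • s = 0 := by
    rw [two_smul]; exact add_eq_zero_iff_eq_neg.2 h
  have h3 : algebraMap K (ExtAlg K n) (2⁻¹) * 2 = 1 := by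
    rw [show (2 : ExtAlg K n) = algebraMap K (ExtAlg K n) 2 from (map_ofNat _ 2).symm, ← map_mul]
    simp
  rw [← one_smul (ExtAlg K n) s, ← h3, mul_smul, h2, smul_zero]

theorem cartan_cartan [CharZero K] (b : Fin n → Fin n → K) (f : (Fin n →₀ ℕ) → M)
    (α : Fin n →₀ ℕ) : cartan b (cartan b f) α = 0 := by
  simp only [cartan, Finset.smul_sum]
  exact sum_sum_vec_smul_eq_zero b
    (fun k l => f (α + Finsupp.single k 1 + Finsupp.single l 1))
    fun k l => by rw [add_right_comm]

theorem cartan_congr (b : Fin n → Fin n → K) {f g : (Fin n →₀ ℕ) → M} {i : ℕ}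
    (h : ∀ α, α.degree = i + 1 → f α = g α) {α : Fin n →₀ ℕ} (hα : α.degree = i) :
    cartan b f α = cartan b g α := by
  refine Finset.sum_congr rfl fun k _ => ?_
  rw [h _ (by simp [hα])]

/-- The Poincaré lemma for the Cartan complex of the exterior algebra. -/
theorem exists_cartan_eq [CharZero K] (b : Basis (Fin n) K (Fin n → K)) {i j : ℕ}
    (f : (Fin n →₀ ℕ) → ExtAlg K n) (hf : ∀ α, α.degree = i + 1 → f α ∈ extDeg K n j)
    (hc : ∀ α, α.degree = i → cartan b f α = 0) :
    ∃ g : (Fin n →₀ ℕ) → ExtAlg K n,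
      (∀ α, α.degree = i + 2 → ∀ p, j = p + 1 → g α ∈ extDeg K n p) ∧
      (j = 0 → ∀ α, α.degree = i + 2 → g α = 0) ∧
      ∀ α, α.degree = i + 1 → cartan b g α = f α := by
  have hdeg : ∀ (α : Fin n →₀ ℕ) l, α l ≠ 0 →
      (α - Finsupp.single l 1) + Finsupp.single l 1 = α := by
    intro α l hl
    refine tsub_add_cancel_of_le ?_
    rw [Finsupp.single_le_iff]; omega
  have hdeg' : ∀ (α : Fin n →₀ ℕ) l p, α l ≠ 0 → α.degree = p + 1 →
      (α - Finsupp.single l 1).degree = p := by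
    intro α l p hl hp
    have := congrArg Finsupp.degree (hdeg α l hl)
    simp at this; omega
  set c : K := (((i + 1 + j : ℕ) : K))⁻¹ with hc'
  have hc0 : ((i + 1 + j : ℕ) : K) ≠ 0 := by exact_mod_cast (by omega)
  -- The contracting homotopy contracts with the l-th coordinate and multiplies by the l-th divided
  -- power variable. The factor α l comes from y_l · y^(α - ε_l) = α_l · y^(α), and it also
  -- neutralises the truncated subtraction when α l = 0. The homotopy composed with the differential
  -- acts on cycles by the total degree i + 1 + j, whose inverse is `c`.
  refine ⟨fun α => c • ∑ l, (α l : K) • ctr (b.coord l) (f (α - Finsupp.single l 1)), ?_, ?_, ?_⟩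
  · intro α hα p hp
    refine Submodule.smul_mem _ _ (Submodule.sum_mem _ fun l _ => ?_)
    by_cases hl : α l = 0
    · simp [hl]
    · refine Submodule.smul_mem _ _ (ctr_mem _ ?_)
      rw [← hp]
      exact hf _ (hdeg' α l _ hl hα)
  · intro hj α hα
    subst hj
    have : ∀ l, (α l : K) • ctr (b.coord l) (f (α - Finsupp.single l 1)) = 0 := by
      intro l
      by_cases hl : α l = 0
      · simp [hl]
      · rw [ctr_eq_zero _ (hf _ (hdeg' α l _ hl hα)), smul_zero]
    simp [this]
  · intro α hα
    have key : ∑ k, vec (b k) * ∑ l, ((α + Finsupp.single k 1 : Fin n →₀ ℕ) l : K) •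
        ctr (b.coord l) (f (α + Finsupp.single k 1 - Finsupp.single l 1)) =
        ((i + 1 + j : ℕ) : K) • f α := by
      have hcl : ∀ l, (α l : K) • ctr (b.coord l) (cartan b f (α - Finsupp.single l 1)) = 0 := by
        intro l
        by_cases hl : α l = 0
        · simp [hl]
        · rw [hc _ (hdeg' α l _ hl hα), map_zero, smul_zero]
      -- Termwise anticommutation of differential and homotopy: the diagonal terms produce the total
      -- degree, while the remaining sum is a contraction of `cartan b f` and vanishes on cycles.
      have h1 : ∀ k l, vec (b k) * ((α + Finsupp.single k 1 : Fin n →₀ ℕ) l : K) •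
          ctr (b.coord l) (f (α + Finsupp.single k 1 - Finsupp.single l 1)) =
          (if k = l then vec (b k) * ctr (b.coord k) (f α) + (α l : K) • f α else 0) -
          (α l : K) • ctr (b.coord l)
            (vec (b k) * f (α - Finsupp.single l 1 + Finsupp.single k 1)) := by
        intro k l
        rw [ctr_vec_mul, smul_sub, Basis.coord_apply, Basis.repr_self]
        by_cases hl : α l = 0
        · by_cases hkl : k = l
          · subst hkl; simp [hl]
          · have : Finsupp.single k 1 l = 0 := Finsupp.single_eq_of_ne (Ne.symm hkl)
            simp [hkl, hl, this]
        · have h2 : α + Finsupp.single k 1 - Finsupp.single l 1 =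
              α - Finsupp.single l 1 + Finsupp.single k 1 := by
            conv_lhs => rw [← hdeg α l hl, add_right_comm, add_tsub_cancel_right]
          rw [h2]
          by_cases hkl : k = l
          · subst hkl
            rw [hdeg α k hl]
            simp only [Finsupp.add_apply, Finsupp.single_eq_same, Nat.cast_add, Nat.cast_one,
              if_true, one_smul, mul_add, mul_smul_comm, add_smul]
            abel
          · have h3 : Finsupp.single k 1 l = 0 := Finsupp.single_eq_of_ne (Ne.symm hkl)
            have h4 : (Finsupp.single k (1 : K)) l = 0 := Finsupp.single_eq_of_ne (Ne.symm hkl)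
            simp [hkl, h3, h4]
      simp_rw [Finset.mul_sum, h1, Finset.sum_sub_distrib]
      have h5 : ∑ k, ∑ l, (α l : K) • ctr (b.coord l)
            (vec (b k) * f (α - Finsupp.single l 1 + Finsupp.single k 1)) = 0 := by
        rw [Finset.sum_comm]
        refine Finset.sum_eq_zero fun l _ => ?_
        rw [← Finset.smul_sum, ← map_sum]
        exact hcl l
      rw [h5, sub_zero]
      simp only [Finset.sum_ite_eq, Finset.mem_univ, if_true, Finset.sum_add_distrib]
      rw [sum_vec_mul_ctr b (hf α hα), ← Finset.sum_smul, ← Nat.cast_sum,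
        ← Finsupp.degree_eq_sum, hα, ← add_smul]
      congr 1
      push_cast; ring
    simp only [cartan, smul_eq_mul, mul_smul_comm]
    rw [← Finset.smul_sum, key, smul_smul, hc', inv_mul_cancel₀ hc0, one_smul]

end Cartan

/-! ### Homogeneous components of E and of graded free modules. -/

section Graded

variable {K : Type*} [Field K] {n : ℕ}

/-- The homogeneous component of degree `j`. -/
def homComp (K : Type*) [Field K] (n j : ℕ) : ExtAlg K n →ₗ[K] ExtAlg K n :=
  GradedAlgebra.proj (fun i : ℕ => extDeg K n i) j

theorem homComp_mem (j : ℕ) (x : ExtAlg K n) : homComp K n j x ∈ extDeg K n j :=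
  SetLike.coe_mem _

theorem homComp_same {j : ℕ} {x : ExtAlg K n} (hx : x ∈ extDeg K n j) : homComp K n j x = x :=
  DirectSum.decompose_of_mem_same _ hx

theorem homComp_ne {i j : ℕ} {x : ExtAlg K n} (hx : x ∈ extDeg K n j) (h : j ≠ i) :
    homComp K n i x = 0 :=
  DirectSum.decompose_of_mem_ne _ hx h

theorem homComp_mul_of_le {i j : ℕ} (x : ExtAlg K n) {y : ExtAlg K n} (hy : y ∈ extDeg K n j)
    (h : j ≤ i) : homComp K n i (x * y) = homComp K n (i - j) x * y :=
  DirectSum.coe_decompose_mul_of_right_mem_of_le _ hy h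

theorem homComp_mul_of_not_le {i j : ℕ} (x : ExtAlg K n) {y : ExtAlg K n}
    (hy : y ∈ extDeg K n j) (h : ¬j ≤ i) : homComp K n i (x * y) = 0 :=
  DirectSum.coe_decompose_mul_of_right_mem_of_not_le _ hy h

theorem homComp_mul_left_of_le {i j : ℕ} {x : ExtAlg K n} (y : ExtAlg K n)
    (hx : x ∈ extDeg K n j) (h : j ≤ i) :
    homComp K n i (x * y) = x * homComp K n (i - j) y :=
  DirectSum.coe_decompose_mul_of_left_mem_of_le _ hx h

theorem homComp_mul_left_of_not_le {i j : ℕ} {x : ExtAlg K n} (y : ExtAlg K n)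
    (hx : x ∈ extDeg K n j) (h : ¬j ≤ i) : homComp K n i (x * y) = 0 :=
  DirectSum.coe_decompose_mul_of_left_mem_of_not_le _ hx h

theorem exists_sum_homComp (x : ExtAlg K n) : ∃ s : Finset ℕ, x = ∑ j ∈ s, homComp K n j x := by
  classical
  exact ⟨_, (DirectSum.sum_support_decompose (fun i : ℕ => extDeg K n i) x).symm⟩

/-- The augmentation of the exterior algebra. -/
abbrev aug₀ (K : Type*) [Field K] (n : ℕ) : ExtAlg K n →ₐ[K] K := ExteriorAlgebra.algebraMapInv

theorem aug₀_vec (v : Fin n → K) : aug₀ K n (vec v) = 0 := by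
  simp [ExteriorAlgebra.algebraMapInv]

theorem aug₀_algebraMap (c : K) : aug₀ K n (algebraMap K (ExtAlg K n) c) = c := by
  simp

theorem aug₀_eq_zero {j : ℕ} {x : ExtAlg K n} (hx : x ∈ extDeg K n (j + 1)) :
    aug₀ K n x = 0 := by
  refine extDeg_succ_induction (C := fun x => aug₀ K n x = 0)
    (fun v x _ => ?_) (fun x y hx hy => ?_) hx
  · rw [map_mul, aug₀_vec, zero_mul]
  · rw [map_add, hx, hy, add_zero]

variable {r s : ℕ}

theorem mem_freeDeg {deg : Fin r → ℕ} {k : ℕ} {x : Fin r → ExtAlg K n} :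
    x ∈ freeDeg K n deg k ↔ ∀ b, x b ∈ if deg b ≤ k then extDeg K n (k - deg b) else ⊥ := by
  simp [freeDeg]

theorem vec_smul_mem_freeDeg {deg : Fin r → ℕ} {k : ℕ} {x : Fin r → ExtAlg K n}
    (hx : x ∈ freeDeg K n deg k) (v : Fin n → K) : vec v • x ∈ freeDeg K n deg (k + 1) := by
  rw [mem_freeDeg] at hx ⊢
  intro b
  have := hx b
  by_cases h : deg b ≤ k
  · rw [if_pos h] at this
    rw [if_pos (by omega), Nat.sub_add_comm h]
    exact vec_mul_mem v this
  · rw [if_neg h, Submodule.mem_bot] at this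
    simp [this]

/-- The component of degree `k` of an element of a graded free module. -/
def freeComp (deg : Fin r → ℕ) (k : ℕ) (x : Fin r → ExtAlg K n) : Fin r → ExtAlg K n :=
  fun b => if deg b ≤ k then homComp K n (k - deg b) (x b) else 0

theorem freeComp_mem (deg : Fin r → ℕ) (k : ℕ) (x : Fin r → ExtAlg K n) :
    freeComp deg k x ∈ freeDeg K n deg k := by
  rw [mem_freeDeg]
  intro b
  unfold freeComp
  split_ifs
  · exact homComp_mem _ _
  · exact zero_mem _

theorem freeComp_same {deg : Fin r → ℕ} {k : ℕ} {x : Fin r → ExtAlg K n}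
    (hx : x ∈ freeDeg K n deg k) : freeComp deg k x = x := by
  rw [mem_freeDeg] at hx
  ext1 b
  have := hx b
  unfold freeComp
  split_ifs at this ⊢ with h
  · exact homComp_same this
  · exact ((Submodule.mem_bot K).1 this).symm

theorem map_eq_sum_mul (T : (Fin r → ExtAlg K n) →ₗ[ExtAlg K n] ExtAlg K n)
    (x : Fin r → ExtAlg K n) : T x = ∑ b, x b * T (Pi.single b 1) := by
  conv_lhs => rw [pi_eq_sum_univ' x, map_sum]
  refine Finset.sum_congr rfl fun b _ => ?_
  rw [map_smul, smul_eq_mul]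

/-- Degree-preserving maps commute with taking components. The target is E(-e), so degrees below the
shift e have to be treated as zero. -/
theorem map_freeComp {deg : Fin r → ℕ} (T : (Fin r → ExtAlg K n) →ₗ[ExtAlg K n] ExtAlg K n)
    (e : ℕ) (hT : ∀ b, T (Pi.single b 1) ∈ if e ≤ deg b then extDeg K n (deg b - e) else ⊥)
    (k : ℕ) (x : Fin r → ExtAlg K n) :
    T (freeComp deg k x) = if e ≤ k then homComp K n (k - e) (T x) else 0 := by
  rw [map_eq_sum_mul T, map_eq_sum_mul T x]
  split_ifs with hk
  · rw [map_sum]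
    refine Finset.sum_congr rfl fun b _ => ?_
    have := hT b
    unfold freeComp
    by_cases h : e ≤ deg b
    · rw [if_pos h] at this
      split_ifs with hb
      · rw [homComp_mul_of_le _ this (by omega)]
        congr 3; omega
      · rw [homComp_mul_of_not_le _ this (by omega), zero_mul]
    · rw [if_neg h, Submodule.mem_bot] at this
      simp [this]
  · refine Finset.sum_eq_zero fun b _ => ?_
    have := hT b
    unfold freeComp
    split_ifs with hb
    · rw [if_neg (by omega), Submodule.mem_bot] at this
      rw [this, mul_zero]
    · rw [zero_mul]

theorem map_pi_freeComp {deg : Fin r → ℕ} {deg' : Fin s → ℕ}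
    (T : (Fin r → ExtAlg K n) →ₗ[ExtAlg K n] (Fin s → ExtAlg K n))
    (hT : ∀ b, T (Pi.single b 1) ∈ freeDeg K n deg' (deg b))
    (k : ℕ) (x : Fin r → ExtAlg K n) :
    T (freeComp deg k x) = freeComp deg' k (T x) := by
  ext1 c
  exact map_freeComp (LinearMap.proj c ∘ₗ T) (deg' c)
    (fun b => mem_freeDeg.1 (hT b) c) k x

theorem map_pi_mem_freeDeg {deg : Fin r → ℕ} {deg' : Fin s → ℕ}
    (T : (Fin r → ExtAlg K n) →ₗ[ExtAlg K n] (Fin s → ExtAlg K n))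
    (hT : ∀ b, T (Pi.single b 1) ∈ freeDeg K n deg' (deg b))
    {k : ℕ} {x : Fin r → ExtAlg K n} (hx : x ∈ freeDeg K n deg k) :
    T x ∈ freeDeg K n deg' k := by
  rw [← freeComp_same hx, map_pi_freeComp T hT]
  exact freeComp_mem _ _ _

theorem exists_mem_freeDeg_map_pi_eq {deg : Fin r → ℕ} {deg' : Fin s → ℕ}
    (T : (Fin r → ExtAlg K n) →ₗ[ExtAlg K n] (Fin s → ExtAlg K n))
    (hT : ∀ b, T (Pi.single b 1) ∈ freeDeg K n deg' (deg b))
    {k : ℕ} {y : Fin s → ExtAlg K n} (hy : y ∈ freeDeg K n deg' k) (hr : y ∈ LinearMap.range T) :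
    ∃ x ∈ freeDeg K n deg k, T x = y := by
  obtain ⟨x, rfl⟩ := hr
  exact ⟨freeComp deg k x, freeComp_mem _ _ _, by rw [map_pi_freeComp T hT, freeComp_same hy]⟩

/-- Elements of `𝔪 F` are combinations of the variables with homogeneous coefficients. -/
theorem exists_eq_sum_vec_smul [CharZero K] (b : Basis (Fin n) K (Fin n → K)) {deg : Fin r → ℕ}
    {k : ℕ} {x : Fin r → ExtAlg K n} (hx : x ∈ freeDeg K n deg (k + 1))
    (h0 : ∀ c, aug₀ K n (x c) = 0) :
    ∃ y : Fin n → Fin r → ExtAlg K n, (∀ l, y l ∈ freeDeg K n deg k) ∧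
      x = ∑ l, vec (b l) • y l := by
  rw [mem_freeDeg] at hx
  have key : ∀ c, ∃ y : Fin n → ExtAlg K n,
      (∀ l, y l ∈ if deg c ≤ k then extDeg K n (k - deg c) else ⊥) ∧
      x c = ∑ l, vec (b l) * y l := by
    intro c
    have hc := hx c
    by_cases h : deg c ≤ k
    · rw [if_pos (by omega), Nat.sub_add_comm h] at hc
      refine ⟨fun l => ((k - deg c + 1 : ℕ) : K)⁻¹ • ctr (b.coord l) (x c), fun l => ?_, ?_⟩
      · rw [if_pos h]
        exact Submodule.smul_mem _ _ (ctr_mem _ hc)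
      · simp_rw [mul_smul_comm]
        rw [← Finset.smul_sum, sum_vec_mul_ctr b hc, smul_smul, inv_mul_cancel₀, one_smul]
        exact_mod_cast Nat.succ_ne_zero (k - deg c)
    · refine ⟨0, fun l => by simp, ?_⟩
      have : x c = 0 := by
        by_cases h' : deg c ≤ k + 1
        · rw [if_pos h', show k + 1 - deg c = 0 by omega] at hc
          obtain ⟨a, ha⟩ := mem_extDeg_zero hc
          have := h0 c
          rw [ha, aug₀_algebraMap] at this
          rw [ha, this, map_zero]
        · rw [if_neg h'] at hc
          exact (Submodule.mem_bot K).1 hc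
      simp [this]
  choose y hy1 hy2 using key
  refine ⟨fun l c => y c l, fun l => mem_freeDeg.2 fun c => hy1 c l, ?_⟩
  ext1 c
  simp [hy2 c]

/-- The Poincaré lemma for the Cartan complex of a graded free module. -/
theorem exists_cartan_eq_free [CharZero K] (b : Basis (Fin n) K (Fin n → K)) {deg : Fin r → ℕ}
    {i k : ℕ} (f : (Fin n →₀ ℕ) → Fin r → ExtAlg K n)
    (hf : ∀ α, α.degree = i + 1 → f α ∈ freeDeg K n deg (k + 1))
    (hc : ∀ α, α.degree = i → cartan b f α = 0) :
    ∃ g : (Fin n →₀ ℕ) → Fin r → ExtAlg K n,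
      (∀ α, α.degree = i + 2 → g α ∈ freeDeg K n deg k) ∧
      ∀ α, α.degree = i + 1 → cartan b g α = f α := by
  have key : ∀ c, ∃ g : (Fin n →₀ ℕ) → ExtAlg K n,
      (∀ α, α.degree = i + 2 → g α ∈ if deg c ≤ k then extDeg K n (k - deg c) else ⊥) ∧
      ∀ α, α.degree = i + 1 → cartan b g α = f α c := by
    intro c
    have hc' : ∀ α, α.degree = i → cartan b (fun β => f β c) α = 0 := fun α hα => by
      have := map_cartan b (LinearMap.proj c : (Fin r → ExtAlg K n) →ₗ[ExtAlg K n] _) f α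
      rw [hc α hα, map_zero] at this
      exact this.symm
    have hf' := fun α hα => mem_freeDeg.1 (hf α hα) c
    by_cases h : deg c ≤ k + 1
    · simp only [if_pos h] at hf'
      obtain ⟨g, hg1, hg2, hg3⟩ := exists_cartan_eq b (fun β => f β c) hf' hc'
      refine ⟨g, fun α hα => ?_, hg3⟩
      split_ifs with h'
      · exact hg1 α hα _ (Nat.sub_add_comm h')
      · exact (Submodule.mem_bot K).2 (hg2 (by omega) α hα)
    · refine ⟨0, fun α _ => zero_mem _, fun α hα => ?_⟩
      have := hf' α hα
      rw [if_neg h, Submodule.mem_bot] at this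
      simp [cartan, this]
  choose g hg1 hg2 using key
  refine ⟨fun α c => g c α, fun α hα => mem_freeDeg.2 fun c => hg1 c α hα, fun α hα => ?_⟩
  ext1 c
  rw [← hg2 c α hα]
  exact map_cartan b (LinearMap.proj c : (Fin r → ExtAlg K n) →ₗ[ExtAlg K n] _)
    (fun α c => g c α) α

end Graded

/-! ### From vanishing of Tor to exactness of the Cartan complex of J. -/

namespace GradedFreeResolution

variable {K : Type*} [Field K] {n : ℕ} {J : Ideal (ExtAlg K n)} (F : GradedFreeResolution J)

theorem aug₀_map_congr {r : ℕ} (T : (Fin r → ExtAlg K n) →ₗ[ExtAlg K n] ExtAlg K n)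
    {x y : Fin r → ExtAlg K n} (h : ∀ c, aug₀ K n (x c) = aug₀ K n (y c)) :
    aug₀ K n (T x) = aug₀ K n (T y) := by
  rw [map_eq_sum_mul T x, map_eq_sum_mul T y]
  simp [h]

theorem dBar_aug₀ (i : ℕ) (y : Fin (F.rank (i + 1)) → ExtAlg K n) :
    F.dBar i (fun c => aug₀ K n (y c)) = fun c => aug₀ K n (F.d i y c) := by
  ext1 c
  exact aug₀_map_congr (LinearMap.proj c ∘ₗ F.d i) fun a => aug₀_algebraMap _

theorem aug₀_mem_barDeg {i k : ℕ} {y : Fin (F.rank i) → ExtAlg K n}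
    (hy : y ∈ freeDeg K n (F.deg i) k) : (fun c => aug₀ K n (y c)) ∈ F.barDeg i k := by
  rw [mem_freeDeg] at hy
  simp only [barDeg, Submodule.mem_pi, Set.mem_univ, true_imp_iff]
  intro c
  have := hy c
  split_ifs with h
  · trivial
  · rw [Submodule.mem_bot]
    split_ifs at this with h'
    · obtain ⟨m, hm⟩ : ∃ m, k - F.deg i c = m + 1 := ⟨k - F.deg i c - 1, by omega⟩
      rw [hm] at this
      exact aug₀_eq_zero this
    · rw [(Submodule.mem_bot K).1 this, map_zero]

/-- Since Tor vanishes in this bidegree, the reduction of y modulo the maximal ideal is a boundary.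
Subtracting a lift of the bounding chain leaves an element of 𝔪 F_i. -/
theorem exists_sub_map_eq_sum [CharZero K] (b : Basis (Fin n) K (Fin n → K)) {i k : ℕ}
    (hi : F.betti i (k + 1) = 0)
    {y : Fin (F.rank i) → ExtAlg K n} (hy : y ∈ freeDeg K n (F.deg i) (k + 1))
    (hc : (fun c => aug₀ K n (y c)) ∈ F.torCycles i (k + 1)) :
    ∃ (w : Fin (F.rank (i + 1)) → ExtAlg K n) (z : Fin n → Fin (F.rank i) → ExtAlg K n),
      (∀ l, z l ∈ freeDeg K n (F.deg i) k) ∧ y - F.d i w = ∑ l, vec (b l) • z l := by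
  have h1 : Subsingleton (F.tor i (k + 1)) := Module.finrank_zero_iff.1 hi
  rw [Submodule.Quotient.subsingleton_iff] at h1
  have h2 : (fun c => aug₀ K n (y c)) ∈ F.torBoundaries i (k + 1) := by
    have : (⟨_, hc⟩ : F.torCycles i (k + 1)) ∈
      (F.torBoundaries i (k + 1)).submoduleOf (F.torCycles i (k + 1)) := h1 ▸ trivial
    exact this
  obtain ⟨v, hv, hvy⟩ := h2
  set w : Fin (F.rank (i + 1)) → ExtAlg K n := fun c => algebraMap K (ExtAlg K n) (v c) with hw
  have hwd : w ∈ freeDeg K n (F.deg (i + 1)) (k + 1) := by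
    rw [mem_freeDeg]
    intro c
    have hvc : v c ∈ if F.deg (i + 1) c = k + 1 then (⊤ : Submodule K K) else ⊥ := by
      have := (Submodule.mem_pi.1 hv) c
      exact this trivial
    by_cases h3 : F.deg (i + 1) c = k + 1
    · rw [h3, if_pos le_rfl, Nat.sub_self, extDeg_zero]
      exact Submodule.mem_one.2 ⟨_, rfl⟩
    · rw [if_neg h3, Submodule.mem_bot] at hvc
      rw [hw]
      dsimp only
      rw [hvc, map_zero]
      exact zero_mem _
  refine ⟨w, exists_eq_sum_vec_smul b
    (sub_mem hy (map_pi_mem_freeDeg _ (F.d_homogeneous i) hwd)) fun c => ?_⟩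
  have := congrFun hvy c
  have h3 : F.dBar i v c = aug₀ K n (F.d i w c) := rfl
  rw [Pi.sub_apply, map_sub, ← h3, this, sub_self]

/-- Dimension shifting through the syzygy modules, carried out by hand. A chain with values in the
syzygy module that bounds in F_r already bounds inside the syzygy module. Homological degree 0 is
the vanishing of Tor_{r+1}; a higher degree is reduced to the next syzygy module by lifting along
d_r. -/
theorem exists_cartan_range [CharZero K] {d : ℕ}
    (hF : ∀ i m : ℕ, m ≠ i + d → F.betti i m = 0) (b : Basis (Fin n) K (Fin n → K)) (i : ℕ) :
    ∀ r k, k ≠ d + r → ∀ ω θ : (Fin n →₀ ℕ) → Fin (F.rank r) → ExtAlg K n,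
      (∀ α, α.degree = i → ω α ∈ LinearMap.range (F.d r) ∧
        ω α ∈ freeDeg K n (F.deg r) (k + 1)) →
      (∀ α, α.degree = i → ω α = cartan b θ α) →
      ∃ η : (Fin n →₀ ℕ) → Fin (F.rank r) → ExtAlg K n,
        (∀ α, α.degree = i + 1 → η α ∈ LinearMap.range (F.d r) ∧
          η α ∈ freeDeg K n (F.deg r) k) ∧
        ∀ α, α.degree = i → cartan b η α = ω α := by
  induction i with
  | zero =>
    intro r k hk ω θ hω hθ
    obtain ⟨h1, h2⟩ := hω 0 (by simp)
    obtain ⟨y, hy, hyω⟩ := exists_mem_freeDeg_map_pi_eq _ (F.d_homogeneous r) h2 h1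
    have hc : (fun c => aug₀ K n (y c)) ∈ F.torCycles (r + 1) (k + 1) := by
      refine ⟨F.aug₀_mem_barDeg hy, ?_⟩
      show F.dBar r _ = 0
      rw [dBar_aug₀, hyω, hθ 0 (by simp)]
      ext c
      simp [cartan, aug₀_vec]
    obtain ⟨w, z, hz, hyz⟩ := F.exists_sub_map_eq_sum b
      (hF (r + 1) (k + 1) (by omega)) hy hc
    classical
    refine ⟨fun α => if h : ∃ l, α = Finsupp.single l 1 then F.d r (z h.choose) else 0,
      fun α _ => ?_, fun α hα => ?_⟩
    · dsimp only
      split_ifs with h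
      · exact ⟨⟨_, rfl⟩, map_pi_mem_freeDeg _ (F.d_homogeneous r) (hz _)⟩
      · exact ⟨zero_mem _, zero_mem _⟩
    · obtain rfl : α = 0 := (Finsupp.degree_eq_zero_iff α).1 hα
      have hch : ∀ l : Fin n, ∀ h : ∃ l', Finsupp.single l 1 = (Finsupp.single l' 1 : _ →₀ ℕ),
          h.choose = l := fun l h =>
        ((Finsupp.single_left_inj one_ne_zero).1 h.choose_spec).symm
      have h3 : ∀ l : Fin n, ∃ l', Finsupp.single l 1 = (Finsupp.single l' 1 : _ →₀ ℕ) :=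
        fun l => ⟨l, rfl⟩
      simp only [cartan, zero_add, h3, dif_pos, hch]
      have h4 := congrArg (F.d r) hyz
      rw [map_sub, (F.exact_d r).apply_apply_eq_zero, sub_zero, hyω, map_sum] at h4
      rw [h4]
      simp
  | succ i ih =>
    intro r k hk ω θ hω hθ
    have hlift : ∀ α : Fin n →₀ ℕ, ∃ y : Fin (F.rank (r + 1)) → ExtAlg K n, α.degree = i + 1 →
        y ∈ freeDeg K n (F.deg (r + 1)) (k + 1) ∧ F.d r y = ω α := by
      intro α
      by_cases hα : α.degree = i + 1
      · obtain ⟨y, hy⟩ := exists_mem_freeDeg_map_pi_eq _ (F.d_homogeneous r)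
          (hω α hα).2 (hω α hα).1
        exact ⟨y, fun _ => hy⟩
      · exact ⟨0, fun h => absurd h hα⟩
    choose ω' hω' using hlift
    -- Passing to the lift raises both r and the internal degree by one, so the condition k ≠ d + r
    -- persists. The differential of the lift dies under d_r because it covers a double differential
    -- of θ.
    obtain ⟨η, hη, hηω⟩ := ih (r + 1) (k + 1) (by omega) (cartan b ω') ω' (fun α hα => by
      constructor
      · have : F.d r (cartan b ω' α) = 0 := by
          rw [map_cartan, ← cartan_cartan b θ α]
          refine cartan_congr _ (fun β hβ => ?_) hα
          rw [(hω' β hβ).2, hθ β hβ]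
        exact (F.exact_d r _).1 this
      · exact sum_mem fun l _ => vec_smul_mem_freeDeg (hω' _ (by simp [hα])).1 _)
      (fun α _ => rfl)
    -- The corrected lift ω' - η is a cycle over a free module, hence a boundary; since η dies under
    -- d_r, pushing the bounding chain down bounds ω.
    obtain ⟨ζ, hζ, hζω⟩ := exists_cartan_eq_free b (ω' - η)
      (fun α hα => sub_mem (hω' α hα).1 (hη α hα).2)
      (fun α hα => by rw [cartan_sub, Pi.sub_apply, hηω α hα, sub_self])
    refine ⟨fun α => F.d r (ζ α), fun α hα => ⟨⟨_, rfl⟩,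
      map_pi_mem_freeDeg _ (F.d_homogeneous r) (hζ α hα)⟩, fun α hα => ?_⟩
    rw [← map_cartan, hζω α hα, Pi.sub_apply, map_sub, (hω' α hα).2]
    have : F.d r (η α) = 0 := (F.exact_d r _).2 (hη α hα).1
    rw [this, sub_zero]

theorem aug_freeComp (k : ℕ) (x : Fin (F.rank 0) → ExtAlg K n) :
    F.aug (freeComp (F.deg 0) k x) = homComp K n k (F.aug x) := by
  have := map_freeComp F.aug 0 (fun b => by simpa using F.aug_homogeneous b) k x
  simpa using this

theorem aug_mem {k : ℕ} {x : Fin (F.rank 0) → ExtAlg K n} (hx : x ∈ freeDeg K n (F.deg 0) k) :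
    F.aug x ∈ extDeg K n k := by
  rw [← freeComp_same hx, aug_freeComp]
  exact homComp_mem _ _

theorem mem_range_aug {x : ExtAlg K n} : x ∈ J ↔ ∃ y, F.aug y = x := by
  have := SetLike.ext_iff.1 F.range_aug x
  exact this.symm

theorem aug_mem_ideal (y) : F.aug y ∈ J := F.mem_range_aug.2 ⟨y, rfl⟩

theorem homComp_mem_ideal (F : GradedFreeResolution J) (k : ℕ) {x : ExtAlg K n} (hx : x ∈ J) :
    homComp K n k x ∈ J := by
  obtain ⟨y, rfl⟩ := F.mem_range_aug.1 hx
  rw [← aug_freeComp]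
  exact F.aug_mem_ideal _

/-- The same dimension shift along F_0 → J. Only the hypothesis that ω is a cycle is needed at this
last stage, since its lift then has differential in the image of d_0. -/
theorem exists_cartan_ideal [CharZero K] {d : ℕ}
    (hF : ∀ i m : ℕ, m ≠ i + d → F.betti i m = 0) (b : Basis (Fin n) K (Fin n → K)) (i : ℕ)
    {k : ℕ} (hk : k + 1 ≠ d) (ω : (Fin n →₀ ℕ) → ExtAlg K n)
    (hω : ∀ α, α.degree = i → ω α ∈ J ∧ ω α ∈ extDeg K n (k + 1))
    (hc : ∀ α, α.degree + 1 = i → cartan b ω α = 0) :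
    ∃ η : (Fin n →₀ ℕ) → ExtAlg K n,
      (∀ α, α.degree = i + 1 → η α ∈ J ∧ η α ∈ extDeg K n k) ∧
      ∀ α, α.degree = i → cartan b η α = ω α := by
  have hlift : ∀ α : Fin n →₀ ℕ, ∃ y : Fin (F.rank 0) → ExtAlg K n, α.degree = i →
      y ∈ freeDeg K n (F.deg 0) (k + 1) ∧ F.aug y = ω α := by
    intro α
    by_cases hα : α.degree = i
    · obtain ⟨y, hy⟩ := F.mem_range_aug.1 (hω α hα).1
      refine ⟨freeComp (F.deg 0) (k + 1) y, fun _ => ⟨freeComp_mem _ _ _, ?_⟩⟩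
      rw [aug_freeComp, hy, homComp_same (hω α hα).2]
    · exact ⟨0, fun h => absurd h hα⟩
  choose ω' hω' using hlift
  cases i with
  | zero =>
    obtain ⟨w, z, hz, hyz⟩ := F.exists_sub_map_eq_sum b (hF 0 (k + 1) (by omega))
      (hω' 0 (by simp)).1 (F.aug₀_mem_barDeg (hω' 0 (by simp)).1)
    classical
    refine ⟨fun α => if h : ∃ l, α = Finsupp.single l 1 then F.aug (z h.choose) else 0,
      fun α _ => ?_, fun α hα => ?_⟩
    · dsimp only
      split_ifs with h
      · exact ⟨F.aug_mem_ideal _, F.aug_mem (hz _)⟩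
      · exact ⟨zero_mem _, zero_mem _⟩
    · obtain rfl : α = 0 := (Finsupp.degree_eq_zero_iff α).1 hα
      have hch : ∀ l : Fin n, ∀ h : ∃ l', Finsupp.single l 1 = (Finsupp.single l' 1 : _ →₀ ℕ),
          h.choose = l := fun l h =>
        ((Finsupp.single_left_inj one_ne_zero).1 h.choose_spec).symm
      have h3 : ∀ l : Fin n, ∃ l', Finsupp.single l 1 = (Finsupp.single l' 1 : _ →₀ ℕ) :=
        fun l => ⟨l, rfl⟩
      simp only [cartan, zero_add, h3, dif_pos, hch]
      have h4 := congrArg F.aug hyz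
      rw [map_sub, F.exact_aug.apply_apply_eq_zero, sub_zero, (hω' 0 (by simp)).2, map_sum] at h4
      rw [h4]
      simp
  | succ i =>
    obtain ⟨η, hη, hηω⟩ := F.exists_cartan_range hF b i 0 (k + 1) (by omega) (cartan b ω') ω'
      (fun α hα => by
        constructor
        · have : F.aug (cartan b ω' α) = 0 := by
            rw [map_cartan, ← hc α (by omega)]
            exact cartan_congr _ (fun β hβ => (hω' β hβ).2) hα
          exact (F.exact_aug _).1 this
        · exact sum_mem fun l _ => vec_smul_mem_freeDeg (hω' _ (by simp [hα])).1 _)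
      (fun α _ => rfl)
    obtain ⟨ζ, hζ, hζω⟩ := exists_cartan_eq_free b (ω' - η)
      (fun α hα => sub_mem (hω' α hα).1 (hη α hα).2)
      (fun α hα => by rw [cartan_sub, Pi.sub_apply, hηω α hα, sub_self])
    refine ⟨fun α => F.aug (ζ α), fun α hα => ⟨F.aug_mem_ideal _, F.aug_mem (hζ α hα)⟩,
      fun α hα => ?_⟩
    rw [← map_cartan, hζω α hα, Pi.sub_apply, map_sub, (hω' α hα).2]
    have : F.aug (η α) = 0 := (F.exact_aug _).2 (hη α hα).1
    rw [this, sub_zero]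

end GradedFreeResolution

/-! ### Monomials, boundaries and supports. -/

section Monomials

variable {K : Type*} [Field K] {n : ℕ}

/-- The monomial `e_F`. -/
def mon (K : Type*) [Field K] {n : ℕ} (F : Finset (Fin n)) : ExtAlg K n :=
  ((F.sort (· ≤ ·)).map (extVar K)).prod

theorem extVar_eq (i : Fin n) : extVar K i = vec (Pi.single i 1) := rfl

theorem extVar_mul_self (i : Fin n) : extVar K i * extVar K i = 0 := vec_mul_self _

theorem prod_perm {l l' : List (Fin n)} (h : l.Perm l') :
    (l.map (extVar K)).prod = (l'.map (extVar K)).prod ∨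
      (l.map (extVar K)).prod = -(l'.map (extVar K)).prod := by
  induction h with
  | nil => exact Or.inl rfl
  | cons x _ ih =>
    simp only [List.map_cons, List.prod_cons]
    rcases ih with ih | ih <;> rw [ih]
    · exact Or.inl rfl
    · exact Or.inr (mul_neg _ _)
  | swap x y l =>
    right
    simp only [List.map_cons, List.prod_cons]
    rw [← mul_assoc, ← mul_assoc, extVar_eq, extVar_eq, vec_mul_vec, neg_mul]
  | trans _ _ ih ih' =>
    rcases ih with ih | ih <;> rcases ih' with ih' | ih' <;> simp [ih, ih']

theorem mon_eq_basis (F : Finset (Fin n)) :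
    mon K F = (Pi.basisFun K (Fin n)).ExteriorAlgebra F := by
  rw [ExteriorAlgebra.basis_apply_ofCard (n := F.card) _ rfl]
  simp only [ExteriorAlgebra.ιMulti_family, ExteriorAlgebra.ιMulti_apply, mon]
  congr 1
  refine List.ext_get (by simp) fun i h1 h2 => ?_
  simp [extVar, Set.powersetCard.ofFinEmbEquiv_symm_apply]
  rfl

theorem mon_ne_zero (F : Finset (Fin n)) : mon K F ≠ 0 := by
  rw [mon_eq_basis]; exact Basis.ne_zero _ _

theorem mon_empty : mon K (∅ : Finset (Fin n)) = 1 := by simp [mon]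

theorem extVar_mul_mon_of_notMem {i : Fin n} {F : Finset (Fin n)} (h : i ∉ F) :
    extVar K i * mon K F = mon K (insert i F) ∨ extVar K i * mon K F = -mon K (insert i F) := by
  have hp : (i :: F.sort (· ≤ ·)).Perm ((insert i F).sort (· ≤ ·)) := by
    refine List.perm_of_nodup_nodup_toFinset_eq ?_ (Finset.sort_nodup _ _) ?_
    · simp [h]
    · simp
  have := prod_perm (K := K) hp
  rw [List.map_cons, List.prod_cons] at this
  exact this

theorem extVar_mul_mon_of_mem {i : Fin n} {F : Finset (Fin n)} (h : i ∈ F) :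
    extVar K i * mon K F = 0 := by
  rcases extVar_mul_mon_of_notMem (K := K) (Finset.notMem_erase i F) with h1 | h1 <;>
    rw [Finset.insert_erase h] at h1
  · rw [← h1, ← mul_assoc, extVar_mul_self, zero_mul]
  · rw [← neg_neg (mon K F), ← h1, mul_neg, ← mul_assoc, extVar_mul_self, zero_mul, neg_zero]

/-- Closure under negation is required because multiplication by a variable inserts an index only up
to sign. -/
theorem mon_induction {C : Finset (Fin n) → ExtAlg K n → Prop} (h1 : C ∅ 1)
    (hneg : ∀ F x, C F x → C F (-x))
    (hmul : ∀ i F, i ∉ F → C F (mon K F) → C (insert i F) (extVar K i * mon K F))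
    (F : Finset (Fin n)) : C F (mon K F) := by
  classical
  induction F using Finset.induction_on with
  | empty => rw [mon_empty]; exact h1
  | insert i F hi ih =>
    have := hmul i F hi ih
    rcases extVar_mul_mon_of_notMem (K := K) hi with h | h
    · rwa [h] at this
    · rw [h] at this; simpa using hneg _ _ this

theorem mon_mem (F : Finset (Fin n)) : mon K F ∈ extDeg K n F.card := by
  refine mon_induction (C := fun F x => x ∈ extDeg K n F.card) ?_ (fun F x h => neg_mem h)
    (fun i F hi h => ?_) F
  · rw [Finset.card_empty, extDeg_zero]; exact Submodule.one_le.1 le_rfl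
  · rw [Finset.card_insert_of_notMem hi]; exact vec_mul_mem _ h

/-- The span of the monomials `e_F` with `F` in a given family. -/
def monSpan (K : Type*) [Field K] {n : ℕ} (S : Set (Finset (Fin n))) : Submodule K (ExtAlg K n) :=
  Submodule.span K (mon K '' S)

theorem mon_mem_monSpan {S : Set (Finset (Fin n))} {F : Finset (Fin n)} (h : F ∈ S) :
    mon K F ∈ monSpan K S :=
  Submodule.subset_span ⟨F, h, rfl⟩

theorem monSpan_mono {S T : Set (Finset (Fin n))} (h : S ⊆ T) : monSpan K S ≤ monSpan K T :=
  Submodule.span_mono (Set.image_mono h)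

/-- Monomials form a basis, so disjoint families of supports separate subspaces. This is how two
parts of J are shown to be independent. -/
theorem disjoint_monSpan {S T : Set (Finset (Fin n))} (h : Disjoint S T) :
    Disjoint (monSpan K S) (monSpan K T) := by
  have := ((Pi.basisFun K (Fin n)).ExteriorAlgebra).linearIndependent.disjoint_span_image h
  have he : mon K (n := n) = (Pi.basisFun K (Fin n)).ExteriorAlgebra := funext mon_eq_basis
  rw [monSpan, monSpan, he]
  exact this

theorem extVar_mul_mem_monSpan {S T : Set (Finset (Fin n))} {i : Fin n}
    (h : ∀ F ∈ S, i ∉ F → insert i F ∈ T) {x : ExtAlg K n} (hx : x ∈ monSpan K S) :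
    extVar K i * x ∈ monSpan K T := by
  refine Submodule.span_induction (p := fun x _ => extVar K i * x ∈ monSpan K T) ?_ ?_ ?_ ?_ hx
  · rintro _ ⟨F, hF, rfl⟩
    by_cases hi : i ∈ F
    · rw [extVar_mul_mon_of_mem hi]; exact zero_mem _
    · rcases extVar_mul_mon_of_notMem (K := K) hi with h1 | h1 <;> rw [h1]
      · exact mon_mem_monSpan (h F hF hi)
      · exact neg_mem (mon_mem_monSpan (h F hF hi))
  · rw [mul_zero]; exact zero_mem _
  · intro x y _ _ hx hy; rw [mul_add]; exact add_mem hx hy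
  · intro c x _ hx; rw [mul_smul_comm]; exact Submodule.smul_mem _ _ hx

theorem extDeg_le_monSpan (k : ℕ) : extDeg K n k ≤ monSpan K {F | F.card = k} := by
  induction k with
  | zero =>
    intro x hx
    obtain ⟨c, rfl⟩ := mem_extDeg_zero hx
    rw [Algebra.algebraMap_eq_smul_one, ← mon_empty]
    exact Submodule.smul_mem _ _ (mon_mem_monSpan (by simp))
  | succ k ih =>
    intro x hx
    refine extDeg_succ_induction (C := fun x => x ∈ monSpan K {F | F.card = k + 1})
      (fun v x hx => ?_) (fun x y hx hy => add_mem hx hy) hx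
    have hv : vec v = ∑ i, v i • extVar K i := by
      conv_lhs => rw [pi_eq_sum_univ' v, map_sum]
      refine Finset.sum_congr rfl fun i _ => ?_
      rw [map_smul, extVar_eq]
    rw [hv, Finset.sum_mul]
    refine sum_mem fun i _ => ?_
    rw [smul_mul_assoc]
    refine Submodule.smul_mem _ _ (extVar_mul_mem_monSpan ?_ (ih hx))
    intro F hF hi
    exact (Finset.card_insert_of_notMem hi).trans (congrArg _ hF)

/-- The sum of the coordinates. -/
def coordSum (K : Type*) [Field K] (n : ℕ) : Dual K (Fin n → K) := ∑ i, LinearMap.proj i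

theorem coordSum_apply (v : Fin n → K) : coordSum K n v = ∑ i, v i := by
  simp [coordSum, LinearMap.sum_apply]

theorem coordSum_single (i : Fin n) : coordSum K n (Pi.single i 1) = 1 := by
  simp [coordSum_apply, Finset.sum_pi_single']

theorem ctr_prod (φ : Dual K (Fin n → K)) (c : K) (l : List (Fin n))
    (h : ∀ i ∈ l, φ (Pi.single i 1) = c) :
    ctr φ (l.map (extVar K)).prod =
      c • ∑ j ∈ Finset.range l.length, (-1) ^ j * ((l.eraseIdx j).map (extVar K)).prod := by
  induction l with
  | nil => simp [ctr_one]
  | cons i l ih =>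
    rw [List.map_cons, List.prod_cons, extVar_eq, ctr_vec_mul, h i (by simp),
      ih fun j hj => h j (by simp [hj]), List.length_cons, Finset.sum_range_succ']
    simp only [pow_succ, List.eraseIdx_cons_succ, List.map_cons, List.prod_cons,
      List.eraseIdx_cons_zero, pow_zero, one_mul, smul_add]
    rw [add_comm, sub_eq_add_neg]
    congr 1
    rw [mul_smul_comm, ← smul_neg, Finset.mul_sum, ← Finset.sum_neg_distrib]
    congr 1
    refine Finset.sum_congr rfl fun j _ => ?_
    rw [← mul_assoc, ← mul_assoc, ← extVar_eq, mul_neg_one, neg_mul, neg_mul,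
      ((Commute.neg_one_left (extVar K i)).pow_left j).eq]

theorem ctr_mon (φ : Dual K (Fin n → K)) (c : K) (F : Finset (Fin n))
    (h : ∀ i ∈ F, φ (Pi.single i 1) = c) : ctr φ (mon K F) = c • boundaryMonomial K F := by
  rw [mon, ctr_prod φ c _ fun i hi => h i (by simpa using hi), Finset.length_sort,
    boundaryMonomial]

theorem boundaryMonomial_eq (F : Finset (Fin n)) :
    boundaryMonomial K F = ctr (coordSum K n) (mon K F) := by
  rw [ctr_mon _ 1 F fun i _ => coordSum_single i, one_smul]

/-- Contractions anticommute, contraction of e_F with φ is a multiple of ∂e_F, and ∂∂ = 0. -/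
theorem ctr_boundaryMonomial (φ : Dual K (Fin n → K)) (c : K) (F : Finset (Fin n))
    (h : ∀ i ∈ F, φ (Pi.single i 1) = c) : ctr φ (boundaryMonomial K F) = 0 := by
  have : boundaryMonomial K F = ctr (coordSum K n) (mon K F) := boundaryMonomial_eq F
  have h2 := CliffordAlgebra.contractLeft_comm (Q := (0 : QuadraticForm K (Fin n → K)))
    φ (coordSum K n) (mon K F)
  change ctr φ (ctr (coordSum K n) (mon K F)) = -(ctr (coordSum K n) (ctr φ (mon K F))) at h2
  rw [this, h2, ctr_mon φ c F h, map_smul, this, ctr_ctr, smul_zero, neg_zero]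

theorem ctr_mon_mem_monSpan (φ : Dual K (Fin n → K)) (F : Finset (Fin n)) :
    ctr φ (mon K F) ∈ monSpan K {G | ∃ i ∈ F, G = F.erase i} := by
  refine mon_induction
    (C := fun F x => ctr φ x ∈ monSpan K {G | ∃ i ∈ F, G = F.erase i}) ?_ ?_ ?_ F
  · rw [ctr_one]; exact zero_mem _
  · intro F x h; rw [map_neg]; exact neg_mem h
  · intro i F hi h
    rw [extVar_eq, ctr_vec_mul]
    refine sub_mem (Submodule.smul_mem _ _ (mon_mem_monSpan ⟨i, by simp, ?_⟩))
      (extVar_mul_mem_monSpan ?_ h)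
    · rw [Finset.erase_insert hi]
    · rintro _ ⟨j, hj, rfl⟩ hi'
      refine ⟨j, by simp [hj], ?_⟩
      rw [Finset.erase_insert_of_ne]
      rintro rfl
      exact hi hj

theorem boundaryMonomial_mem_monSpan (F : Finset (Fin n)) :
    boundaryMonomial K F ∈ monSpan K {G | ∃ i ∈ F, G = F.erase i} := by
  rw [boundaryMonomial_eq]; exact ctr_mon_mem_monSpan _ _

theorem boundaryMonomial_mem {F : Finset (Fin n)} {k : ℕ} (hF : F.card = k + 1) :
    boundaryMonomial K F ∈ extDeg K n k := by
  rw [boundaryMonomial_eq]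
  exact ctr_mem _ (hF ▸ mon_mem F)

theorem extVar_mul_boundaryMonomial {i : Fin n} {F : Finset (Fin n)} (hi : i ∈ F) :
    extVar K i * boundaryMonomial K F = mon K F := by
  have h := ctr_vec_mul (coordSum K n) (Pi.single i 1) (mon K F)
  rw [← extVar_eq, extVar_mul_mon_of_mem hi, map_zero, coordSum_single, one_smul,
    ← boundaryMonomial_eq] at h
  exact (sub_eq_zero.1 h.symm).symm

theorem boundaryMonomial_ne_zero {F : Finset (Fin n)} (hF : F.Nonempty) :
    boundaryMonomial K F ≠ 0 := by
  obtain ⟨i, hi⟩ := hF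
  intro h
  have := extVar_mul_boundaryMonomial (K := K) hi
  rw [h, mul_zero] at this
  exact mon_ne_zero F this.symm

/-- The boundary of a monomial may be rewritten with a base point. -/
theorem boundaryMonomial_mem_span_insert (y : Fin n) (F : Finset (Fin n)) :
    boundaryMonomial K F ∈ Submodule.span K
      {x | ∃ i ∈ F, y ∉ F.erase i ∧ x = boundaryMonomial K (insert y (F.erase i))} := by
  -- Since ∂∂ = 0, ∂(e_y ∂e_F) = ∂e_F for every index y; expanding ∂e_F inside gives boundaries of
  -- sets through y.
  have h1 : boundaryMonomial K F =
      ctr (coordSum K n) (extVar K y * boundaryMonomial K F) := by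
    rw [extVar_eq, ctr_vec_mul, coordSum_single, one_smul]
    simp only [boundaryMonomial_eq]
    rw [ctr_ctr, mul_zero, sub_zero]
  rw [h1]
  refine Submodule.span_induction (p := fun x _ => ctr (coordSum K n) (extVar K y * x) ∈ _)
    ?_ ?_ ?_ ?_ (boundaryMonomial_mem_monSpan F)
  · rintro _ ⟨_, ⟨i, hi, rfl⟩, rfl⟩
    by_cases hy : y ∈ F.erase i
    · rw [extVar_mul_mon_of_mem hy, map_zero]; exact zero_mem _
    · have hm : boundaryMonomial K (insert y (F.erase i)) ∈ Submodule.span K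
          {x | ∃ i ∈ F, y ∉ F.erase i ∧ x = boundaryMonomial K (insert y (F.erase i))} :=
        Submodule.subset_span ⟨i, hi, hy, rfl⟩
      rw [boundaryMonomial_eq] at hm
      rcases extVar_mul_mon_of_notMem (K := K) hy with h | h <;> rw [h]
      · exact hm
      · rw [map_neg]; exact neg_mem hm
  · rw [mul_zero, map_zero]; exact zero_mem _
  · intro x y _ _ hx hy; rw [mul_add, map_add]; exact add_mem hx hy
  · intro c x _ hx; rw [mul_smul_comm, map_smul]; exact Submodule.smul_mem _ _ hx

end Monomials

/-! ### Reading off the lowest degree of a two-sided ideal from its generators. -/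

section Span

variable {K : Type*} [Field K] {n : ℕ}

/-- The elements without components of degree less than `d` whose component of degree `d` lies in
`P` form a two-sided ideal. -/
def orderIdeal (d : ℕ) (P : Submodule K (ExtAlg K n)) : Ideal (ExtAlg K n) where
  carrier := {x | (∀ j < d, homComp K n j x = 0) ∧ homComp K n d x ∈ P}
  zero_mem' := ⟨fun j _ => map_zero _, by rw [map_zero]; exact zero_mem _⟩
  add_mem' := fun hx hy => ⟨fun j hj => by rw [map_add, hx.1 j hj, hy.1 j hj, add_zero], by
    rw [map_add]; exact add_mem hx.2 hy.2⟩
  smul_mem' := fun a x hx => by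
    obtain ⟨s, hs⟩ := exists_sum_homComp a
    have key : ∀ i, (∀ j < d, homComp K n j (homComp K n i a * x) = 0) ∧
        homComp K n d (homComp K n i a * x) ∈ P := by
      intro i
      constructor
      · intro j hj
        by_cases h : i ≤ j
        · rw [homComp_mul_left_of_le _ (homComp_mem i a) h, hx.1 _ (by omega), mul_zero]
        · exact homComp_mul_left_of_not_le _ (homComp_mem i a) h
      · by_cases h : i ≤ d
        · rw [homComp_mul_left_of_le _ (homComp_mem i a) h]
          rcases Nat.eq_zero_or_pos i with rfl | hi
          · obtain ⟨c, hc⟩ := mem_extDeg_zero (homComp_mem 0 a)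
            rw [hc, ← Algebra.smul_def]
            exact Submodule.smul_mem _ _ hx.2
          · rw [hx.1 _ (by omega), mul_zero]; exact zero_mem _
        · rw [homComp_mul_left_of_not_le _ (homComp_mem i a) h]; exact zero_mem _
    rw [smul_eq_mul, hs, Finset.sum_mul]
    refine ⟨fun j hj => ?_, ?_⟩
    · rw [map_sum]; exact Finset.sum_eq_zero fun i _ => (key i).1 j hj
    · rw [map_sum]; exact sum_mem fun i _ => (key i).2

theorem orderIdeal_isTwoSided (d : ℕ) (P : Submodule K (ExtAlg K n)) :
    (orderIdeal d P).IsTwoSided := by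
  refine ⟨fun {x} a hx => ?_⟩
  obtain ⟨s, hs⟩ := exists_sum_homComp a
  have key : ∀ i, (∀ j < d, homComp K n j (x * homComp K n i a) = 0) ∧
      homComp K n d (x * homComp K n i a) ∈ P := by
    intro i
    constructor
    · intro j hj
      by_cases h : i ≤ j
      · rw [homComp_mul_of_le _ (homComp_mem i a) h, hx.1 _ (by omega), zero_mul]
      · exact homComp_mul_of_not_le _ (homComp_mem i a) h
    · by_cases h : i ≤ d
      · rw [homComp_mul_of_le _ (homComp_mem i a) h]
        rcases Nat.eq_zero_or_pos i with rfl | hi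
        · obtain ⟨c, hc⟩ := mem_extDeg_zero (homComp_mem 0 a)
          rw [hc, ← Algebra.commutes, ← Algebra.smul_def]
          exact Submodule.smul_mem _ _ hx.2
        · rw [hx.1 _ (by omega), zero_mul]; exact zero_mem _
      · rw [homComp_mul_of_not_le _ (homComp_mem i a) h]; exact zero_mem _
  rw [hs, Finset.mul_sum]
  refine ⟨fun j hj => ?_, ?_⟩
  · rw [map_sum]; exact Finset.sum_eq_zero fun i _ => (key i).1 j hj
  · rw [map_sum]; exact sum_mem fun i _ => (key i).2

theorem span_asIdeal_le_orderIdeal {S : Set (ExtAlg K n)} {d : ℕ} {P : Submodule K (ExtAlg K n)}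
    (h : ∀ x ∈ S, x ∈ orderIdeal d P) : (TwoSidedIdeal.span S).asIdeal ≤ orderIdeal d P := by
  have := orderIdeal_isTwoSided (K := K) (n := n) d P
  have h1 : TwoSidedIdeal.span S ≤ (orderIdeal d P).toTwoSided :=
    TwoSidedIdeal.span_le.2 fun x hx => Ideal.mem_toTwoSided.2 (h x hx)
  exact fun x hx => Ideal.mem_toTwoSided.1 (h1 hx)

theorem mem_orderIdeal_of_lt {d k : ℕ} {P : Submodule K (ExtAlg K n)} {x : ExtAlg K n}
    (hx : x ∈ extDeg K n k) (h : d < k) : x ∈ orderIdeal d P :=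
  ⟨fun j hj => homComp_ne hx (by omega), by rw [homComp_ne hx (by omega)]; exact zero_mem _⟩

theorem mem_orderIdeal_of_eq {d : ℕ} {P : Submodule K (ExtAlg K n)} {x : ExtAlg K n}
    (hx : x ∈ extDeg K n d) (h : x ∈ P) : x ∈ orderIdeal d P :=
  ⟨fun j hj => homComp_ne hx (by omega), by rwa [homComp_same hx]⟩

end Span

/-! ### Vector configurations of girth at least d + 1 and the counting of base points. -/

section VectorConfiguration

variable {L V : Type*} [Field L] [AddCommGroup V] [Module L V] {n : ℕ}

/-- The span of the vectors `a i`, `i ∈ F`. -/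
def vspan (L : Type*) {V : Type*} [Field L] [AddCommGroup V] [Module L V] {n : ℕ}
    (a : Fin n → V) (F : Finset (Fin n)) : Submodule L V :=
  Submodule.span L (a '' F)

/-- The vectors `a i`, `i ∈ F`, are linearly dependent. -/
def Dep (L : Type*) {V : Type*} [Field L] [AddCommGroup V] [Module L V] {n : ℕ}
    (a : Fin n → V) (F : Finset (Fin n)) : Prop :=
  ¬LinearIndependent L (fun i : F => a i)

variable {a : Fin n → V} {F G : Finset (Fin n)}

theorem mem_vspan {i : Fin n} (h : i ∈ F) : a i ∈ vspan L a F :=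
  Submodule.subset_span ⟨i, h, rfl⟩

theorem vspan_le {Y : Submodule L V} : vspan L a F ≤ Y ↔ ∀ i ∈ F, a i ∈ Y := by
  rw [vspan, Submodule.span_le]
  exact ⟨fun h i hi => h ⟨i, hi, rfl⟩, by rintro h _ ⟨i, hi, rfl⟩; exact h i hi⟩

theorem vspan_mono (h : F ⊆ G) : vspan L a F ≤ vspan L a G :=
  vspan_le.2 fun _ hi => mem_vspan (h hi)

theorem dep_iff : Dep L a F ↔ finrank L (vspan L a F) < F.card := by
  have hr : Set.range (fun i : F => a i) = a '' F := by
    ext; simp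
  have h1 := linearIndependent_iff_card_eq_finrank_span (R := L) (b := fun i : F => a i)
  have h2 := finrank_range_le_card (R := L) (fun i : F => a i)
  rw [Set.finrank, hr, Fintype.card_coe] at h1 h2
  rw [Dep, h1, vspan]
  omega

theorem finrank_vspan_le : finrank L (vspan L a F) ≤ F.card := by
  have hr : Set.range (fun i : F => a i) = a '' F := by
    ext; simp
  have h2 := finrank_range_le_card (R := L) (fun i : F => a i)
  rwa [Set.finrank, hr, Fintype.card_coe] at h2

theorem finrank_vspan (h : ¬Dep L a F) : finrank L (vspan L a F) = F.card := by
  rw [dep_iff] at h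
  have := finrank_vspan_le (L := L) (a := a) (F := F)
  omega

theorem Dep.mono (h : Dep L a F) (hFG : F ⊆ G) : Dep L a G := by
  intro hG
  exact h (hG.comp (Set.inclusion (s := (F : Set (Fin n))) (t := G) (by exact_mod_cast hFG))
    (Set.inclusion_injective _))

open Classical in
/-- The indices of the vectors in a subspace. -/
def pts (a : Fin n → V) (Y : Submodule L V) : Finset (Fin n) := Finset.univ.filter (a · ∈ Y)

theorem mem_pts {Y : Submodule L V} {i : Fin n} : i ∈ pts a Y ↔ a i ∈ Y := by
  simp [pts]

theorem insert_injOn {x : Fin n} (hF : x ∉ F) (hG : x ∉ G) (h : insert x F = insert x G) :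
    F = G := by
  rw [← Finset.erase_insert hF, h, Finset.erase_insert hG]

/-- A choice of a base point on each subspace, with priority for `o`, `t` and the points of `U`. -/
theorem exists_basePoint (a : Fin n → V) (o t : Fin n) (U : Submodule L V) :
    ∃ y : Submodule L V → Fin n,
      (∀ Y, a o ∈ Y → y Y = o) ∧ (∀ Y, a o ∉ Y → a t ∈ Y → y Y = t) ∧
      (∀ Y, a o ∉ Y → a t ∉ Y → (∃ i, a i ∈ U ∧ a i ∈ Y) →
        a (y Y) ∈ U ∧ a (y Y) ∈ Y ∧ ∀ i, a i ∈ U → a i ∈ Y → y Y ≤ i) := by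
  have key : ∀ Y : Submodule L V, ∃ y : Fin n, (a o ∈ Y → y = o) ∧
      (a o ∉ Y → a t ∈ Y → y = t) ∧
      (a o ∉ Y → a t ∉ Y → (∃ i, a i ∈ U ∧ a i ∈ Y) →
        a y ∈ U ∧ a y ∈ Y ∧ ∀ i, a i ∈ U → a i ∈ Y → y ≤ i) := by
    intro Y
    by_cases ho : a o ∈ Y
    · exact ⟨o, fun _ => rfl, fun h => absurd ho h, fun h => absurd ho h⟩
    by_cases ht : a t ∈ Y
    · exact ⟨t, fun h => absurd h ho, fun _ _ => rfl, fun _ h => absurd ht h⟩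
    by_cases hU : ∃ i, a i ∈ U ∧ a i ∈ Y
    · have hne : (pts a (U ⊓ Y)).Nonempty := by
        obtain ⟨i, hi⟩ := hU
        exact ⟨i, mem_pts.2 (Submodule.mem_inf.2 hi)⟩
      have hm := Submodule.mem_inf.1 (mem_pts.1 (Finset.min'_mem _ hne))
      refine ⟨(pts a (U ⊓ Y)).min' hne, fun h => absurd h ho, fun _ h => absurd h ht,
        fun _ _ _ => ⟨hm.1, hm.2, fun i hi hi' => ?_⟩⟩
      exact Finset.min'_le _ _ (mem_pts.2 (Submodule.mem_inf.2 ⟨hi, hi'⟩))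
    · exact ⟨o, fun h => absurd h ho, fun _ h => absurd h ht, fun _ _ h => absurd h hU⟩
  choose y h1 h2 h3 using key
  exact ⟨y, h1, h2, h3⟩

theorem finrank_vspan_of_card_le {d : ℕ} (hg : ∀ F, Dep L a F → d + 1 ≤ F.card)
    (h : F.card ≤ d) : finrank L (vspan L a F) = F.card :=
  finrank_vspan fun h' => by have := hg F h'; omega

variable [FiniteDimensional L V]

theorem dep_of_le {Y : Submodule L V} (hF : ∀ i ∈ F, a i ∈ Y) (h : finrank L Y < F.card) :
    Dep L a F :=
  dep_iff.2 ((Submodule.finrank_mono (vspan_le.2 hF)).trans_lt h)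

variable {d : ℕ} (hg : ∀ F, Dep L a F → d + 1 ≤ F.card)

include hg in
theorem vspan_eq_of_card_eq {Y : Submodule L V} (hY : finrank L Y ≤ d) (hF : F.card = d)
    (h : ∀ i ∈ F, a i ∈ Y) : vspan L a F = Y := by
  have h1 := finrank_vspan_of_card_le hg hF.le
  exact Submodule.eq_of_le_of_finrank_le (vspan_le.2 h) (by omega)

include hg in
theorem finrank_vspan_circuit (hF : F.card = d + 1) (h : Dep L a F) :
    finrank L (vspan L a F) = d := by
  have h1 := dep_iff.1 h
  obtain ⟨i, hi⟩ : F.Nonempty := Finset.card_pos.1 (by omega)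
  have h2 := finrank_vspan_of_card_le hg (F := F.erase i)
    (by rw [Finset.card_erase_of_mem hi]; omega)
  have h3 := Submodule.finrank_mono (vspan_mono (L := L) (a := a) (Finset.erase_subset i F))
  rw [h2, Finset.card_erase_of_mem hi] at h3
  omega

include hg in
theorem vspan_erase (hF : F.card = d + 1) (h : Dep L a F) {i : Fin n} (hi : i ∈ F) :
    vspan L a (F.erase i) = vspan L a F :=
  vspan_eq_of_card_eq hg (finrank_vspan_circuit hg hF h).le
    (by rw [Finset.card_erase_of_mem hi]; omega)
    fun j hj => mem_vspan (Finset.mem_of_mem_erase hj)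

include hg in
-- Any d vectors are independent. If x were not in Q, the d points of Q ∪ {x} would span both Y and
-- the span of Q ∪ {p}, putting a p into Y.
theorem mem_of_mem_vspan_insert {Y : Submodule L V} (hY : finrank L Y ≤ d)
    {Q : Finset (Fin n)} (hQ : Q.card + 1 = d) (hQY : ∀ i ∈ Q, a i ∈ Y) {p : Fin n}
    (hp : a p ∉ Y) {x : Fin n} (hx : a x ∈ vspan L a (insert p Q)) (hxY : a x ∈ Y) : x ∈ Q := by
  by_contra hxQ
  have hc : (insert x Q).card = d := by rw [Finset.card_insert_of_notMem hxQ, hQ]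
  have h1 : vspan L a (insert x Q) = Y := vspan_eq_of_card_eq hg hY hc (by
    intro i hi
    rcases Finset.mem_insert.1 hi with rfl | hi
    · exact hxY
    · exact hQY i hi)
  have h2 : vspan L a (insert x Q) = vspan L a (insert p Q) := by
    refine vspan_eq_of_card_eq hg ?_ hc ?_
    · have h3 := finrank_vspan_le (L := L) (a := a) (F := insert p Q)
      have h4 := Finset.card_insert_le p Q
      omega
    · intro i hi
      rcases Finset.mem_insert.1 hi with rfl | hi
      · exact hx
      · exact mem_vspan (Finset.mem_insert_of_mem hi)
  exact hp (h1 ▸ h2 ▸ mem_vspan (Finset.mem_insert_self p Q))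

include hg in
/-- A point of `U` outside `Y`, the least one. -/
theorem exists_outsidePoint {U : Submodule L V} (hU : finrank L U = d)
    {C : Finset (Fin n)} (hC : C.card = d) (hCU : ∀ i ∈ C, a i ∈ U) (q : Fin n) :
    ∃ p : Submodule L V → Fin n, p U = q ∧ ∀ Y : Submodule L V, finrank L Y = d → Y ≠ U →
      a (p Y) ∈ U ∧ a (p Y) ∉ Y ∧ ∀ i, a i ∈ U → a i ∉ Y → p Y ≤ i := by
  have key : ∀ Y : Submodule L V, ∃ p : Fin n, (Y = U → p = q) ∧ (finrank L Y = d → Y ≠ U →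
      a p ∈ U ∧ a p ∉ Y ∧ ∀ i, a i ∈ U → a i ∉ Y → p ≤ i) := by
    intro Y
    by_cases hYU : Y = U
    · exact ⟨q, fun _ => rfl, fun _ h => absurd hYU h⟩
    by_cases hY : finrank L Y = d
    · have hne : (pts a U \ pts a Y).Nonempty := by
        by_contra hne
        rw [Finset.not_nonempty_iff_eq_empty, Finset.sdiff_eq_empty_iff_subset] at hne
        refine hYU ?_
        rw [← vspan_eq_of_card_eq hg hU.le hC hCU]
        exact (vspan_eq_of_card_eq hg hY.le hC
          fun i hi => mem_pts.1 (hne (mem_pts.2 (hCU i hi)))).symm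
      have hm := Finset.mem_sdiff.1 (Finset.min'_mem _ hne)
      refine ⟨_, fun h => absurd h hYU, fun _ _ => ⟨mem_pts.1 hm.1,
        fun h => hm.2 (mem_pts.2 h), fun i hi hi' => Finset.min'_le _ _ ?_⟩⟩
      exact Finset.mem_sdiff.2 ⟨mem_pts.2 hi, fun h => hi' (mem_pts.1 h)⟩
    · exact ⟨q, fun h => absurd h hYU, fun h => absurd h hY⟩
  choose p h1 h2 using key
  exact ⟨p, h1 U rfl, h2⟩

include hg in
open Classical in
-- The base points are o, then t, then the least point of U on the subspace. With two points of W
-- outside U, this choice leaves fewer broken sets than the bound that exactness of the Cartan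
-- complex demands. The inequality is proved on the complement: the good d-sets, those containing
-- their base point, number more than the (d - 1)-subsets of Z'.
theorem exists_card_filter_lt (hd : 2 ≤ d) {U W : Submodule L V} (hU : finrank L U = d)
    (hUW : U ≤ W) (hX : d + 1 ≤ (pts a U).card) {q q' : Fin n} (hqq : q ≠ q')
    (hqW : a q ∈ W) (hqW' : a q' ∈ W) (hqU : a q ∉ U) (hqU' : a q' ∉ U) {o t : Fin n}
    (hot : o ≠ t) (ho : a o ∈ U) (ht : a t ∈ U) :
    ∃ y : Submodule L V → Fin n, (∀ Y, a o ∈ Y → y Y = o) ∧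
      ((((pts a W).erase o).powersetCard d).filter
        fun G => y (vspan L a G) ∉ G).card < (((pts a W).erase o).erase t).card.choose d := by
  obtain ⟨y, hy1, hy2, hy3⟩ := exists_basePoint a o t U
  refine ⟨y, hy1, ?_⟩
  obtain ⟨e, rfl⟩ : ∃ e, d = e + 1 := ⟨d - 1, by omega⟩
  obtain ⟨C, hCX, hC⟩ := Finset.exists_subset_card_eq (show e + 1 ≤ (pts a U).card by omega)
  obtain ⟨p, hp1, hp2⟩ := exists_outsidePoint hg hU hC (fun i hi => mem_pts.1 (hCX hi)) q
  set Z := (pts a W).erase o with hZ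
  set Z' := Z.erase t with hZ'
  have htZ : t ∈ Z := Finset.mem_erase.2 ⟨hot.symm, mem_pts.2 (hUW ht)⟩
  have hZcard : Z.card = Z'.card + 1 := by
    rw [hZ', Finset.card_erase_of_mem htZ]
    have := Finset.card_pos.2 ⟨t, htZ⟩
    omega
  have hmemZ' : ∀ {i}, i ∈ Z' ↔ i ≠ t ∧ i ≠ o ∧ a i ∈ W := by
    intro i; rw [hZ', Finset.mem_erase, hZ, Finset.mem_erase, mem_pts]
  have hmemZ : ∀ {i}, i ∈ Z ↔ i ≠ o ∧ a i ∈ W := by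
    intro i; rw [hZ, Finset.mem_erase, mem_pts]
  -- the good sets
  set good := (Z.powersetCard (e + 1)).filter (fun G => y (vspan L a G) ∈ G) with hgood
  -- Pascal's rule for Z = Z' ∪ {t} turns the upper bound on broken sets into a lower bound on good
  -- ones.
  have hsum : ((Z.powersetCard (e + 1)).filter fun G => y (vspan L a G) ∉ G).card + good.card =
      Z'.card.choose (e + 1) + Z'.card.choose e := by
    rw [add_comm, hgood, Finset.card_filter_add_card_filter_not, Finset.card_powersetCard, hZcard,
      Nat.choose_succ_succ, add_comm]
  suffices hlt : Z'.card.choose e < good.card by omega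
  -- the subspace attached to a set
  set Wf : Finset (Fin n) → Submodule L V := fun Q => vspan L a (insert t Q) with hWf
  have hWrank : ∀ {Q}, Q ∈ Z'.powersetCard e → finrank L (Wf Q) = e + 1 := by
    intro Q hQ
    obtain ⟨h1, h2⟩ := Finset.mem_powersetCard.1 hQ
    have htQ : t ∉ Q := fun h => (hmemZ'.1 (h1 h)).1 rfl
    have hc : (insert t Q).card = e + 1 := by rw [Finset.card_insert_of_notMem htQ, h2]
    rw [hWf]; dsimp only; rw [finrank_vspan_of_card_le hg hc.le, hc]
  have hQW : ∀ {Q : Finset (Fin n)}, ∀ i ∈ Q, a i ∈ Wf Q :=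
    fun i hi => mem_vspan (Finset.mem_insert_of_mem hi)
  have htW : ∀ {Q : Finset (Fin n)}, a t ∈ Wf Q := mem_vspan (Finset.mem_insert_self t _)
  have hpW : ∀ {Q}, Q ∈ Z'.powersetCard e → a (p (Wf Q)) ∉ Wf Q ∧ a (p (Wf Q)) ∈ W := by
    intro Q hQ
    by_cases h : Wf Q = U
    · rw [h, hp1]; exact ⟨hqU, hqW⟩
    · have := hp2 _ (hWrank hQ) h
      exact ⟨this.2.1, hUW this.1⟩
  -- An injection from the e-subsets of Z' to good sets. Adding t works unless o lies on the span of
  -- Q ∪ {t}, since then o takes priority as base point. In that case a point p off this span is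
  -- added instead: the least such point of U, or q when the span is U itself.
  set f : Finset (Fin n) → Finset (Fin n) :=
    fun Q => if a o ∈ Wf Q then insert (p (Wf Q)) Q else insert t Q with hf
  have hpZ' : ∀ {Q}, Q ∈ Z'.powersetCard e → a o ∈ Wf Q → p (Wf Q) ∈ Z' := by
    intro Q hQ ho'
    obtain ⟨h1, h2⟩ := hpW hQ
    refine hmemZ'.2 ⟨?_, ?_, h2⟩
    · intro h; rw [h] at h1; exact h1 htW
    · intro h; rw [h] at h1; exact h1 ho'
  have hpQ : ∀ {Q}, Q ∈ Z'.powersetCard e → p (Wf Q) ∉ Q :=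
    fun hQ h => (hpW hQ).1 (hQW _ h)
  have htnot : ∀ {Q}, Q ∈ Z'.powersetCard e → t ∉ Q := by
    intro Q hQ h
    exact (hmemZ'.1 ((Finset.mem_powersetCard.1 hQ).1 h)).1 rfl
  have honot : ∀ {Q}, Q ∈ Z'.powersetCard e → o ∉ Q := by
    intro Q hQ h
    exact (hmemZ'.1 ((Finset.mem_powersetCard.1 hQ).1 h)).2.1 rfl
  -- sets of the form `Q ∪ p` with `p` outside the subspace of `Q`
  have hbase : ∀ {Q}, Q ∈ Z'.powersetCard e → ∀ {r}, a r ∉ Wf Q → a o ∈ Wf Q →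
      ((∃ i, a i ∈ U ∧ a i ∈ vspan L a (insert r Q)) →
        a (y (vspan L a (insert r Q))) ∈ U ∧
        a (y (vspan L a (insert r Q))) ∈ vspan L a (insert r Q) ∧
        ∀ i, a i ∈ U → a i ∈ vspan L a (insert r Q) → y (vspan L a (insert r Q)) ≤ i) := by
    intro Q hQ r hr ho'
    have h2 := (Finset.mem_powersetCard.1 hQ).2
    refine hy3 _ ?_ ?_
    · intro h
      exact honot hQ (mem_of_mem_vspan_insert hg (hWrank hQ).le (by omega) hQW hr h ho')
    · intro h
      exact htnot hQ (mem_of_mem_vspan_insert hg (hWrank hQ).le (by omega) hQW hr h htW)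
  -- The base point lies on U and on the span of Q ∪ {r} with r off U, hence in Q. That Q is
  -- nonempty, so that such a point exists, uses d ≥ 2.
  have hUcase : ∀ {Q}, Q ∈ Z'.powersetCard e → Wf Q = U → ∀ {r}, a r ∉ U →
      y (vspan L a (insert r Q)) ∈ insert r Q := by
    intro Q hQ hWU r hr
    have h2 := (Finset.mem_powersetCard.1 hQ).2
    obtain ⟨i, hi⟩ : Q.Nonempty := Finset.card_pos.1 (by omega)
    obtain ⟨h3, h4, -⟩ := hbase hQ (by rwa [hWU]) (by rwa [hWU])
      ⟨i, hWU ▸ hQW i hi, mem_vspan (Finset.mem_insert_of_mem hi)⟩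
    exact Finset.mem_insert_of_mem (mem_of_mem_vspan_insert hg (hWrank hQ).le (by omega) hQW
      (by rwa [hWU]) h4 (by rwa [hWU]))
  have hfgood : ∀ Q ∈ Z'.powersetCard e, f Q ∈ good := by
    intro Q hQ
    obtain ⟨h1, h2⟩ := Finset.mem_powersetCard.1 hQ
    rw [hgood, Finset.mem_filter, Finset.mem_powersetCard]
    by_cases ho' : a o ∈ Wf Q
    · have hfQ : f Q = insert (p (Wf Q)) Q := if_pos ho'
      rw [hfQ]
      refine ⟨⟨?_, by rw [Finset.card_insert_of_notMem (hpQ hQ), h2]⟩, ?_⟩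
      · intro i hi
        rcases Finset.mem_insert.1 hi with rfl | hi
        · exact Finset.mem_of_mem_erase (hpZ' hQ ho')
        · exact Finset.mem_of_mem_erase (h1 hi)
      · by_cases hWU : Wf Q = U
        · exact hUcase hQ hWU (hWU ▸ (hpW hQ).1)
        · obtain ⟨h3, h4, h5⟩ := hp2 _ (hWrank hQ) hWU
          obtain ⟨h6, h7, h8⟩ := hbase hQ h4 ho'
            ⟨_, h3, mem_vspan (Finset.mem_insert_self _ _)⟩
          by_cases h9 : a (y (vspan L a (insert (p (Wf Q)) Q))) ∈ Wf Q
          · exact Finset.mem_insert_of_mem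
              (mem_of_mem_vspan_insert hg (hWrank hQ).le (by omega) hQW h4 h7 h9)
          -- The base point y and the point p are both least choices: y among the points of U on the
          -- new span, p among those off W_Q. If y is off W_Q, each is a competitor of the other, so
          -- they coincide.
          · rw [le_antisymm (h8 _ h3 (mem_vspan (Finset.mem_insert_self _ _))) (h5 _ h6 h9)]
            exact Finset.mem_insert_self _ _
    · have hfQ : f Q = insert t Q := if_neg ho'
      rw [hfQ]
      refine ⟨⟨?_, by rw [Finset.card_insert_of_notMem (htnot hQ), h2]⟩, ?_⟩
      · intro i hi
        rcases Finset.mem_insert.1 hi with rfl | hi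
        · exact htZ
        · exact Finset.mem_of_mem_erase (h1 hi)
      · rw [hy2 _ ho' htW]
        exact Finset.mem_insert_self _ _
  -- two sets with a common part of size `e - 1`
  have hcommon : ∀ {Q}, Q ∈ Z'.powersetCard e → a o ∈ Wf Q → ∀ {r}, r ∈ Q →
      ∀ {Y : Submodule L V}, finrank L Y = e + 1 → a o ∈ Y → a t ∈ Y →
      (∀ i ∈ Q.erase r, a i ∈ Y) → Wf Q = Y := by
    intro Q hQ ho' r hr Y hY hoY htY hQY
    have h2 := (Finset.mem_powersetCard.1 hQ).2
    have htS : t ∉ Q.erase r := fun h => htnot hQ (Finset.mem_of_mem_erase h)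
    have hoS : o ∉ insert t (Q.erase r) := by
      rw [Finset.mem_insert]
      rintro (h | h)
      · exact hot h
      · exact honot hQ (Finset.mem_of_mem_erase h)
    have hc : (insert o (insert t (Q.erase r))).card = e + 1 := by
      rw [Finset.card_insert_of_notMem hoS, Finset.card_insert_of_notMem htS,
        Finset.card_erase_of_mem hr, h2]
      have := Finset.card_pos.2 ⟨r, hr⟩
      omega
    have h3 : vspan L a (insert o (insert t (Q.erase r))) = Wf Q := by
      refine vspan_eq_of_card_eq hg (hWrank hQ).le hc fun i hi => ?_
      rcases Finset.mem_insert.1 hi with rfl | hi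
      · exact ho'
      rcases Finset.mem_insert.1 hi with rfl | hi
      · exact htW
      · exact hQW _ (Finset.mem_of_mem_erase hi)
    have h4 : vspan L a (insert o (insert t (Q.erase r))) = Y := by
      refine vspan_eq_of_card_eq hg hY.le hc fun i hi => ?_
      rcases Finset.mem_insert.1 hi with rfl | hi
      · exact hoY
      rcases Finset.mem_insert.1 hi with rfl | hi
      · exact htY
      · exact hQY _ hi
    rw [← h3, h4]
  have hswap : ∀ {r r' : Fin n} {Q Q' : Finset (Fin n)}, insert r Q = insert r' Q' → r ≠ r' →
      r ∈ Q' ∧ r' ∈ Q ∧ ∀ i ∈ Q.erase r', i ∈ Q' := by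
    intro r r' Q Q' h hne
    refine ⟨?_, ?_, fun i hi => ?_⟩
    · exact (Finset.mem_insert.1 (h ▸ Finset.mem_insert_self r Q)).resolve_left hne
    · exact (Finset.mem_insert.1 (h ▸ Finset.mem_insert_self r' Q')).resolve_left hne.symm
    · obtain ⟨h1, h2⟩ := Finset.mem_erase.1 hi
      exact (Finset.mem_insert.1 (h ▸ Finset.mem_insert_of_mem h2)).resolve_left h1
  -- Two preimages with different added points share all but one element. Together with o and t the
  -- common part determines the spans, which therefore agree; but then the added point of one lies
  -- in the other set, inside the span it must avoid.
  have hinj : Set.InjOn f (Z'.powersetCard e) := by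
    have hne : ∀ {Q Q'}, Q ∈ Z'.powersetCard e → Q' ∈ Z'.powersetCard e → a o ∈ Wf Q →
        insert (p (Wf Q)) Q ≠ insert t Q' := by
      intro Q Q' hQ hQ' ho' h
      have h1 : t ∈ insert (p (Wf Q)) Q := h ▸ Finset.mem_insert_self t Q'
      rcases Finset.mem_insert.1 h1 with h2 | h2
      · exact (hmemZ'.1 (hpZ' hQ ho')).1 h2.symm
      · exact htnot hQ h2
    intro Q hQ Q' hQ' h
    rw [Finset.mem_coe] at hQ hQ'
    simp only [hf] at h
    by_cases h1 : a o ∈ Wf Q <;> by_cases h2 : a o ∈ Wf Q'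
    · rw [if_pos h1, if_pos h2] at h
      by_cases hpp : p (Wf Q) = p (Wf Q')
      · rw [hpp] at h
        exact insert_injOn (hpp ▸ hpQ hQ) (hpQ hQ') h
      · obtain ⟨h3, h4, h5⟩ := hswap h hpp
        have := hcommon hQ h1 h4 (hWrank hQ') h2 htW fun i hi => hQW i (h5 i hi)
        exact absurd ((SetLike.ext_iff.1 this _).2 (hQW _ h3)) (hpW hQ).1
    · rw [if_pos h1, if_neg h2] at h
      exact absurd h (hne hQ hQ' h1)
    · rw [if_neg h1, if_pos h2] at h
      exact absurd h.symm (hne hQ' hQ h2)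
    · rw [if_neg h1, if_neg h2] at h
      exact insert_injOn (htnot hQ) (htnot hQ') h
  -- one more good set
  obtain ⟨R, hRX, hR⟩ := Finset.exists_subset_card_eq
    (show e ≤ (((pts a U).erase o).erase t).card by
      rw [Finset.card_erase_of_mem (Finset.mem_erase.2 ⟨hot.symm, mem_pts.2 ht⟩),
        Finset.card_erase_of_mem (mem_pts.2 ho)]
      omega)
  have hRU : ∀ i ∈ R, a i ∈ U := fun i hi =>
    mem_pts.1 (Finset.mem_of_mem_erase (Finset.mem_of_mem_erase (hRX hi)))
  have hRZ : R ∈ Z'.powersetCard e := by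
    refine Finset.mem_powersetCard.2 ⟨fun i hi => ?_, hR⟩
    have h1 := Finset.mem_erase.1 (hRX hi)
    have h2 := Finset.mem_erase.1 h1.2
    exact hmemZ'.2 ⟨h1.1, h2.1, hUW (hRU i hi)⟩
  have hWR : Wf R = U := by
    refine vspan_eq_of_card_eq hg hU.le ?_ ?_
    · rw [Finset.card_insert_of_notMem (htnot hRZ), hR]
    · intro i hi
      rcases Finset.mem_insert.1 hi with rfl | hi
      · exact ht
      · exact hRU i hi
  have hq'o : q' ≠ o := by rintro rfl; exact hqU' ho
  have hq't : q' ≠ t := by rintro rfl; exact hqU' ht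
  have hq'R : q' ∉ R := fun h => hqU' (hRU _ h)
  have hGgood : insert q' R ∈ good := by
    rw [hgood, Finset.mem_filter, Finset.mem_powersetCard]
    refine ⟨⟨fun i hi => ?_, by rw [Finset.card_insert_of_notMem hq'R, hR]⟩,
      hUcase hRZ hWR hqU'⟩
    rcases Finset.mem_insert.1 hi with rfl | hi
    · exact hmemZ.2 ⟨hq'o, hqW'⟩
    · exact Finset.mem_of_mem_erase ((Finset.mem_powersetCard.1 hRZ).1 hi)
  -- Here q' is the second point outside U: over R, whose span with t is U, the injection adds q and
  -- not q'.
  have hGim : insert q' R ∉ (Z'.powersetCard e).image f := by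
    intro h
    obtain ⟨Q, hQ, hfQ⟩ := Finset.mem_image.1 h
    simp only [hf] at hfQ
    by_cases h1 : a o ∈ Wf Q
    · rw [if_pos h1] at hfQ
      by_cases hpq : p (Wf Q) = q'
      · have hQR : Q = R := by
          rw [hpq] at hfQ
          exact insert_injOn (hpq ▸ hpQ hQ) hq'R hfQ
        rw [hQR, hWR, hp1] at hpq
        exact hqq hpq
      · obtain ⟨h3, h4, h5⟩ := hswap hfQ hpq
        have hWU := hcommon hQ h1 h4 hU ho ht fun i hi => hRU i (h5 i hi)
        exact (hpW hQ).1 ((SetLike.ext_iff.1 hWU _).2 (hRU _ h3))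
    · rw [if_neg h1] at hfQ
      have h2 : t ∈ insert q' R := hfQ ▸ Finset.mem_insert_self t Q
      rcases Finset.mem_insert.1 h2 with h3 | h3
      · exact hq't h3.symm
      · exact htnot hRZ h3
  calc Z'.card.choose e = ((Z'.powersetCard e).image f).card := by
        rw [Finset.card_image_of_injOn hinj, Finset.card_powersetCard]
    _ < (insert (insert q' R) ((Z'.powersetCard e).image f)).card := by
        rw [Finset.card_insert_of_notMem hGim]; omega
    _ ≤ good.card := by
        refine Finset.card_le_card fun G hG => ?_
        rcases Finset.mem_insert.1 hG with rfl | hG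
        · exact hGgood
        · obtain ⟨Q, hQ, rfl⟩ := Finset.mem_image.1 hG
          exact hfgood Q hQ

end VectorConfiguration

/-! ### The abstract setting, and the change of variables e_k ↦ e_k - e_o. -/

section LinearIdeal

variable {K : Type*} [Field K] {n : ℕ} {L V : Type*} [Field L] [AddCommGroup V] [Module L V]

/-- The properties of an Orlik–Solomon ideal with a `d`-linear resolution that are used below. -/
structure LinearIdeal (K L : Type*) {V : Type*} [Field K] [Field L] [AddCommGroup V] [Module L V]
    {n : ℕ} (a : Fin n → V) (d : ℕ) (J : Ideal (ExtAlg K n)) : Prop where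
  two_le : 2 ≤ d
  girth : ∀ F, Dep L a F → d + 1 ≤ F.card
  boundary_mem : ∀ F, Dep L a F → boundaryMonomial K F ∈ J
  mem_span : ∀ x ∈ J, x ∈ extDeg K n d → x ∈ Submodule.span K
    {x | ∃ C, C.card = d + 1 ∧ Dep L a C ∧ x = boundaryMonomial K C}
  eq_zero_of_lt : ∀ k < d, ∀ x ∈ J, x ∈ extDeg K n k → x = 0
  homComp_mem : ∀ k, ∀ x ∈ J, homComp K n k x ∈ J
  exists_cartan : ∀ (b : Basis (Fin n) K (Fin n → K)) (i k : ℕ), d ≤ k →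
    ∀ ω : (Fin n →₀ ℕ) → ExtAlg K n,
      (∀ α, α.degree = i → ω α ∈ J ∧ ω α ∈ extDeg K n (k + 1)) →
      (∀ α, α.degree + 1 = i → cartan b ω α = 0) →
      ∃ η : (Fin n →₀ ℕ) → ExtAlg K n,
        (∀ α, α.degree = i + 1 → η α ∈ J ∧ η α ∈ extDeg K n k) ∧
        ∀ α, α.degree = i → cartan b η α = ω α

/-- Replacing `e_k` by `e_k - e_o` for `k ∈ Z`. -/
def shear (Z : Finset (Fin n)) (o : Fin n) (ho : o ∉ Z) : (Fin n → K) ≃ₗ[K] (Fin n → K) :=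
  LinearEquiv.transvection (f := -∑ k ∈ Z, LinearMap.proj k) (v := Pi.single o 1) (by
    simp only [LinearMap.neg_apply, LinearMap.sum_apply, LinearMap.proj_apply, neg_eq_zero]
    exact Finset.sum_eq_zero fun k hk => Pi.single_eq_of_ne (by rintro rfl; exact ho hk) _)

theorem shear_single_of_mem {Z : Finset (Fin n)} {o : Fin n} (ho : o ∉ Z) {k : Fin n}
    (hk : k ∈ Z) : shear (K := K) Z o ho (Pi.single k 1) = Pi.single k 1 - Pi.single o 1 := by
  simp [shear, LinearMap.transvection.apply, LinearMap.sum_apply, hk, sub_eq_add_neg]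

theorem shear_single_of_notMem {Z : Finset (Fin n)} {o : Fin n} (ho : o ∉ Z) {k : Fin n}
    (hk : k ∉ Z) : shear (K := K) Z o ho (Pi.single k 1) = Pi.single k 1 := by
  simp [shear, LinearMap.transvection.apply, LinearMap.sum_apply, hk]

/-- The automorphism of the exterior algebra replacing `e_k` by `e_k - e_o` for `k ∈ Z`. -/
def shearAlg (Z : Finset (Fin n)) (o : Fin n) (ho : o ∉ Z) : ExtAlg K n →ₐ[K] ExtAlg K n :=
  ExteriorAlgebra.map (shear Z o ho).toLinearMap

theorem shearAlg_extVar {Z : Finset (Fin n)} {o : Fin n} (ho : o ∉ Z) {k : Fin n}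
    (hk : k ∈ Z) : shearAlg Z o ho (extVar K k) = extVar K k - extVar K o := by
  rw [shearAlg, extVar, ExteriorAlgebra.map_apply_ι]
  simp only [LinearEquiv.coe_coe]
  rw [shear_single_of_mem ho hk, map_sub]
  rfl

theorem ctr_shearAlg_mon {Z : Finset (Fin n)} {o : Fin n} (ho : o ∉ Z) (G : Finset (Fin n))
    (hG : G ⊆ Z) : ctr (coordSum K n) (shearAlg Z o ho (mon K G)) = 0 := by
  refine mon_induction
    (C := fun G x => G ⊆ Z → ctr (coordSum K n) (shearAlg Z o ho x) = 0) ?_ ?_ ?_ G hG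
  · intro _; rw [map_one, ctr_one]
  · intro F x h hF; rw [map_neg, map_neg, h hF, neg_zero]
  · intro i F _ h hF
    rw [map_mul, shearAlg_extVar ho (hF (Finset.mem_insert_self i F)), extVar_eq, extVar_eq,
      ← map_sub, ctr_vec_mul, h fun j hj => hF (Finset.mem_insert_of_mem hj), map_sub,
      coordSum_single, coordSum_single, sub_self, zero_smul, mul_zero, sub_zero]

theorem extVar_mul_shearAlg_mon {Z : Finset (Fin n)} {o : Fin n} (ho : o ∉ Z)
    (G : Finset (Fin n)) (hG : G ⊆ Z) :
    extVar K o * shearAlg Z o ho (mon K G) = extVar K o * mon K G := by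
  refine mon_induction
    (C := fun G x => G ⊆ Z → extVar K o * shearAlg Z o ho x = extVar K o * x) ?_ ?_ ?_ G hG
  · intro _; rw [map_one]
  · intro F x h hF; rw [map_neg, mul_neg, h hF, mul_neg]
  · intro i F _ h hF
    have hc : extVar K o * extVar K i = -(extVar K i * extVar K o) := vec_mul_vec _ _
    rw [map_mul, shearAlg_extVar ho (hF (Finset.mem_insert_self i F)), ← mul_assoc, mul_sub,
      extVar_mul_self, sub_zero, hc, neg_mul, mul_assoc,
      h fun j hj => hF (Finset.mem_insert_of_mem hj), ← mul_assoc, ← neg_mul, ← hc, mul_assoc]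

/-- Both sides are the product of the e_k - e_o up to sign: this product is killed by ∂, so it
equals ∂ of its product with e_o, where the shear is invisible. -/
theorem shearAlg_mon {Z : Finset (Fin n)} {o : Fin n} (ho : o ∉ Z) (G : Finset (Fin n))
    (hG : G ⊆ Z) :
    shearAlg Z o ho (mon K G) = boundaryMonomial K (insert o G) ∨
      shearAlg Z o ho (mon K G) = -boundaryMonomial K (insert o G) := by
  have h1 := ctr_vec_mul (coordSum K n) (Pi.single o 1) (shearAlg Z o ho (mon K G))
  rw [ctr_shearAlg_mon ho G hG, mul_zero, sub_zero, coordSum_single, one_smul, ← extVar_eq,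
    extVar_mul_shearAlg_mon ho G hG] at h1
  rw [← h1, boundaryMonomial_eq]
  rcases extVar_mul_mon_of_notMem (K := K) (fun h => ho (hG h)) with h | h <;> rw [h]
  · exact Or.inl rfl
  · exact Or.inr (map_neg _ _)

open Classical in
/-- Setting the variables outside `Z` to zero. -/
def killAlg (K : Type*) [Field K] (Z : Finset (Fin n)) : ExtAlg K n →ₐ[K] ExtAlg K n :=
  ExteriorAlgebra.map (LinearMap.pi fun k => if k ∈ Z then LinearMap.proj k else 0)

theorem killAlg_extVar_of_mem {Z : Finset (Fin n)} {k : Fin n} (hk : k ∈ Z) :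
    killAlg K Z (extVar K k) = extVar K k := by
  rw [killAlg, extVar, ExteriorAlgebra.map_apply_ι]
  congr 1
  ext j
  by_cases hj : j = k
  · subst hj; simp [hk]
  · by_cases hjZ : j ∈ Z <;> simp [hjZ, Pi.single_eq_of_ne hj]

theorem killAlg_extVar_of_notMem {Z : Finset (Fin n)} {k : Fin n} (hk : k ∉ Z) :
    killAlg K Z (extVar K k) = 0 := by
  rw [killAlg, extVar, ExteriorAlgebra.map_apply_ι]
  rw [ExteriorAlgebra.ι_eq_zero_iff]
  ext j
  by_cases hj : j = k
  · subst hj; simp [hk]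
  · by_cases hjZ : j ∈ Z <;> simp [hjZ, Pi.single_eq_of_ne hj]

theorem killAlg_mon_eq_zero {Z : Finset (Fin n)} {G : Finset (Fin n)} {i : Fin n} (hi : i ∈ G)
    (hiZ : i ∉ Z) : killAlg K Z (mon K G) = 0 := by
  rw [← extVar_mul_boundaryMonomial hi, map_mul, killAlg_extVar_of_notMem hiZ, zero_mul]

theorem killAlg_shearAlg_extVar {Z : Finset (Fin n)} {o : Fin n} (ho : o ∉ Z) {k : Fin n}
    (hk : k ∈ Z) : killAlg K Z (shearAlg Z o ho (extVar K k)) = extVar K k := by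
  rw [shearAlg_extVar ho hk, map_sub, killAlg_extVar_of_mem hk, killAlg_extVar_of_notMem ho,
    sub_zero]

theorem killAlg_shearAlg_mon {Z : Finset (Fin n)} {o : Fin n} (ho : o ∉ Z) (G : Finset (Fin n))
    (hG : G ⊆ Z) : killAlg K Z (shearAlg Z o ho (mon K G)) = mon K G := by
  refine mon_induction (C := fun G x => G ⊆ Z → killAlg K Z (shearAlg Z o ho x) = x)
    ?_ ?_ ?_ G hG
  · intro _; rw [map_one, map_one]
  · intro F x h hF; rw [map_neg, map_neg, h hF]
  · intro i F _ h hF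
    rw [map_mul, map_mul, killAlg_shearAlg_extVar ho (hF (Finset.mem_insert_self i F)),
      h fun j hj => hF (Finset.mem_insert_of_mem hj)]

/-- Boundaries of monomials with at least two indices outside `Z`. -/
theorem killAlg_boundaryMonomial_eq_zero {Z F : Finset (Fin n)} {i j : Fin n} (hi : i ∈ F)
    (hj : j ∈ F) (hij : i ≠ j) (hiZ : i ∉ Z) (hjZ : j ∉ Z) :
    killAlg K Z (boundaryMonomial K F) = 0 := by
  refine Submodule.span_induction (p := fun x _ => killAlg K Z x = 0) ?_ ?_ ?_ ?_
    (boundaryMonomial_mem_monSpan F)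
  · rintro _ ⟨_, ⟨k, hk, rfl⟩, rfl⟩
    by_cases hki : k = i
    · exact killAlg_mon_eq_zero (Finset.mem_erase.2 ⟨by rw [hki]; exact hij.symm, hj⟩) hjZ
    · exact killAlg_mon_eq_zero (Finset.mem_erase.2 ⟨Ne.symm hki, hi⟩) hiZ
  · exact map_zero _
  · intro x y _ _ hx hy; rw [map_add, hx, hy, add_zero]
  · intro c x _ hx; rw [map_smul, hx, smul_zero]

/-- The coefficient of the monomial `e_I`. -/
def coef (K : Type*) [Field K] (I : Finset (Fin n)) : ExtAlg K n →ₗ[K] K :=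
  ((Pi.basisFun K (Fin n)).ExteriorAlgebra).coord I

theorem coef_mon (I G : Finset (Fin n)) : coef K I (mon K G) = if G = I then 1 else 0 := by
  classical
  rw [coef, mon_eq_basis, Basis.coord_apply, Basis.repr_self, Finsupp.single_apply]

/-- The ratio of consecutive counts is (|Z| + i)/(i + 1), which tends to 1. This removes the
exponent counts from the comparison of dimensions. -/
theorem card_finsuppAntidiag_succ_mul (Z : Finset (Fin n)) (hZ : 0 < Z.card) (i : ℕ) :
    (Z.finsuppAntidiag (i + 1)).card * (i + 1) = (Z.finsuppAntidiag i).card * (Z.card + i) := by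
  rw [Finset.card_finsuppAntidiag_nat_eq_multichoose, Finset.card_finsuppAntidiag_nat_eq_multichoose]
  obtain ⟨m, hm⟩ : ∃ m, Z.card = m + 1 := ⟨Z.card - 1, by omega⟩
  rw [hm, Nat.multichoose_eq, Nat.multichoose_eq, show m + 1 + (i + 1) - 1 = m + i + 1 by omega,
    show m + 1 + i - 1 = m + i by omega, ← Nat.add_one_mul_choose_eq]
  ring

/-- A matrix with a right inverse has at most as many rows as columns. -/
theorem card_le_of_mul_eq_one {R C : Type*} [Fintype R] [Fintype C] [DecidableEq R]
    (A : Matrix R C K) (B : Matrix C R K) (h : A * B = 1) : Fintype.card R ≤ Fintype.card C := by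
  calc Fintype.card R = (1 : Matrix R R K).rank := (Matrix.rank_one).symm
    _ ≤ A.rank := by rw [← h]; exact Matrix.rank_mul_le_left A B
    _ ≤ Fintype.card C := A.rank_le_card_width

end LinearIdeal

/-! ### Comparing dimensions in the Cartan complex inside a subspace of rank d + 1. -/

section Counting

variable {K : Type*} [Field K] {n : ℕ} {L V : Type*} [Field L] [AddCommGroup V] [Module L V]
  [FiniteDimensional L V] {a : Fin n → V} {d : ℕ} {J : Ideal (ExtAlg K n)}

open Classical in
/-- The sets `G` of `d` indices in `W` whose base point does not belong to `G`. -/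
def brokenSets (a : Fin n → V) (d : ℕ) (y : Submodule L V → Fin n) (Z : Finset (Fin n)) :
    Finset (Finset (Fin n)) :=
  (Z.powersetCard d).filter fun G => y (vspan L a G) ∉ G

/-- After setting the variables outside Z to zero, only circuits inside W matter, and each of their
boundaries can be rewritten through the base point of its span. Hence J_d is cut down to a space of
dimension at most the number of broken sets. -/
theorem LinearIdeal.killAlg_mem_span (h : LinearIdeal K L a d J) {W : Submodule L V} {o : Fin n}
    {y : Submodule L V → Fin n} (hy1 : ∀ Y, a o ∈ Y → y Y = o) {x : ExtAlg K n} (hx : x ∈ J)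
    (hxd : x ∈ extDeg K n d) :
    ∃ c : Finset (Fin n) → K, killAlg K ((pts a W).erase o) x =
      ∑ G ∈ brokenSets a d y ((pts a W).erase o), c G •
        killAlg K ((pts a W).erase o) (boundaryMonomial K (insert (y (vspan L a G)) G)) := by
  classical
  set Z := (pts a W).erase o with hZ
  set w : Finset (Fin n) → ExtAlg K n := fun G =>
    killAlg K Z (boundaryMonomial K (insert (y (vspan L a G)) G)) with hw
  suffices hmem : killAlg K Z x ∈ Submodule.span K (w '' (brokenSets a d y Z : Set _)) by
    obtain ⟨c, hc⟩ := (Submodule.mem_span_image_finset_iff_exists_fun' K).1 hmem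
    exact ⟨c, hc.symm⟩
  refine Submodule.span_induction (p := fun x _ => killAlg K Z x ∈
    Submodule.span K (w '' (brokenSets a d y Z : Set _))) ?_ ?_ ?_ ?_ (h.mem_span x hx hxd)
  · rintro _ ⟨C, hC, hdep, rfl⟩
    by_cases hCW : ∀ i ∈ C, a i ∈ W
    · refine Submodule.span_induction (p := fun x _ => killAlg K Z x ∈
        Submodule.span K (w '' (brokenSets a d y Z : Set _))) ?_ ?_ ?_ ?_
        (boundaryMonomial_mem_span_insert (y (vspan L a C)) C)
      · rintro _ ⟨i, hi, hyi, rfl⟩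
        have he := vspan_erase h.girth hC hdep hi
        refine Submodule.subset_span ⟨C.erase i, ?_, by rw [hw]; dsimp only; rw [he]⟩
        rw [Finset.mem_coe, brokenSets, Finset.mem_filter, Finset.mem_powersetCard, he]
        refine ⟨⟨fun j hj => ?_, by rw [Finset.card_erase_of_mem hi]; omega⟩, hyi⟩
        rw [hZ, Finset.mem_erase, mem_pts]
        refine ⟨?_, hCW j (Finset.mem_of_mem_erase hj)⟩
        -- A set containing o has base point o, so it is not broken; this keeps broken sets inside
        -- Z.
        rintro rfl
        rw [hy1 _ (mem_vspan (Finset.mem_of_mem_erase hj))] at hyi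
        exact hyi hj
      · rw [map_zero]; exact zero_mem _
      · intro x y _ _ hx hy; rw [map_add]; exact add_mem hx hy
      · intro c x _ hx; rw [map_smul]; exact Submodule.smul_mem _ _ hx
    · push Not at hCW
      obtain ⟨i, hi, hiW⟩ := hCW
      have hiZ : i ∉ Z := fun hi' => hiW (mem_pts.1 (Finset.mem_of_mem_erase hi'))
      by_cases hj : ∃ j ∈ C.erase i, a j ∉ W
      · obtain ⟨j, hj, hjW⟩ := hj
        obtain ⟨hji, hjC⟩ := Finset.mem_erase.1 hj
        rw [killAlg_boundaryMonomial_eq_zero hi hjC hji.symm hiZ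
          fun hj' => hjW (mem_pts.1 (Finset.mem_of_mem_erase hj'))]
        exact zero_mem _
      -- A circuit with exactly one point off W cannot occur, because its other points span that
      -- point.
      · push Not at hj
        refine absurd (vspan_le.2 hj ?_) hiW
        rw [vspan_erase h.girth hC hdep hi]
        exact mem_vspan hi
  · rw [map_zero]; exact zero_mem _
  · intro x y _ _ hx hy; rw [map_add]; exact add_mem hx hy
  · intro c x _ hx; rw [map_smul]; exact Submodule.smul_mem _ _ hx

/-- Any d + 2 forms in W are dependent for rank reasons, so J contains all boundaries of such sets:
in degree d + 1 it contains every product of differences e_k - e_o over Z. -/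
theorem LinearIdeal.shearAlg_mem (h : LinearIdeal K L a d J) {W : Submodule L V}
    (hW : finrank L W = d + 1) {o : Fin n} (ho : a o ∈ W)
    (ho' : o ∉ (pts a W).erase o) {I : Finset (Fin n)} (hI : I ⊆ (pts a W).erase o)
    (hIc : I.card = d) {k : Fin n} (hk : k ∈ (pts a W).erase o) :
    shearAlg _ o ho' (extVar K k * mon K I) ∈ J ∧
      shearAlg _ o ho' (extVar K k * mon K I) ∈ extDeg K n (d + 1) := by
  by_cases hkI : k ∈ I
  · rw [extVar_mul_mon_of_mem hkI, map_zero]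
    exact ⟨zero_mem _, zero_mem _⟩
  · have hsub : insert k I ⊆ (pts a W).erase o := Finset.insert_subset hk hI
    have hoI : o ∉ insert k I := fun hh => ho' (hsub hh)
    have hc : (insert o (insert k I)).card = d + 1 + 1 := by
      rw [Finset.card_insert_of_notMem hoI, Finset.card_insert_of_notMem hkI, hIc]
    have h1 : boundaryMonomial K (insert o (insert k I)) ∈ J :=
      h.boundary_mem _ (dep_of_le (Y := W) (fun i hi => by
        rcases Finset.mem_insert.1 hi with rfl | hi
        · exact ho
        · exact mem_pts.1 (Finset.mem_of_mem_erase (hsub hi))) (by omega))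
    have h2 : boundaryMonomial K (insert o (insert k I)) ∈ extDeg K n (d + 1) :=
      boundaryMonomial_mem hc
    rcases extVar_mul_mon_of_notMem (K := K) hkI with h3 | h3 <;>
      rcases shearAlg_mon (K := K) ho' _ hsub with h4 | h4 <;>
      simp only [h3, h4, map_neg, neg_neg]
    · exact ⟨h1, h2⟩
    · exact ⟨neg_mem h1, neg_mem h2⟩
    · exact ⟨neg_mem h1, neg_mem h2⟩
    · exact ⟨h1, h2⟩

/-- A coordinate of the contraction with `e_t`. -/
def ctrCoef (K : Type*) [Field K] (t : Fin n) (I : Finset (Fin n)) : ExtAlg K n →ₗ[K] K :=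
  coef K I ∘ₗ ctr (LinearMap.proj t)

theorem ctrCoef_extVar_mul_mon {t : Fin n} {I G : Finset (Fin n)} (htG : t ∉ G) (k : Fin n) :
    ctrCoef K t I (extVar K k * mon K G) = if k = t ∧ G = I then 1 else 0 := by
  classical
  rw [ctrCoef, LinearMap.comp_apply, extVar_eq, ctr_vec_mul, ctr_mon (LinearMap.proj t) 0 G,
    zero_smul, mul_zero, sub_zero, map_smul, coef_mon, LinearMap.proj_apply, Pi.single_apply]
  · by_cases hk : k = t
    · by_cases hG : G = I <;> simp [hk, hG]
    · simp [hk, Ne.symm hk]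
  · intro i hi
    rw [LinearMap.proj_apply, Pi.single_eq_of_ne]
    rintro rfl
    exact htG hi

/-- In internal degree d + 1 the Cartan boundaries of the sheared exterior algebra on Z take values
in J, so by exactness they bound chains with values in J_d. The left side counts boundaries
independent by their coefficient at e_t e_I; the right side bounds the available chains after
killing the variables outside Z. -/
theorem LinearIdeal.card_mul_le [CharZero K] (h : LinearIdeal K L a d J) {W : Submodule L V}
    (hW : finrank L W = d + 1) {o t : Fin n} (hot : o ≠ t) (ho : a o ∈ W) (ht : a t ∈ W)
    {y : Submodule L V → Fin n} (hy1 : ∀ Y, a o ∈ Y → y Y = o) (i : ℕ) :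
    (((pts a W).erase o).finsuppAntidiag i).card *
        (((pts a W).erase o).erase t).card.choose d ≤
      (((pts a W).erase o).finsuppAntidiag (i + 1)).card *
        (brokenSets a d y ((pts a W).erase o)).card := by
  classical
  set Z := (pts a W).erase o with hZ
  set Z' := Z.erase t with hZ'
  have ho' : o ∉ Z := Finset.notMem_erase o _
  have htZ : t ∈ Z := Finset.mem_erase.2 ⟨hot.symm, mem_pts.2 ht⟩
  set T := brokenSets a d y Z with hT
  set w : Finset (Fin n) → ExtAlg K n := fun G =>
    killAlg K Z (boundaryMonomial K (insert (y (vspan L a G)) G)) with hw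
  set b : Basis (Fin n) K (Fin n → K) := (Pi.basisFun K (Fin n)).map (shear Z o ho') with hb
  have hbvec : ∀ k, vec (b k) = shearAlg Z o ho' (extVar K k) := by
    intro k
    rw [hb, shearAlg, extVar, ExteriorAlgebra.map_apply_ι]
    simp
  have hkill : ∀ (f : (Fin n →₀ ℕ) → ExtAlg K n) α, killAlg K Z (cartan b f α) =
      ∑ k ∈ Z, extVar K k * killAlg K Z (f (α + Finsupp.single k 1)) := by
    intro f α
    rw [cartan, map_sum, ← Finset.sum_subset (Finset.subset_univ Z)]
    · refine Finset.sum_congr rfl fun k hk => ?_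
      rw [smul_eq_mul, map_mul, hbvec, killAlg_shearAlg_extVar ho' hk]
    · intro k _ hk
      have : vec (b k) = extVar K k := by
        rw [extVar_eq, hb, Basis.map_apply, Pi.basisFun_apply, shear_single_of_notMem ho' hk]
      rw [smul_eq_mul, map_mul, this, killAlg_extVar_of_notMem hk, zero_mul]
  have hsupp : ∀ {α₀ α : Fin n →₀ ℕ} {k : Fin n}, α₀ ∈ Z.finsuppAntidiag i →
      α + Finsupp.single k 1 = α₀ + Finsupp.single t 1 → k ∈ Z := by
    intro α₀ α k hα₀ he
    by_contra hk
    have h1 := DFunLike.congr_fun he k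
    have h2 : α₀ k = 0 := by
      by_contra h3
      exact hk ((Finset.mem_finsuppAntidiag.1 hα₀).2 (Finsupp.mem_support_iff.2 h3))
    have h3 : t ≠ k := by rintro rfl; exact hk htZ
    simp [h2, Finsupp.single_eq_of_ne h3.symm] at h1
  have hdeg : ∀ {m} {α : Fin n →₀ ℕ}, α ∈ Z.finsuppAntidiag m → α.degree = m := by
    intro m α hα
    obtain ⟨h1, h2⟩ := Finset.mem_finsuppAntidiag.1 hα
    rw [← h1, Finsupp.degree_apply]
    exact Finset.sum_subset h2 fun x _ hx => Finsupp.notMem_support_iff.1 hx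
  have key : ∀ α₀ ∈ Z.finsuppAntidiag i, ∀ I₀ ∈ Z'.powersetCard d,
      ∃ N : (Fin n →₀ ℕ) → Finset (Fin n) → K,
        ∀ α ∈ Z.finsuppAntidiag i, ∀ I,
          ∑ k ∈ Z, ∑ G ∈ T, ctrCoef K t I (extVar K k * w G) * N (α + Finsupp.single k 1) G =
          if α = α₀ ∧ I = I₀ then 1 else 0 := by
    intro α₀ hα₀ I₀ hI₀
    obtain ⟨hI₀Z', hI₀c⟩ := Finset.mem_powersetCard.1 hI₀
    have hI₀Z : I₀ ⊆ Z := hI₀Z'.trans (Finset.erase_subset _ _)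
    have htI₀ : t ∉ I₀ := fun hh => Finset.notMem_erase t Z (hI₀Z' hh)
    -- A chain concentrated at one exponent. As t ∉ I₀, the monomial e_t e_{I₀} in its differential
    -- can only arise from k = t, which pins down α₀ and I₀.
    set f : (Fin n →₀ ℕ) → ExtAlg K n := fun β =>
      if β = α₀ + Finsupp.single t 1 then shearAlg Z o ho' (mon K I₀) else 0 with hf
    obtain ⟨η, hη, hηω⟩ := h.exists_cartan b i d le_rfl (cartan b f) (fun α _ => by
      have hterm : ∀ k, vec (b k) • f (α + Finsupp.single k 1) ∈ J ∧
          vec (b k) • f (α + Finsupp.single k 1) ∈ extDeg K n (d + 1) := by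
        intro k
        simp only [hf, smul_eq_mul]
        split_ifs with he
        · rw [hbvec, ← map_mul]
          exact h.shearAlg_mem hW ho ho' hI₀Z hI₀c (hsupp hα₀ he)
        · rw [mul_zero]; exact ⟨zero_mem _, zero_mem _⟩
      exact ⟨sum_mem fun k _ => (hterm k).1, sum_mem fun k _ => (hterm k).2⟩)
      (fun α _ => cartan_cartan b f α)
    have hN : ∀ β : Fin n →₀ ℕ, ∃ c : Finset (Fin n) → K, β.degree = i + 1 →
        killAlg K Z (η β) = ∑ G ∈ T, c G • w G := by
      intro β
      by_cases hβ : β.degree = i + 1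
      · obtain ⟨c, hc⟩ := h.killAlg_mem_span (W := W) hy1 (hη β hβ).1 (hη β hβ).2
        exact ⟨c, fun _ => hc⟩
      · exact ⟨0, fun hh => absurd hh hβ⟩
    choose N hN using hN
    refine ⟨N, fun α hα I => ?_⟩
    have h1 : ctrCoef K t I (killAlg K Z (cartan b η α)) =
        ∑ k ∈ Z, ∑ G ∈ T, ctrCoef K t I (extVar K k * w G) * N (α + Finsupp.single k 1) G := by
      rw [hkill, map_sum]
      refine Finset.sum_congr rfl fun k _ => ?_
      rw [hN _ (by simp [hdeg hα]), Finset.mul_sum, map_sum]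
      refine Finset.sum_congr rfl fun G _ => ?_
      rw [mul_smul_comm, map_smul, smul_eq_mul, mul_comm]
    rw [← h1, hηω α (hdeg hα), hkill, map_sum]
    have h2 : ∀ k ∈ Z, ctrCoef K t I (extVar K k * killAlg K Z (f (α + Finsupp.single k 1))) =
        if k = t then (if α = α₀ ∧ I = I₀ then 1 else 0) else 0 := by
      intro k _
      by_cases he : α + Finsupp.single k 1 = α₀ + Finsupp.single t 1
      · simp only [hf]
        rw [if_pos he, killAlg_shearAlg_mon ho' _ hI₀Z, ctrCoef_extVar_mul_mon htI₀]
        by_cases hk : k = t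
        · subst hk
          have hα' : α = α₀ := add_right_cancel he
          simp [hα', eq_comm]
        · rw [if_neg hk, if_neg fun hh => hk hh.1]
      · simp only [hf]
        rw [if_neg he, map_zero, mul_zero, map_zero]
        split_ifs with hk hh
        · exact absurd (by rw [hk, hh.1]) he
        · rfl
        · rfl
    rw [Finset.sum_congr rfl h2, Finset.sum_ite_eq', if_pos htZ]
  -- Coefficients of the bounding chains give a right inverse of the matrix of the differential, so
  -- its rows do not outnumber its columns.
  choose! N hN using key
  have hcard := card_le_of_mul_eq_one
    (R := {α // α ∈ Z.finsuppAntidiag i} × {I // I ∈ Z'.powersetCard d})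
    (C := {β // β ∈ Z.finsuppAntidiag (i + 1)} × {G // G ∈ T})
    (Matrix.of fun r c => ∑ k ∈ Z, if c.1.1 = r.1.1 + Finsupp.single k 1 then
      ctrCoef K t r.2.1 (extVar K k * w c.2.1) else 0)
    (Matrix.of fun c r => N r.1.1 r.2.1 c.1.1 c.2.1) (by
      ext ⟨⟨α, hα⟩, ⟨I, hI⟩⟩ ⟨⟨α₀, hα₀⟩, ⟨I₀, hI₀⟩⟩
      rw [Matrix.mul_apply, Fintype.sum_prod_type]
      simp only [Matrix.of_apply, Matrix.one_apply, Prod.mk.injEq, Subtype.mk.injEq]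
      rw [← hN α₀ hα₀ I₀ hI₀ α hα I]
      simp_rw [Finset.sum_mul]
      rw [Finset.sum_coe_sort (Z.finsuppAntidiag (i + 1)) (fun β => ∑ G : {G // G ∈ T},
        ∑ k ∈ Z, (if β = α + Finsupp.single k 1 then
          ctrCoef K t I (extVar K k * w G.1) else 0) * N α₀ I₀ β G.1)]
      have h1 : ∀ β, (∑ G : {G // G ∈ T},
          ∑ k ∈ Z, (if β = α + Finsupp.single k 1 then
            ctrCoef K t I (extVar K k * w G.1) else 0) * N α₀ I₀ β G.1) =
          ∑ k ∈ Z, if β = α + Finsupp.single k 1 then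
            ∑ G ∈ T, ctrCoef K t I (extVar K k * w G) * N α₀ I₀ (α + Finsupp.single k 1) G
            else 0 := by
        intro β
        rw [Finset.sum_coe_sort T (fun G => ∑ k ∈ Z, (if β = α + Finsupp.single k 1 then
            ctrCoef K t I (extVar K k * w G) else 0) * N α₀ I₀ β G), Finset.sum_comm]
        refine Finset.sum_congr rfl fun k _ => ?_
        by_cases hβ : β = α + Finsupp.single k 1
        · rw [if_pos hβ]
          refine Finset.sum_congr rfl fun G _ => ?_
          rw [if_pos hβ, hβ]
        · rw [if_neg hβ]
          refine Finset.sum_eq_zero fun G _ => ?_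
          rw [if_neg hβ, zero_mul]
      rw [Finset.sum_congr rfl fun β _ => h1 β, Finset.sum_comm]
      refine Finset.sum_congr rfl fun k hk => ?_
      rw [Finset.sum_ite_eq', if_pos]
      rw [Finset.mem_finsuppAntidiag]
      obtain ⟨h2, h3⟩ := Finset.mem_finsuppAntidiag.1 hα
      constructor
      · rw [Finsupp.coe_add]
        refine (Finset.sum_add_distrib (f := α) (g := Finsupp.single k 1)).trans ?_
        rw [h2]
        congr 1
        simp [Finsupp.single_apply, hk]
      · intro j hj
        by_contra hjZ
        have h4 : α j = 0 := by
          by_contra h5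
          exact hjZ (h3 (Finsupp.mem_support_iff.2 h5))
        have h5 : j ≠ k := by rintro rfl; exact hjZ hk
        simp [h4, Finsupp.single_eq_of_ne h5] at hj)
  rw [Fintype.card_prod, Fintype.card_prod, Fintype.card_coe, Fintype.card_coe, Fintype.card_coe,
    Fintype.card_coe, Finset.card_powersetCard] at hcard
  exact hcard

/-- A dependent subspace of rank `d` has at most one point more in any subspace of rank `d + 1`. -/
theorem LinearIdeal.eq_of_notMem [CharZero K] (h : LinearIdeal K L a d J) {U W : Submodule L V}
    (hU : finrank L U = d) (hX : d + 1 ≤ (pts a U).card) (hUW : U ≤ W)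
    (hW : finrank L W = d + 1) {q q' : Fin n}
    (hqW : a q ∈ W) (hqW' : a q' ∈ W) (hqU : a q ∉ U) (hqU' : a q' ∉ U) : q = q' := by
  classical
  by_contra hqq
  have hd := h.two_le
  obtain ⟨o, ho, t, ht, hot⟩ := Finset.one_lt_card.1 (show 1 < (pts a U).card by omega)
  rw [mem_pts] at ho ht
  obtain ⟨y, hy1, hlt⟩ := exists_card_filter_lt h.girth hd hU hUW hX hqq hqW hqW' hqU hqU'
    hot ho ht
  change (brokenSets a d y ((pts a W).erase o)).card < _ at hlt
  set Z := (pts a W).erase o with hZ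
  set T := (brokenSets a d y Z).card with hT
  have htZ : t ∈ Z := Finset.mem_erase.2 ⟨hot.symm, mem_pts.2 (hUW ht)⟩
  have hZpos : 0 < Z.card := Finset.card_pos.2 ⟨t, htZ⟩
  -- Large enough for a contradiction: (T + 1)(i + 1) ≤ T(|Z| + i) would force T + i + 1 ≤ T|Z|.
  set i := T * Z.card with hi
  have h1 := h.card_mul_le hW hot (hUW ho) (hUW ht) hy1 i
  rw [← hZ, ← hT] at h1
  have h2 := card_finsuppAntidiag_succ_mul Z hZpos i
  have h3 : 0 < (Z.finsuppAntidiag i).card := Finset.card_pos.2 ⟨Finsupp.single t i, by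
    rw [Finset.mem_finsuppAntidiag]
    refine ⟨by simp [Finsupp.single_apply, htZ], fun j hj => ?_⟩
    have := Finsupp.support_single_subset hj
    rw [Finset.mem_singleton] at this
    rwa [this]⟩
  set s := (Z.finsuppAntidiag i).card
  set s' := (Z.finsuppAntidiag (i + 1)).card
  have h4 : s * (T + 1) ≤ s' * T := le_trans (Nat.mul_le_mul_left _ hlt) h1
  have h5 : s * ((T + 1) * (i + 1)) ≤ s * (T * (Z.card + i)) := by
    calc s * ((T + 1) * (i + 1)) = s * (T + 1) * (i + 1) := by ring
      _ ≤ s' * T * (i + 1) := Nat.mul_le_mul_right _ h4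
      _ = s' * (i + 1) * T := by ring
      _ = s * (T * (Z.card + i)) := by rw [h2]; ring
  have h6 := Nat.le_of_mul_le_mul_left h5 h3
  rw [hi] at h6
  nlinarith

end Counting

/-! ### All circuits of size d + 1 span the same subspace. -/

section Uniqueness

variable {K : Type*} [Field K] {n : ℕ}

theorem extDeg_zero_mul (P : Submodule K (ExtAlg K n)) : extDeg K n 0 * P = P := by
  rw [extDeg_zero, one_mul]

theorem extDeg_succ_mul (m : ℕ) (P : Submodule K (ExtAlg K n)) :
    extDeg K n (m + 1) * P = extDeg K n 1 * (extDeg K n m * P) := by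
  rw [← mul_assoc]
  congr 1
  simp only [extDeg, ExteriorAlgebra.exteriorPower]
  rw [pow_one, pow_succ']

theorem vec_mul_mem_extDeg_succ_mul {m : ℕ} {P : Submodule K (ExtAlg K n)} (v : Fin n → K)
    {x : ExtAlg K n} (hx : x ∈ extDeg K n m * P) : vec v * x ∈ extDeg K n (m + 1) * P := by
  rw [extDeg_succ_mul]
  exact Submodule.mul_mem_mul (vec_mem v) hx

theorem exists_eq_sum_vec_mul (b : Basis (Fin n) K (Fin n → K)) {m : ℕ}
    {P : Submodule K (ExtAlg K n)} {x : ExtAlg K n} (hx : x ∈ extDeg K n (m + 1) * P) :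
    ∃ p : Fin n → ExtAlg K n, (∀ k, p k ∈ extDeg K n m * P) ∧ x = ∑ k, vec (b k) * p k := by
  rw [extDeg_succ_mul] at hx
  refine Submodule.mul_induction_on hx ?_ ?_
  · intro u hu y hy
    simp only [extDeg, ExteriorAlgebra.exteriorPower, pow_one] at hu
    obtain ⟨v, rfl⟩ := hu
    refine ⟨fun k => b.repr v k • y, fun k => Submodule.smul_mem _ _ hy, ?_⟩
    conv_lhs => rw [← b.sum_repr v, map_sum, Finset.sum_mul]
    refine Finset.sum_congr rfl fun k _ => ?_
    rw [map_smul, smul_mul_assoc, mul_smul_comm]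
  · rintro _ _ ⟨p, hp, rfl⟩ ⟨q, hq, rfl⟩
    refine ⟨fun k => p k + q k, fun k => add_mem (hp k) (hq k), ?_⟩
    simp only [mul_add, Finset.sum_add_distrib]

theorem extDeg_mul_le_extDeg {P : Submodule K (ExtAlg K n)} {d : ℕ} (hP : P ≤ extDeg K n d)
    (m : ℕ) : extDeg K n m * P ≤ extDeg K n (d + m) := by
  rw [add_comm]
  exact Submodule.mul_le.2 fun x hx y hy => mul_mem_extDeg hx (hP hy)

theorem extDeg_mul_mem_ideal {P : Submodule K (ExtAlg K n)} {J : Ideal (ExtAlg K n)}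
    (hP : ∀ x ∈ P, x ∈ J) {m : ℕ} {x : ExtAlg K n} (hx : x ∈ extDeg K n m * P) : x ∈ J :=
  Submodule.mul_induction_on hx (fun y _ z hz => J.mul_mem_left y (hP z hz))
    fun _ _ => add_mem

theorem exists_ne_zero_extDeg_mul [CharZero K] {P : Submodule K (ExtAlg K n)} {d : ℕ}
    (hP : P ≤ extDeg K n d) {x : ExtAlg K n} (hx : x ∈ P) (h0 : x ≠ 0) (m : ℕ) (hm : d + m ≤ n) :
    ∃ y ∈ extDeg K n m * P, y ≠ 0 := by
  induction m with
  | zero => exact ⟨x, by rwa [extDeg_zero_mul], h0⟩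
  | succ m ih =>
    obtain ⟨y, hy, hy0⟩ := ih (by omega)
    obtain ⟨k, hk⟩ := exists_vec_mul_ne_zero (Pi.basisFun K (Fin n))
      (extDeg_mul_le_extDeg hP m hy) hy0 (by omega)
    exact ⟨_, vec_mul_mem_extDeg_succ_mul _ hy, hk⟩

theorem exists_smul_eq_of_mem_extDeg_top {x y : ExtAlg K n} (hx : x ∈ extDeg K n n)
    (hx0 : x ≠ 0) (hy : y ∈ extDeg K n n) : ∃ c : K, y = c • x := by
  have key : ∀ z ∈ extDeg K n n, ∃ c : K, c • mon K Finset.univ = z := by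
    intro z hz
    have h1 := extDeg_le_monSpan n hz
    have h2 : {F : Finset (Fin n) | F.card = n} = {Finset.univ} := by
      ext F
      rw [Set.mem_ofPred_eq, Set.mem_singleton_iff, ← Finset.card_eq_iff_eq_univ, Fintype.card_fin]
    rw [h2, monSpan, Set.image_singleton] at h1
    exact Submodule.mem_span_singleton.1 h1
  obtain ⟨c, rfl⟩ := key x hx
  obtain ⟨e, rfl⟩ := key y hy
  have hc : c ≠ 0 := by rintro rfl; exact hx0 (zero_smul _ _)
  exact ⟨e * c⁻¹, by rw [smul_smul, inv_mul_cancel_right₀ hc]⟩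

variable {L V : Type*} [Field L] [AddCommGroup V] [Module L V]
  {a : Fin n → V} {d : ℕ} {J : Ideal (ExtAlg K n)}

/-- Exactness in homological degree 0: J has no generators in degrees above d. -/
theorem LinearIdeal.exists_eq_sum_vec_mul (h : LinearIdeal K L a d J)
    (b : Basis (Fin n) K (Fin n → K)) {k : ℕ} (hk : d ≤ k) {x : ExtAlg K n} (hx : x ∈ J)
    (hxk : x ∈ extDeg K n (k + 1)) :
    ∃ p : Fin n → ExtAlg K n, (∀ l, p l ∈ J ∧ p l ∈ extDeg K n k) ∧
      x = ∑ l, vec (b l) * p l := by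
  obtain ⟨η, hη, hηx⟩ := h.exists_cartan b 0 k hk (fun _ => x) (fun _ _ => ⟨hx, hxk⟩)
    (fun α hα => by omega)
  refine ⟨fun l => η (Finsupp.single l 1), fun l => hη _ (by simp), ?_⟩
  rw [← hηx 0 (by simp)]
  simp [cartan]

theorem LinearIdeal.mem_extDeg_mul (h : LinearIdeal K L a d J) {S : Submodule K (ExtAlg K n)}
    (hS : ∀ x ∈ J, x ∈ extDeg K n d → x ∈ S) (m : ℕ) {x : ExtAlg K n} (hx : x ∈ J)
    (hxm : x ∈ extDeg K n (d + m)) : x ∈ extDeg K n m * S := by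
  induction m generalizing x with
  | zero => rw [extDeg_zero_mul]; exact hS x hx hxm
  | succ m ih =>
    obtain ⟨p, hp, rfl⟩ := h.exists_eq_sum_vec_mul (Pi.basisFun K (Fin n)) (by omega) hx
      (k := d + m) hxm
    exact sum_mem fun l _ => vec_mul_mem_extDeg_succ_mul _ (ih (hp l).1 (hp l).2)

/-- The disjointness of two parts of `J` propagates from degree `d + 1` upwards. -/
theorem LinearIdeal.disjoint_extDeg_mul [CharZero K] (h : LinearIdeal K L a d J)
    {P Q : Submodule K (ExtAlg K n)} (hP : P ≤ extDeg K n d) (hQ : Q ≤ extDeg K n d)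
    (hPJ : ∀ x ∈ P, x ∈ J) (hQJ : ∀ x ∈ Q, x ∈ J)
    (hPQ : ∀ x ∈ J, x ∈ extDeg K n d → x ∈ P ⊔ Q)
    (h1 : Disjoint (extDeg K n 1 * P) (extDeg K n 1 * Q)) (m : ℕ) :
    Disjoint (extDeg K n (m + 1) * P) (extDeg K n (m + 1) * Q) := by
  induction m with
  | zero => exact h1
  | succ m ih =>
    rw [Submodule.disjoint_def] at ih ⊢
    intro x hxP hxQ
    set b := Pi.basisFun K (Fin n)
    obtain ⟨p, hp, hxp⟩ := _root_.exists_eq_sum_vec_mul b hxP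
    obtain ⟨q, hq, hxq⟩ := _root_.exists_eq_sum_vec_mul b hxQ
    classical
    -- The two expressions of x as Σ e_k p_k and Σ e_k q_k differ by a 1-cycle with values in J,
    -- which bounds by linearity of the first syzygies.
    set β : (Fin n →₀ ℕ) → ExtAlg K n := fun α =>
      ∑ k, if α = Finsupp.single k 1 then p k - q k else 0 with hβ
    have hβk : ∀ k, β (Finsupp.single k 1) = p k - q k := by
      intro k
      simp [hβ, Finsupp.single_left_inj]
    obtain ⟨η, hη, hηβ⟩ := h.exists_cartan b 1 (d + m) (by omega) β (fun α _ => by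
      have hk : ∀ k, (if α = Finsupp.single k 1 then p k - q k else 0) ∈ J ∧
          (if α = Finsupp.single k 1 then p k - q k else 0) ∈ extDeg K n (d + m + 1) := by
        intro k
        split_ifs
        · exact ⟨sub_mem (extDeg_mul_mem_ideal hPJ (hp k)) (extDeg_mul_mem_ideal hQJ (hq k)),
            sub_mem (extDeg_mul_le_extDeg hP (m + 1) (hp k))
              (extDeg_mul_le_extDeg hQ (m + 1) (hq k))⟩
        · exact ⟨zero_mem _, zero_mem _⟩
      exact ⟨sum_mem fun k _ => (hk k).1, sum_mem fun k _ => (hk k).2⟩) (fun α hα => by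
        obtain rfl : α = 0 := (Finsupp.degree_eq_zero_iff α).1 (by omega)
        simp only [cartan, zero_add, hβk, smul_sub, Finset.sum_sub_distrib]
        simp only [smul_eq_mul]
        rw [← hxp, ← hxq, sub_self])
    have hsplit : ∀ α : Fin n →₀ ℕ, ∃ y z : ExtAlg K n, α.degree = 2 →
        y ∈ extDeg K n m * P ∧ z ∈ extDeg K n m * Q ∧ y + z = η α := by
      intro α
      by_cases hα : α.degree = 2
      · have := h.mem_extDeg_mul hPQ m (hη α hα).1 (hη α hα).2
        rw [Submodule.mul_sup] at this
        obtain ⟨y, hy, z, hz, hyz⟩ := Submodule.mem_sup.1 this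
        exact ⟨y, z, fun _ => ⟨hy, hz, hyz⟩⟩
      · exact ⟨0, 0, fun h => absurd h hα⟩
    choose y z hyz using hsplit
    have hdeg : ∀ k l : Fin n, (Finsupp.single k 1 + Finsupp.single l 1 : Fin n →₀ ℕ).degree = 2 :=
      fun k l => by simp
    -- Splitting the bounding chain as y + z along P and Q, the difference p_k - Σ e_l y_{kl} = q_k
    -- + Σ e_l z_{kl} lies in both parts one degree lower, so it vanishes by induction.
    have hpk : ∀ k, p k = ∑ l, vec (b l) * y (Finsupp.single k 1 + Finsupp.single l 1) := by
      intro k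
      have h2 := hηβ (Finsupp.single k 1) (by simp)
      rw [hβk] at h2
      have h3 : cartan b η (Finsupp.single k 1) =
          ∑ l, vec (b l) * y (Finsupp.single k 1 + Finsupp.single l 1) +
          ∑ l, vec (b l) * z (Finsupp.single k 1 + Finsupp.single l 1) := by
        rw [cartan, ← Finset.sum_add_distrib]
        refine Finset.sum_congr rfl fun l _ => ?_
        rw [← (hyz _ (hdeg k l)).2.2, smul_eq_mul, mul_add]
      rw [h3] at h2
      refine sub_eq_zero.1 (ih _ (sub_mem (hp k) (sum_mem fun l _ =>
        vec_mul_mem_extDeg_succ_mul _ (hyz _ (hdeg k l)).1)) ?_)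
      have h4 : p k - ∑ l, vec (b l) * y (Finsupp.single k 1 + Finsupp.single l 1) =
          q k + ∑ l, vec (b l) * z (Finsupp.single k 1 + Finsupp.single l 1) := by
        rw [sub_eq_iff_eq_add, add_assoc, add_comm (∑ l, vec (b l) * z _), h2]
        abel
      rw [h4]
      exact add_mem (hq k) (sum_mem fun l _ =>
        vec_mul_mem_extDeg_succ_mul _ (hyz _ (hdeg k l)).2.1)
    -- The family y depends only on the exponent ε_k + ε_l, so it is symmetric and x = Σ e_k e_l
    -- y_{kl} cancels.
    rw [hxp, ← sum_sum_vec_smul_eq_zero b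
      (fun k l => y (Finsupp.single k 1 + Finsupp.single l 1)) fun k l => by rw [add_comm]]
    refine Finset.sum_congr rfl fun k _ => ?_
    rw [hpk k, Finset.mul_sum]
    rfl

/-- Products of variables with elements spanned by monomials. -/
theorem extDeg_one_mul_le_monSpan {S T : Set (Finset (Fin n))} {P : Submodule K (ExtAlg K n)}
    (hP : P ≤ monSpan K S) (h : ∀ F ∈ S, ∀ i ∉ F, insert i F ∈ T) :
    extDeg K n 1 * P ≤ monSpan K T := by
  intro x hx
  obtain ⟨p, hp, rfl⟩ := _root_.exists_eq_sum_vec_mul (Pi.basisFun K (Fin n)) (m := 0) hx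
  refine sum_mem fun k _ => ?_
  rw [Pi.basisFun_apply]
  refine extVar_mul_mem_monSpan (fun F hF => h F hF k) (hP ?_)
  have := hp k
  rwa [extDeg_zero_mul] at this

/-- All dependent sets of `d + 1` vectors span the same subspace. -/
theorem LinearIdeal.vspan_eq [CharZero K] [FiniteDimensional L V] (h : LinearIdeal K L a d J)
    {C C' : Finset (Fin n)} (hC : C.card = d + 1) (hCd : Dep L a C) (hC' : C'.card = d + 1)
    (hCd' : Dep L a C') : vspan L a C' = vspan L a C := by
  by_contra hne
  set U := vspan L a C with hU
  have hUr : finrank L U = d := finrank_vspan_circuit h.girth hC hCd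
  have hX : d + 1 ≤ (pts a U).card := by
    rw [← hC]; exact Finset.card_le_card fun i hi => mem_pts.2 (mem_vspan hi)
  set P : Submodule K (ExtAlg K n) := Submodule.span K {x | ∃ B, B.card = d + 1 ∧ Dep L a B ∧
    vspan L a B = U ∧ x = boundaryMonomial K B} with hP
  set Q : Submodule K (ExtAlg K n) := Submodule.span K {x | ∃ B, B.card = d + 1 ∧ Dep L a B ∧
    vspan L a B ≠ U ∧ x = boundaryMonomial K B} with hQ
  have hPd : P ≤ extDeg K n d :=
    Submodule.span_le.2 (by rintro _ ⟨B, hB, -, -, rfl⟩; exact boundaryMonomial_mem hB)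
  have hQd : Q ≤ extDeg K n d :=
    Submodule.span_le.2 (by rintro _ ⟨B, hB, -, -, rfl⟩; exact boundaryMonomial_mem hB)
  have hPJ : P ≤ J.restrictScalars K :=
    Submodule.span_le.2 (by rintro _ ⟨B, -, hB, -, rfl⟩; exact h.boundary_mem B hB)
  have hQJ : Q ≤ J.restrictScalars K :=
    Submodule.span_le.2 (by rintro _ ⟨B, -, hB, -, rfl⟩; exact h.boundary_mem B hB)
  have hPQ : ∀ x ∈ J, x ∈ extDeg K n d → x ∈ P ⊔ Q := by
    intro x hx hxd
    refine Submodule.span_le.2 ?_ (h.mem_span x hx hxd)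
    rintro _ ⟨B, hB, hBd, rfl⟩
    by_cases hBU : vspan L a B = U
    · exact Submodule.mem_sup_left (Submodule.subset_span ⟨B, hB, hBd, hBU, rfl⟩)
    · exact Submodule.mem_sup_right (Submodule.subset_span ⟨B, hB, hBd, hBU, rfl⟩)
  have hP1 : extDeg K n 1 * P ≤ monSpan K {F | U ≤ vspan L a F} := by
    refine extDeg_one_mul_le_monSpan (S := {F | U ≤ vspan L a F})
      (Submodule.span_le.2 ?_) fun F hF i _ =>
        (show U ≤ vspan L a F from hF).trans (vspan_mono (Finset.subset_insert i F))
    rintro _ ⟨B, hB, hBd, hBU, rfl⟩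
    refine monSpan_mono ?_ (boundaryMonomial_mem_monSpan B)
    rintro _ ⟨i, hi, rfl⟩
    rw [Set.mem_ofPred_eq, vspan_erase h.girth hB hBd hi, hBU]
  have hQ1 : extDeg K n 1 * Q ≤ monSpan K {F | ¬U ≤ vspan L a F} := by
    refine extDeg_one_mul_le_monSpan (S := {F | ∃ B, B.card = d + 1 ∧ Dep L a B ∧
      vspan L a B ≠ U ∧ ∃ i ∈ B, F = B.erase i}) (Submodule.span_le.2 ?_) ?_
    · rintro _ ⟨B, hB, hBd, hBU, rfl⟩
      refine monSpan_mono ?_ (boundaryMonomial_mem_monSpan B)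
      rintro _ ⟨i, hi, rfl⟩
      exact ⟨B, hB, hBd, hBU, i, hi, rfl⟩
    -- If such a support spanned U as well, its span W would have rank d + 1 and contain both U and
    -- the span of B. Since B has two distinct points outside U, this contradicts
    -- `LinearIdeal.eq_of_notMem`.
    · rintro _ ⟨B, hB, hBd, hBU, i, hi, rfl⟩ j hj hUW
      set W := vspan L a (insert j (B.erase i)) with hW
      have hBW : vspan L a B ≤ W := by
        rw [← vspan_erase h.girth hB hBd hi]; exact vspan_mono (Finset.subset_insert _ _)
      have hWr : finrank L W = d + 1 := by
        have h1 : finrank L W ≤ d + 1 := by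
          refine (finrank_vspan_le (L := L) (a := a)).trans ?_
          rw [Finset.card_insert_of_notMem hj, Finset.card_erase_of_mem hi, hB]
          omega
        have h2 : finrank L U < finrank L W := by
          refine Submodule.finrank_lt_finrank_of_lt (lt_of_le_of_ne hUW ?_)
          intro hUW'
          rw [← hUW'] at hBW
          exact hBU (Submodule.eq_of_le_of_finrank_le hBW
            (by rw [finrank_vspan_circuit h.girth hB hBd, hUr]))
        omega
      have hout : ∀ r ∈ B, ∃ q ∈ B.erase r, a q ∉ U := by
        intro r hr
        by_contra! hall
        refine hBU ?_
        rw [← vspan_erase h.girth hB hBd hr]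
        exact vspan_eq_of_card_eq h.girth hUr.le
          (by rw [Finset.card_erase_of_mem hr, hB]; omega) hall
      obtain ⟨q, hq, hqU⟩ := hout i hi
      obtain ⟨q', hq', hqU'⟩ := hout q (Finset.mem_of_mem_erase hq)
      have hqW := hBW (mem_vspan (Finset.mem_of_mem_erase hq))
      have hqW' := hBW (mem_vspan (Finset.mem_of_mem_erase hq'))
      exact (Finset.mem_erase.1 hq').1
        (h.eq_of_notMem hUr hX hUW hWr hqW' hqW hqU' hqU)
  have h1 : Disjoint (extDeg K n 1 * P) (extDeg K n 1 * Q) := by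
    refine (disjoint_monSpan (K := K) (S := {F | U ≤ vspan L a F})
      (T := {F | ¬U ≤ vspan L a F}) ?_).mono hP1 hQ1
    exact Set.disjoint_left.2 fun F hF hF' => hF' hF
  have hn : d + 1 ≤ n := by
    rw [← hC]; simpa using Finset.card_le_univ C
  -- In degree n the exterior algebra is a line, while both parts are nonzero there because the
  -- socle of E is its top degree.
  have hdis := h.disjoint_extDeg_mul hPd hQd hPJ hQJ hPQ h1 (n - d - 1)
  obtain ⟨m, hm, hm'⟩ : ∃ m, n - d - 1 + 1 = m ∧ d + m = n := ⟨n - d, by omega, by omega⟩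
  rw [hm, Submodule.disjoint_def] at hdis
  have hpos : ∀ {B : Finset (Fin n)}, B.card = d + 1 → B.Nonempty := fun hB =>
    Finset.card_pos.1 (by omega)
  obtain ⟨x, hx, hx0⟩ := exists_ne_zero_extDeg_mul hPd
    (Submodule.subset_span ⟨C, hC, hCd, rfl, rfl⟩) (boundaryMonomial_ne_zero (hpos hC)) m hm'.le
  obtain ⟨y, hy, hy0⟩ := exists_ne_zero_extDeg_mul hQd
    (Submodule.subset_span ⟨C', hC', hCd', hne, rfl⟩) (boundaryMonomial_ne_zero (hpos hC')) m hm'.le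
  obtain ⟨c, rfl⟩ := exists_smul_eq_of_mem_extDeg_top
    (hm' ▸ extDeg_mul_le_extDeg hPd m hx) hx0 (hm' ▸ extDeg_mul_le_extDeg hQd m hy)
  exact hy0 (hdis _ (Submodule.smul_mem _ _ hx) hy)

end Uniqueness

/-! ### Passing from the arrangement to `LinearIdeal`. -/

section Arrangement

theorem three_le_card_of_dep {L V : Type*} [Field L] [AddCommGroup V] [Module L V] {n : ℕ}
    {a : Fin n → V} (h0 : ∀ i, a i ≠ 0) (h : ∀ i j, i ≠ j → a j ∉ Submodule.span L {a i})
    {F : Finset (Fin n)} (hF : Dep L a F) : 3 ≤ F.card := by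
  have h1 := dep_iff.1 hF
  by_contra hc
  obtain ⟨i, hi⟩ : F.Nonempty := Finset.card_pos.1 (by omega)
  have hne : vspan L a F ≠ ⊥ := fun hb => h0 i ((Submodule.mem_bot L).1 (hb ▸ mem_vspan hi))
  have hfin : FiniteDimensional L (vspan L a F) :=
    FiniteDimensional.span_of_finite L (F.finite_toSet.image a)
  have h2 : 0 < finrank L (vspan L a F) := by
    rw [Nat.pos_iff_ne_zero]
    exact fun h3 => hne (Submodule.finrank_eq_zero.1 h3)
  obtain ⟨j, hj, hij⟩ := Finset.exists_mem_ne (by omega : 1 < F.card) i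
  have h3 : Submodule.span L {a i} = vspan L a F := by
    refine Submodule.eq_of_le_of_finrank_le ?_ ?_
    · rw [Submodule.span_singleton_le_iff_mem]; exact mem_vspan hi
    · rw [finrank_span_singleton (h0 i)]; omega
  exact h i j hij.symm (h3 ▸ mem_vspan hj)

theorem exists_smul_eq_of_ker_le {L V : Type*} [Field L] [AddCommGroup V] [Module L V]
    {f g : Dual L V} (h : LinearMap.ker f ≤ LinearMap.ker g) : ∃ c : L, c • f = g := by
  have := mem_span_of_iInf_ker_le_ker (L := fun _ : Unit => f) (K := g) (by simpa using h)
  rw [Set.range_const] at this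
  exact Submodule.mem_span_singleton.1 this

namespace CentralArrangement

variable {n l : ℕ} (𝒜 : CentralArrangement n l)

theorem exists_forms : ∃ a : Fin n → Dual ℂ (Fin l → ℂ), ∀ i, LinearMap.ker (a i) = 𝒜.H i := by
  have key : ∀ i, ∃ f : Dual ℂ (Fin l → ℂ), LinearMap.ker f = 𝒜.H i := by
    intro i
    obtain ⟨f, hf, hle⟩ := Submodule.exists_le_ker_of_lt_top (𝒜.H i)
      (lt_top_iff_ne_top.2 (𝒜.isHyperplane i).1)
    rcases (𝒜.isHyperplane i).le_iff.1 hle with h | h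
    · exact absurd (LinearMap.ker_eq_top.1 h) hf
    · exact ⟨f, h⟩
  choose a ha using key
  exact ⟨a, ha⟩

variable {𝒜} {a : Fin n → Dual ℂ (Fin l → ℂ)}

theorem form_ne_zero (ha : ∀ i, LinearMap.ker (a i) = 𝒜.H i) (i : Fin n) : a i ≠ 0 := by
  intro h
  refine (𝒜.isHyperplane i).1 ?_
  rw [← ha, h, LinearMap.ker_zero]

theorem dependent_iff_dep (ha : ∀ i, LinearMap.ker (a i) = 𝒜.H i) (F : Finset (Fin n)) :
    𝒜.Dependent F ↔ Dep ℂ a F := by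
  constructor
  · rintro ⟨α, hα, hdep⟩ hli
    refine hdep ?_
    have key : ∀ i, ∃ c : ℂˣ, c • a i = α i := by
      intro i
      obtain ⟨c, hc⟩ := exists_smul_eq_of_ker_le (f := a i) (g := α i) (by rw [ha, hα])
      have hc0 : c ≠ 0 := by
        rintro rfl
        exact form_ne_zero hα i (by rw [← hc, zero_smul])
      exact ⟨Units.mk0 c hc0, hc⟩
    choose c hc using key
    have h1 : (fun i : F => α i) = (fun i : F => c i) • fun i : F => a i :=
      funext fun i => (hc i).symm
    rw [h1]
    exact LinearIndependent.units_smul (hli :) _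
  · exact fun h => ⟨a, ha, h⟩

theorem three_le_card (ha : ∀ i, LinearMap.ker (a i) = 𝒜.H i) {F : Finset (Fin n)}
    (hF : Dep ℂ a F) : 3 ≤ F.card := by
  refine three_le_card_of_dep (form_ne_zero ha) (fun i j hij h => hij (𝒜.distinct ?_)) hF
  obtain ⟨c, hc⟩ := Submodule.mem_span_singleton.1 h
  have hle : 𝒜.H i ≤ 𝒜.H j := by
    rw [← ha, ← ha, ← hc]
    intro x hx
    rw [LinearMap.mem_ker] at hx ⊢
    rw [LinearMap.smul_apply, hx, smul_zero]
  exact ((𝒜.isHyperplane i).le_iff.1 hle).resolve_left (𝒜.isHyperplane j).1 |>.symm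

end CentralArrangement

theorem eq_bot_of_homogeneous {K : Type*} [Field K] {n : ℕ} {J : Ideal (ExtAlg K n)}
    (hJ : ∀ k, ∀ x ∈ J, homComp K n k x ∈ J) (h : ∀ k, ∀ x ∈ J, x ∈ extDeg K n k → x = 0) :
    J = ⊥ := by
  refine (Submodule.eq_bot_iff _).2 fun x hx => ?_
  obtain ⟨s, hs⟩ := exists_sum_homComp x
  rw [hs]
  exact Finset.sum_eq_zero fun k _ => h k _ (hJ k x hx) (homComp_mem k x)

/-- Distinct hyperplanes make dependent sets have at least three elements, so J vanishes below
degree 2. Linearity says that J acquires new generators only in degree d, hence J vanishes below d;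
as each ∂e_B is nonzero of degree |B| - 1, every dependent set has more than d elements. -/
theorem linearIdeal_orlikSolomonIdeal {K : Type*} [Field K] [CharZero K] {n l : ℕ}
    {𝒜 : CentralArrangement n l} {a : Fin n → Dual ℂ (Fin l → ℂ)}
    (ha : ∀ i, LinearMap.ker (a i) = 𝒜.H i) {d : ℕ} (hJ : orlikSolomonIdeal K 𝒜 ≠ ⊥)
    (hlin : HasLinearResolution d (orlikSolomonIdeal K 𝒜)) :
    LinearIdeal K ℂ a d (orlikSolomonIdeal K 𝒜) := by
  set J := orlikSolomonIdeal K 𝒜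
  obtain ⟨F, hF⟩ := hlin
  have hhom : ∀ k, ∀ x ∈ J, homComp K n k x ∈ J := fun k x hx => F.homComp_mem_ideal k hx
  have hbd : ∀ B, Dep ℂ a B → boundaryMonomial K B ∈ J := fun B hB =>
    TwoSidedIdeal.mem_asIdeal.2
      (TwoSidedIdeal.subset_span ⟨B, (CentralArrangement.dependent_iff_dep ha B).2 hB, rfl⟩)
  have hle : ∀ (e : ℕ) (P : Submodule K (ExtAlg K n)), (∀ B, Dep ℂ a B → e + 1 ≤ B.card) →
      (∀ B, Dep ℂ a B → B.card = e + 1 → boundaryMonomial K B ∈ P) → J ≤ orderIdeal e P := by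
    intro e P h1 h2
    refine span_asIdeal_le_orderIdeal ?_
    rintro _ ⟨B, hB, rfl⟩
    rw [CentralArrangement.dependent_iff_dep ha] at hB
    have h3 := h1 B hB
    obtain ⟨c, hc⟩ : ∃ c, B.card = c + 1 := ⟨B.card - 1, by omega⟩
    rcases Nat.lt_or_ge e c with h4 | h4
    · exact mem_orderIdeal_of_lt (boundaryMonomial_mem hc) h4
    · obtain rfl : c = e := by omega
      exact mem_orderIdeal_of_eq (boundaryMonomial_mem hc) (h2 B hB hc)
  have hlow : ∀ k < 2, ∀ x ∈ J, x ∈ extDeg K n k → x = 0 := by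
    intro k hk x hx hxk
    have := (hle 2 ⊤ (fun B hB => CentralArrangement.three_le_card ha hB) (fun _ _ _ => trivial)
      hx).1 k hk
    rwa [homComp_same hxk] at this
  have hgen : ∀ k, k + 1 ≠ d → (∀ x ∈ J, x ∈ extDeg K n k → x = 0) →
      ∀ x ∈ J, x ∈ extDeg K n (k + 1) → x = 0 := by
    intro k hk h0 x hx hxk
    obtain ⟨η, hη, hηx⟩ := F.exists_cartan_ideal hF (Pi.basisFun K (Fin n)) 0 hk (fun _ => x)
      (fun _ _ => ⟨hx, hxk⟩) (fun α hα => by omega)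
    rw [← hηx 0 (by simp), cartan]
    refine Finset.sum_eq_zero fun l _ => ?_
    have := hη (0 + Finsupp.single l 1) (by simp)
    rw [h0 _ this.1 this.2, smul_zero]
  have hlt : ∀ k < d, ∀ x ∈ J, x ∈ extDeg K n k → x = 0 := by
    intro k
    induction k with
    | zero => exact fun _ => hlow 0 (by omega)
    | succ k ih => exact fun hk => hgen k (by omega) (ih (by omega))
  -- If d ≤ 1, no generators can appear in degrees at least 2 and there is nothing below, so J would
  -- be zero.
  have hd : 2 ≤ d := by
    by_contra hd
    refine hJ (eq_bot_of_homogeneous hhom fun k => ?_)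
    induction k with
    | zero => exact hlow 0 (by omega)
    | succ k ih =>
      rcases Nat.eq_zero_or_pos k with rfl | hk
      · exact hlow 1 (by omega)
      · exact hgen k (by omega) ih
  have hg : ∀ B, Dep ℂ a B → d + 1 ≤ B.card := by
    intro B hB
    have h3 := CentralArrangement.three_le_card ha hB
    obtain ⟨c, hc⟩ : ∃ c, B.card = c + 1 := ⟨B.card - 1, by omega⟩
    by_contra h4
    exact boundaryMonomial_ne_zero (Finset.card_pos.1 (by omega))
      (hlt c (by omega) _ (hbd B hB) (boundaryMonomial_mem hc))
  refine ⟨hd, hg, hbd, fun x hx hxd => ?_, hlt, hhom, fun b i k hk ω hω hc =>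
    F.exists_cartan_ideal hF b i (k := k) (by omega) ω hω hc⟩
  have := (hle d (Submodule.span K {x | ∃ C, C.card = d + 1 ∧ Dep ℂ a C ∧
    x = boundaryMonomial K C}) hg (fun B hB hc => Submodule.subset_span ⟨B, hc, hB, rfl⟩) hx).2
  rwa [homComp_same hxd] at this

/-- Without circuits of size d + 1 the space J_d is zero, and it generates J. -/
theorem LinearIdeal.exists_dep {K L V : Type*} [Field K] [Field L] [AddCommGroup V] [Module L V]
    {n d : ℕ} {a : Fin n → V} {J : Ideal (ExtAlg K n)} (h : LinearIdeal K L a d J) (hJ : J ≠ ⊥) :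
    ∃ C, C.card = d + 1 ∧ Dep L a C := by
  by_contra! hC
  refine hJ (eq_bot_of_homogeneous h.homComp_mem fun k x hx hxk => ?_)
  rcases Nat.lt_or_ge k d with hk | hk
  · exact h.eq_zero_of_lt k hk x hx hxk
  · obtain ⟨m, rfl⟩ := Nat.exists_eq_add_of_le hk
    have h1 := h.mem_extDeg_mul (S := ⊥) (fun y hy hyd => by
      have h2 := h.mem_span y hy hyd
      rwa [show {x | ∃ C, C.card = d + 1 ∧ Dep L a C ∧ x = boundaryMonomial K C} =
        (∅ : Set (ExtAlg K n)) from Set.eq_empty_of_forall_notMem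
          (by rintro _ ⟨C, h3, h4, -⟩; exact hC C h3 h4), Submodule.span_empty] at h2) m hx hxk
    rwa [Submodule.mul_bot, Submodule.mem_bot] at h1

end Arrangement

/-! ### Regular and singular vectors: the zero-sum space of X. -/

section ZeroSum

variable {K : Type*} [Field K] {n : ℕ}

/-- The vectors with support in `X` and coordinate sum zero. -/
def zeroSum (K : Type*) [Field K] {n : ℕ} (X : Finset (Fin n)) : Submodule K (Fin n → K) where
  carrier := {v | (∀ i ∉ X, v i = 0) ∧ ∑ i, v i = 0}
  zero_mem' := ⟨fun _ _ => rfl, by simp⟩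
  add_mem' := fun {v w} hv hw => ⟨fun i hi => by rw [Pi.add_apply, hv.1 i hi, hw.1 i hi, add_zero],
    by simp only [Pi.add_apply]; rw [Finset.sum_add_distrib, hv.2, hw.2, add_zero]⟩
  smul_mem' := fun c v hv => ⟨fun i hi => by rw [Pi.smul_apply, hv.1 i hi, smul_zero],
    by simp only [Pi.smul_apply]; rw [← Finset.smul_sum, hv.2, smul_zero]⟩

theorem single_sub_single_mem_zeroSum {X : Finset (Fin n)} {i j : Fin n} (hi : i ∈ X)
    (hj : j ∈ X) : (Pi.single i 1 - Pi.single j 1 : Fin n → K) ∈ zeroSum K X := by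
  refine ⟨fun k hk => ?_, ?_⟩
  · rw [Pi.sub_apply, Pi.single_eq_of_ne (by rintro rfl; exact hk hi),
      Pi.single_eq_of_ne (by rintro rfl; exact hk hj), sub_zero]
  · rw [← coordSum_apply, map_sub, coordSum_single, coordSum_single, sub_self]

theorem vec_eq_sum_shearAlg {X : Finset (Fin n)} {o : Fin n} (ho : o ∈ X) {v : Fin n → K}
    (hv : v ∈ zeroSum K X) : vec v =
      ∑ k ∈ X.erase o, v k • shearAlg (X.erase o) o (Finset.notMem_erase o X) (extVar K k) := by
  have h1 : ∑ i ∈ X.erase o, v i + v o = 0 := by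
    rw [Finset.sum_erase_add _ _ ho, ← hv.2]
    exact Finset.sum_subset (Finset.subset_univ _) fun i _ hi => hv.1 i hi
  have h2 : v = ∑ i ∈ X, v i • Pi.single i (1 : K) := by
    conv_lhs => rw [pi_eq_sum_univ' v]
    exact (Finset.sum_subset (Finset.subset_univ _) fun i _ hi => by
      rw [hv.1 i hi, zero_smul]).symm
  conv_lhs => rw [h2, map_sum, ← Finset.sum_erase_add _ _ ho]
  rw [eq_neg_of_add_eq_zero_right h1, neg_smul, map_neg, Finset.sum_smul, map_sum,
    ← sub_eq_add_neg, ← Finset.sum_sub_distrib]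
  refine Finset.sum_congr rfl fun k hk => ?_
  rw [shearAlg_extVar _ hk, map_smul, map_smul, smul_sub]
  rfl

variable {L V : Type*} [Field L] [AddCommGroup V] [Module L V]
  {a : Fin n → V} {d : ℕ} {J : Ideal (ExtAlg K n)}

/-- A form vanishing on zero-sum vectors is constant on the e_i with i ∈ X, so its contraction kills
the generating boundaries. Contraction being an antiderivation, it preserves the ideal they
generate. -/
theorem LinearIdeal.ctr_mem (h : LinearIdeal K L a d J) {X : Finset (Fin n)}
    (hX : ∀ C, C.card = d + 1 → Dep L a C → C ⊆ X) {φ : Dual K (Fin n → K)}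
    (hφ : ∀ v ∈ zeroSum K X, φ v = 0) {x : ExtAlg K n} (hx : x ∈ J) : ctr φ x ∈ J := by
  set S : Submodule K (ExtAlg K n) := Submodule.span K
    {x | ∃ C, C.card = d + 1 ∧ Dep L a C ∧ x = boundaryMonomial K C} with hS
  have hSJ : S ≤ J.restrictScalars K :=
    Submodule.span_le.2 (by rintro _ ⟨C, -, hC, rfl⟩; exact h.boundary_mem C hC)
  have hS0 : ∀ x ∈ S, ctr φ x = 0 := by
    intro x hx
    refine (Submodule.span_le (p := LinearMap.ker (ctr φ))).2 ?_ hx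
    rintro _ ⟨C, hC, hCd, rfl⟩
    obtain ⟨o, ho⟩ : C.Nonempty := Finset.card_pos.1 (by omega)
    refine ctr_boundaryMonomial φ (φ (Pi.single o 1)) C fun i hi => ?_
    have := hφ _ (single_sub_single_mem_zeroSum (hX C hC hCd hi) (hX C hC hCd ho))
    rwa [map_sub, sub_eq_zero] at this
  have hm : ∀ m, ∀ x ∈ extDeg K n m * S, ctr φ x ∈ J := by
    intro m
    induction m with
    | zero =>
      intro x hx
      rw [extDeg_zero_mul] at hx
      rw [hS0 x hx]
      exact zero_mem _
    | succ m ih =>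
      intro x hx
      obtain ⟨p, hp, rfl⟩ := _root_.exists_eq_sum_vec_mul (Pi.basisFun K (Fin n)) hx
      rw [map_sum]
      refine sum_mem fun k _ => ?_
      rw [ctr_vec_mul]
      exact sub_mem ((J.restrictScalars K).smul_mem _ (extDeg_mul_mem_ideal hSJ (hp k)))
        (J.mul_mem_left _ (ih _ (hp k)))
  obtain ⟨s, hs⟩ := exists_sum_homComp x
  rw [hs, map_sum]
  refine sum_mem fun k _ => ?_
  have hk := h.homComp_mem k x hx
  rcases Nat.lt_or_ge k d with hkd | hkd
  · rw [h.eq_zero_of_lt k hkd _ hk (_root_.homComp_mem k x), map_zero]; exact zero_mem _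
  · obtain ⟨m, rfl⟩ := Nat.exists_eq_add_of_le hkd
    exact hm m _ (h.mem_extDeg_mul h.mem_span m hk (_root_.homComp_mem _ x))

/-- With φ(v) = 1, contracting v x ∈ J gives x - v · φ⌟x, which stays in J. -/
theorem LinearIdeal.exists_ctr_of_notMem (h : LinearIdeal K L a d J) {X : Finset (Fin n)}
    (hX : ∀ C, C.card = d + 1 → Dep L a C → C ⊆ X) {v : Fin n → K} (hv : v ∉ zeroSum K X) :
    ∃ φ : Dual K (Fin n → K), ∀ x, vec v * x ∈ J → x - vec v * ctr φ x ∈ J := by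
  obtain ⟨f, hf, hf0⟩ := Submodule.exists_le_ker_of_notMem hv
  refine ⟨(f v)⁻¹ • f, fun x hx => ?_⟩
  have := h.ctr_mem hX (φ := (f v)⁻¹ • f) (fun w hw => by
    rw [LinearMap.smul_apply, LinearMap.mem_ker.1 (hf0 hw), smul_zero]) hx
  rwa [ctr_vec_mul, LinearMap.smul_apply, smul_eq_mul, inv_mul_cancel₀ hf, one_smul] at this

/-- Here v x has degree below d and lies in J, so it is zero, and exactness of multiplication by v
on E applies. -/
theorem LinearIdeal.exists_ctr_of_ne_zero (h : LinearIdeal K L a d J) {v : Fin n → K}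
    (hv : v ≠ 0) {p : ℕ} (hp : p + 2 ≤ d) :
    ∃ φ : Dual K (Fin n → K), ∀ x ∈ extDeg K n p, vec v * x ∈ J → x - vec v * ctr φ x ∈ J := by
  obtain ⟨k, hk⟩ := Function.ne_iff.1 hv
  obtain ⟨φ, hφ⟩ : ∃ φ : Dual K (Fin n → K), φ v = 1 :=
    ⟨(v k)⁻¹ • LinearMap.proj k, inv_mul_cancel₀ hk⟩
  refine ⟨φ, fun x hx hxJ => ?_⟩
  have := ctr_vec_mul φ v x
  rw [h.eq_zero_of_lt (p + 1) (by omega) _ hxJ (vec_mul_mem v hx), map_zero, hφ, one_smul] at this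
  rw [← this]
  exact zero_mem _

/-- The witness w is a product of d - 1 differences e_k - e_o within X. As v is a combination of
such differences, v w is a combination of boundaries of d + 1 points of U, which are dependent. -/
theorem LinearIdeal.exists_of_mem_zeroSum [FiniteDimensional L V] (h : LinearIdeal K L a d J)
    {U : Submodule L V} (hU : finrank L U ≤ d) (hX : d + 1 ≤ (pts a U).card) {v : Fin n → K}
    (hv : v ∈ zeroSum K (pts a U)) :
    ∃ w ∈ extDeg K n (d - 1), vec v * w ∈ J ∧ ∀ y, w - vec v * y ∉ J := by
  have hd := h.two_le
  obtain ⟨e, rfl⟩ : ∃ e, d = e + 1 := ⟨d - 1, by omega⟩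
  rw [Nat.add_sub_cancel]
  obtain ⟨o, ho⟩ : (pts a U).Nonempty := Finset.card_pos.1 (by omega)
  set Z := (pts a U).erase o with hZ
  have ho' : o ∉ Z := Finset.notMem_erase o _
  have hZc : e + 1 ≤ Z.card := by
    rw [hZ, Finset.card_erase_of_mem ho]; omega
  have hvec : vec v = ∑ k ∈ Z, v k • shearAlg Z o ho' (extVar K k) := vec_eq_sum_shearAlg ho hv
  -- The index k₀ is kept out of I, so that the k₀-th contraction will isolate v k₀. For v = 0 any
  -- index of Z serves.
  obtain ⟨k₀, hk₀Z, hk₀⟩ : ∃ k ∈ Z, v ≠ 0 → v k ≠ 0 := by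
    by_cases hv0 : v = 0
    · obtain ⟨k, hk⟩ : Z.Nonempty := Finset.card_pos.1 (by omega)
      exact ⟨k, hk, fun h => absurd hv0 h⟩
    · by_contra! hall
      refine hv0 ((ExteriorAlgebra.ι_eq_zero_iff (R := K) v).1 ?_)
      change vec v = 0
      rw [hvec]
      exact Finset.sum_eq_zero fun k hk => by rw [(hall k hk).2, zero_smul]
  obtain ⟨I, hI, hIc⟩ := Finset.exists_subset_card_eq
    (show e ≤ (Z.erase k₀).card by rw [Finset.card_erase_of_mem hk₀Z]; omega)
  have hIZ : I ⊆ Z := hI.trans (Finset.erase_subset _ _)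
  have hk₀I : k₀ ∉ I := fun hh => Finset.notMem_erase k₀ Z (hI hh)
  have hw : shearAlg Z o ho' (mon K I) ∈ extDeg K n e := by
    have h1 : boundaryMonomial K (insert o I) ∈ extDeg K n e :=
      boundaryMonomial_mem (by rw [Finset.card_insert_of_notMem fun hh => ho' (hIZ hh), hIc])
    rcases shearAlg_mon (K := K) ho' I hIZ with h2 | h2 <;> rw [h2]
    · exact h1
    · exact neg_mem h1
  refine ⟨_, hw, ?_, fun y hy => ?_⟩
  · rw [hvec, Finset.sum_mul]
    refine sum_mem fun k hk => ?_
    rw [smul_mul_assoc, ← map_mul]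
    refine (J.restrictScalars K).smul_mem _ ?_
    by_cases hkI : k ∈ I
    · rw [extVar_mul_mon_of_mem hkI, map_zero]; exact zero_mem _
    · have hsub : insert k I ⊆ Z := Finset.insert_subset hk hIZ
      have h1 : boundaryMonomial K (insert o (insert k I)) ∈ J :=
        h.boundary_mem _ (dep_of_le (Y := U) (fun i hi => by
          rcases Finset.mem_insert.1 hi with rfl | hi
          · exact mem_pts.1 ho
          · exact mem_pts.1 (Finset.mem_of_mem_erase (hsub hi))) (by
          rw [Finset.card_insert_of_notMem fun hh => ho' (hsub hh),
            Finset.card_insert_of_notMem hkI, hIc]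
          omega))
      rcases extVar_mul_mon_of_notMem (K := K) hkI with h3 | h3 <;>
        rcases shearAlg_mon (K := K) ho' _ hsub with h4 | h4 <;>
        simp only [h3, h4, map_neg, neg_neg]
      · exact h1
      · exact neg_mem h1
      · exact neg_mem h1
      · exact h1
  · obtain ⟨c, rfl⟩ : ∃ c, e = c + 1 := ⟨e - 1, by omega⟩
    -- In degree c + 1 = d - 1 the ideal is zero, so membership becomes an equality in E: w equals v
    -- times a homogeneous element.
    have h1 := h.homComp_mem (c + 1) _ hy
    rw [map_sub, homComp_same hw, homComp_mul_left_of_le _ (vec_mem v) (by omega),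
      Nat.add_sub_cancel] at h1
    have h2 := sub_eq_zero.1 (h.eq_zero_of_lt (c + 1) (by omega) _ h1
      (sub_mem hw (vec_mul_mem v (_root_.homComp_mem c y))))
    have hkw : killAlg K Z (shearAlg Z o ho' (mon K I)) = mon K I := killAlg_shearAlg_mon ho' I hIZ
    by_cases hv0 : v = 0
    · rw [hv0, map_zero, zero_mul] at h2
      rw [h2, map_zero] at hkw
      exact mon_ne_zero I hkw.symm
    -- Then v w = 0 in E. Setting the variables outside Z to zero gives (Σ v_k e_k) e_I = 0, and
    -- contraction at k₀ leaves v_{k₀} e_I = 0.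
    · have h3 : vec v * shearAlg Z o ho' (mon K I) = 0 := by
        rw [h2, ← mul_assoc, vec_mul_self, zero_mul]
      have hkv : killAlg K Z (vec v) = vec (∑ k ∈ Z, v k • Pi.single k 1) := by
        rw [hvec, map_sum, map_sum]
        refine Finset.sum_congr rfl fun k hk => ?_
        rw [map_smul, killAlg_shearAlg_extVar ho' hk, map_smul]
        rfl
      have h4 := congrArg (fun x => ctr (LinearMap.proj k₀) (killAlg K Z x)) h3
      simp only [map_mul, hkw, hkv, map_zero, ctr_vec_mul] at h4
      rw [ctr_mon (LinearMap.proj k₀) 0 I (fun i hi => by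
        rw [LinearMap.proj_apply, Pi.single_eq_of_ne (by rintro rfl; exact hk₀I hi)]), zero_smul,
        mul_zero, sub_zero] at h4
      have h5 : (∑ k ∈ Z, v k • Pi.single k (1 : K)) k₀ = v k₀ := by
        simp [Finset.sum_apply, Pi.single_apply, hk₀Z]
      rw [LinearMap.proj_apply, h5] at h4
      rcases smul_eq_zero.1 h4 with h6 | h6
      · exact hk₀ hv0 h6
      · exact mon_ne_zero I h6

end ZeroSum

/-! ### Irreducibility of linear subspaces. -/

section Zariski

variable {K M : Type*} [Field K] [AddCommGroup M] [Module K M]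

theorem isTopologicalBasis_zariskiTopology :
    @TopologicalSpace.IsTopologicalBasis M (zariskiTopology K M)
      {U | ∃ f ∈ polyFunctions K M, U = {w | f w ≠ 0}} := by
  let _ := zariskiTopology K M
  refine ⟨?_, ?_, rfl⟩
  · rintro _ ⟨f, hf, rfl⟩ _ ⟨g, hg, rfl⟩ x ⟨hxf, hxg⟩
    refine ⟨_, ⟨f * g, mul_mem hf hg, rfl⟩, mul_ne_zero hxf hxg, fun y hy => ?_⟩
    exact ⟨left_ne_zero_of_mul hy, right_ne_zero_of_mul hy⟩
  · refine Set.eq_univ_of_forall fun x => ⟨_, ⟨1, one_mem _, rfl⟩, ?_⟩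
    exact one_ne_zero

/-- Polynomial functions are polynomial along lines. -/
theorem exists_polynomial_eval_eq {f : M → K} (hf : f ∈ polyFunctions K M) (x y : M) :
    ∃ p : Polynomial K, ∀ t, p.eval t = f (x + t • y) := by
  refine Algebra.adjoin_induction (p := fun f _ => ∃ p : Polynomial K, ∀ t,
    p.eval t = f (x + t • y)) ?_ ?_ ?_ ?_ hf
  · rintro _ ⟨φ, rfl⟩
    exact ⟨Polynomial.C (φ x) + Polynomial.C (φ y) * Polynomial.X, fun t => by
      rw [Polynomial.eval_add, Polynomial.eval_mul, Polynomial.eval_C, Polynomial.eval_C,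
        Polynomial.eval_X, map_add, map_smul, smul_eq_mul, mul_comm]⟩
  · intro c
    exact ⟨Polynomial.C c, fun t => by simp⟩
  · rintro f g _ _ ⟨p, hp⟩ ⟨q, hq⟩
    exact ⟨p + q, fun t => by simp [hp, hq]⟩
  · rintro f g _ _ ⟨p, hp⟩ ⟨q, hq⟩
    exact ⟨p * q, fun t => by simp [hp, hq]⟩

/-- Two basic open sets meeting the subspace are joined by a line inside it; along this line both
functions are nonzero polynomials, so over an infinite field their product has a nonzero value. -/
theorem isIrreducible_submodule [Infinite K] (W : Submodule K M) :
    @IsIrreducible M (zariskiTopology K M) (W : Set M) := by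
  let _ := zariskiTopology K M
  refine ⟨⟨0, W.zero_mem⟩, fun u v hu hv => ?_⟩
  rintro ⟨x, hxW, hxu⟩ ⟨y, hyW, hyv⟩
  obtain ⟨_, ⟨f, hf, rfl⟩, hxf, hfu⟩ :=
    isTopologicalBasis_zariskiTopology.exists_subset_of_mem_open hxu hu
  obtain ⟨_, ⟨g, hg, rfl⟩, hyg, hgv⟩ :=
    isTopologicalBasis_zariskiTopology.exists_subset_of_mem_open hyv hv
  obtain ⟨p, hp⟩ := exists_polynomial_eval_eq hf x (y - x)
  obtain ⟨q, hq⟩ := exists_polynomial_eval_eq hg x (y - x)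
  have hp0 : p ≠ 0 := by
    rintro rfl
    refine hxf ?_
    simpa using (hp 0).symm
  have hq0 : q ≠ 0 := by
    rintro rfl
    refine hyg ?_
    simpa using (hq 1).symm
  obtain ⟨t, ht⟩ : ∃ t, (p * q).eval t ≠ 0 := by
    by_contra! hall
    exact mul_ne_zero hp0 hq0 (Polynomial.funext fun t => by rw [hall t, Polynomial.eval_zero])
  rw [Polynomial.eval_mul, hp, hq] at ht
  exact ⟨x + t • (y - x), W.add_mem hxW (W.smul_mem t (W.sub_mem hyW hxW)),
    hfu (left_ne_zero_of_mul ht), hgv (right_ne_zero_of_mul ht)⟩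

end Zariski

/-! ### Resonance and rank varieties of E/J. -/

section Quotient

variable {K : Type*} [Field K] {n : ℕ} {J : Ideal (ExtAlg K n)} [J.IsTwoSided]

theorem mem_quotDeg {p : ℕ} {u : ExtAlg K n ⧸ J} :
    u ∈ quotDeg J p ↔ ∃ x ∈ extDeg K n p, Ideal.Quotient.mk J x = u := Iff.rfl

theorem exists_vec_of_mem_quotDeg_one {u : ExtAlg K n ⧸ J} (hu : u ∈ quotDeg J 1) :
    ∃ v : Fin n → K, Ideal.Quotient.mk J (vec v) = u := by
  obtain ⟨x, hx, rfl⟩ := mem_quotDeg.1 hu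
  simp only [extDeg, ExteriorAlgebra.exteriorPower, pow_one] at hx
  obtain ⟨v, rfl⟩ := hx
  exact ⟨v, rfl⟩

theorem mk_vec_mem_quotDeg (v : Fin n → K) : Ideal.Quotient.mk J (vec v) ∈ quotDeg J 1 :=
  mem_quotDeg.2 ⟨_, vec_mem v, rfl⟩

theorem nontrivial_cohomologyOf_iff {u : ExtAlg K n ⧸ J} {p : ℕ} :
    Nontrivial (cohomologyOf J u p) ↔ ∃ c ∈ cocyclesOf J u p, c ∉ coboundariesOf J u p := by
  rw [Submodule.Quotient.nontrivial_iff, Ne, Submodule.submoduleOf_eq_top]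
  exact SetLike.not_le_iff_exists

theorem mk_mul_mk_eq_zero_iff {x y : ExtAlg K n} :
    Ideal.Quotient.mk J x * Ideal.Quotient.mk J y = 0 ↔ x * y ∈ J := by
  rw [← map_mul, Ideal.Quotient.eq_zero_iff_mem]

theorem mk_eq_mk_mul_mk_iff {x y z : ExtAlg K n} :
    Ideal.Quotient.mk J x * Ideal.Quotient.mk J y = Ideal.Quotient.mk J z ↔ z - x * y ∈ J := by
  rw [← map_mul, eq_comm, Ideal.Quotient.mk_eq_mk_iff_sub_mem]

/-- Cohomology vanishes if cocycles are products with their contractions. -/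
theorem not_nontrivial_cohomologyOf {v : Fin n → K} {p : ℕ} {φ : Dual K (Fin n → K)}
    (h : ∀ x ∈ extDeg K n p, vec v * x ∈ J → x - vec v * ctr φ x ∈ J) :
    ¬Nontrivial (cohomologyOf J (Ideal.Quotient.mk J (vec v)) p) := by
  rw [nontrivial_cohomologyOf_iff]
  rintro ⟨c, ⟨hc, hc0⟩, hcb⟩
  obtain ⟨x, hx, rfl⟩ := mem_quotDeg.1 hc
  have h1 := h x hx (mk_mul_mk_eq_zero_iff.1 hc0)
  refine hcb ?_
  cases p with
  | zero =>
    rw [ctr_eq_zero φ hx, mul_zero, sub_zero] at h1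
    rw [Ideal.Quotient.eq_zero_iff_mem.2 h1]
    exact zero_mem _
  | succ p =>
    exact ⟨_, mem_quotDeg.2 ⟨_, ctr_mem φ hx, rfl⟩, mk_eq_mk_mul_mk_iff.2 h1⟩

theorem mem_resonanceVariety_of_exists {v : Fin n → K} {p : ℕ} {w : ExtAlg K n}
    (hw : w ∈ extDeg K n p) (h1 : vec v * w ∈ J) (h2 : ∀ y, w - vec v * y ∉ J) :
    (⟨_, mk_vec_mem_quotDeg v⟩ : quotDeg J 1) ∈ resonanceVariety J p := by
  change Nontrivial (cohomologyOf J (Ideal.Quotient.mk J (vec v)) p)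
  refine nontrivial_cohomologyOf_iff.2 ⟨Ideal.Quotient.mk J w,
    ⟨mem_quotDeg.2 ⟨w, hw, rfl⟩, mk_mul_mk_eq_zero_iff.2 h1⟩, fun hb => ?_⟩
  cases p with
  | zero =>
    refine h2 0 ?_
    rw [mul_zero, sub_zero]
    exact Ideal.Quotient.eq_zero_iff_mem.1 hb
  | succ p =>
    obtain ⟨b, hb, hbw⟩ := hb
    obtain ⟨y, -, rfl⟩ := mem_quotDeg.1 hb
    exact h2 y (mk_eq_mk_mul_mk_iff.1 hbw)

theorem mem_rankVariety_of_exists {v : Fin n → K} {w : ExtAlg K n}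
    (h1 : vec v * w ∈ J) (h2 : ∀ y, w - vec v * y ∉ J) :
    (⟨_, mk_vec_mem_quotDeg v⟩ : quotDeg J 1) ∈ rankVariety J := by
  intro he
  obtain ⟨b, hb⟩ := (Set.ext_iff.1 he (Ideal.Quotient.mk J w)).1 (mk_mul_mk_eq_zero_iff.2 h1)
  obtain ⟨y, rfl⟩ := Ideal.Quotient.mk_surjective b
  exact h2 y (mk_eq_mk_mul_mk_iff.1 hb)

theorem notMem_rankVariety {v : Fin n → K} {φ : Dual K (Fin n → K)} (hv : vec v * vec v ∈ J)
    (h : ∀ x, vec v * x ∈ J → x - vec v * ctr φ x ∈ J) :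
    (⟨_, mk_vec_mem_quotDeg v⟩ : quotDeg J 1) ∉ rankVariety J := by
  refine fun hne => hne (Set.ext fun c => ?_)
  constructor
  · intro hc
    obtain ⟨x, rfl⟩ := Ideal.Quotient.mk_surjective c
    exact ⟨_, mk_eq_mk_mul_mk_iff.2 (h x (mk_mul_mk_eq_zero_iff.1 hc))⟩
  · rintro ⟨b, rfl⟩
    change Ideal.Quotient.mk J (vec v) * (Ideal.Quotient.mk J (vec v) * b) = 0
    rw [← mul_assoc, mk_mul_mk_eq_zero_iff.2 hv, zero_mul]

/-- The degree one elements of the quotient represented by a subspace of vectors. -/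
def quotVec (J : Ideal (ExtAlg K n)) [J.IsTwoSided] (D : Submodule K (Fin n → K)) :
    Submodule K (quotDeg J 1) :=
  (D.map ((Ideal.Quotient.mkₐ K J).toLinearMap ∘ₗ vec)).submoduleOf (quotDeg J 1)

theorem mem_quotVec {D : Submodule K (Fin n → K)} {u : quotDeg J 1} :
    u ∈ quotVec J D ↔ ∃ v ∈ D, Ideal.Quotient.mk J (vec v) = u := Iff.rfl

variable {L V : Type*} [Field L] [AddCommGroup V] [Module L V]
  {a : Fin n → V} {d : ℕ}

theorem LinearIdeal.resonanceVariety_eq_zero (h : LinearIdeal K L a d J) {p : ℕ} (hp : p + 2 ≤ d)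
    (hpn : p ≤ n) : resonanceVariety J p = {0} := by
  ext ⟨u, hu⟩
  rw [Set.mem_singleton_iff]
  constructor
  · intro hR
    obtain ⟨v, rfl⟩ := exists_vec_of_mem_quotDeg_one hu
    by_contra hv
    have hv0 : v ≠ 0 := by
      rintro rfl
      exact hv (Subtype.ext (by simp))
    obtain ⟨φ, hφ⟩ := h.exists_ctr_of_ne_zero hv0 hp
    exact not_nontrivial_cohomologyOf hφ hR
  · intro hu0
    -- For u = 0 the cohomology is A_p itself, which is nonzero because p ≤ n and J has nothing in
    -- degree p.
    obtain ⟨I, -, hI⟩ := Finset.exists_subset_card_eq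
      (show p ≤ (Finset.univ : Finset (Fin n)).card by simpa using hpn)
    have h1 := mem_resonanceVariety_of_exists (J := J) (v := 0) (hI ▸ mon_mem (K := K) I)
      (by rw [map_zero, zero_mul]; exact zero_mem _) (fun y hy => by
        rw [map_zero, zero_mul, sub_zero] at hy
        exact mon_ne_zero I (h.eq_zero_of_lt p (by omega) _ hy (hI ▸ mon_mem I)))
    rw [hu0]
    convert h1
    simp

/-- The dichotomy for v treats both varieties simultaneously: a homotopy outside the zero-sum space
kills all cohomology, and the witness inside it lives in degree d - 1. -/
theorem LinearIdeal.resonanceVariety_eq_and_rankVariety_eq [CharZero K]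
    [FiniteDimensional L V] (h : LinearIdeal K L a d J) {C : Finset (Fin n)} (hC : C.card = d + 1) (hCd : Dep L a C) :
    resonanceVariety J (d - 1) = quotVec J (zeroSum K (pts a (vspan L a C))) ∧
      rankVariety J = quotVec J (zeroSum K (pts a (vspan L a C))) := by
  have hX : ∀ B, B.card = d + 1 → Dep L a B → B ⊆ pts a (vspan L a C) := by
    intro B hB hBd i hi
    rw [mem_pts, ← h.vspan_eq hC hCd hB hBd]
    exact mem_vspan hi
  have hXc : d + 1 ≤ (pts a (vspan L a C)).card := by
    rw [← hC]; exact Finset.card_le_card fun i hi => mem_pts.2 (mem_vspan hi)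
  have hU := (finrank_vspan_circuit h.girth hC hCd).le
  have key : ∀ u : quotDeg J 1, (u ∈ quotVec J (zeroSum K (pts a (vspan L a C))) →
        u ∈ resonanceVariety J (d - 1) ∧ u ∈ rankVariety J) ∧
      (u ∉ quotVec J (zeroSum K (pts a (vspan L a C))) →
        u ∉ resonanceVariety J (d - 1) ∧ u ∉ rankVariety J) := by
    rintro ⟨u, hu⟩
    constructor
    · intro hW
      obtain ⟨v, hv, rfl⟩ := mem_quotVec.1 hW
      obtain ⟨w, hw, h1, h2⟩ := h.exists_of_mem_zeroSum hU hXc hv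
      exact ⟨mem_resonanceVariety_of_exists hw h1 h2, mem_rankVariety_of_exists h1 h2⟩
    · intro hW
      obtain ⟨v, rfl⟩ := exists_vec_of_mem_quotDeg_one hu
      obtain ⟨φ, hφ⟩ := h.exists_ctr_of_notMem hX fun hv => hW (mem_quotVec.2 ⟨v, hv, rfl⟩)
      exact ⟨not_nontrivial_cohomologyOf fun x _ => hφ x,
        notMem_rankVariety (by rw [vec_mul_self]; exact zero_mem _) hφ⟩
  constructor
  · ext u
    exact ⟨fun hu => by_contra fun hW => ((key u).2 hW).1 hu, fun hW => ((key u).1 hW).1⟩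
  · ext u
    exact ⟨fun hu => by_contra fun hW => ((key u).2 hW).2 hu, fun hW => ((key u).1 hW).2⟩

end Quotient

end

theorem proposition4p6 {K : Type*} [Field K] [CharZero K] {n l : ℕ}
    (𝒜 : CentralArrangement n l) (hess : 𝒜.IsEssential) (d : ℕ)
    (hJ : orlikSolomonIdeal K 𝒜 ≠ ⊥)
    (hlin : HasLinearResolution d (orlikSolomonIdeal K 𝒜)) :
    (∀ p : ℕ, p + 2 ≤ d → resonanceVariety (orlikSolomonIdeal K 𝒜) p = {0}) ∧
      resonanceVariety (orlikSolomonIdeal K 𝒜) (d - 1) =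
        rankVariety (orlikSolomonIdeal K 𝒜) ∧
      (∃ W : Submodule K (quotDeg (orlikSolomonIdeal K 𝒜) 1),
        rankVariety (orlikSolomonIdeal K 𝒜) = (W : Set _)) ∧
      @IsIrreducible _ (zariskiTopology K (quotDeg (orlikSolomonIdeal K 𝒜) 1))
        (resonanceVariety (orlikSolomonIdeal K 𝒜) (d - 1)) := by
  obtain ⟨a, ha⟩ := 𝒜.exists_forms
  have h := linearIdeal_orlikSolomonIdeal ha hJ hlin
  obtain ⟨C, hC, hCd⟩ := h.exists_dep hJ
  have hn : d + 1 ≤ n := by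
    rw [← hC]; simpa using Finset.card_le_univ C
  obtain ⟨hR, hV⟩ := h.resonanceVariety_eq_and_rankVariety_eq hC hCd
  refine ⟨fun p hp => h.resonanceVariety_eq_zero hp (by omega), hR.trans hV.symm, ⟨_, hV⟩, ?_⟩
  rw [hR]
  exact isIrreducible_submodule _
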